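/- **Theorem 3.3 (Weak Continuity).** Let $d\ge 3$, $m\ge 0$, let $\Omega\subset\mathbb R^d$ be open and bounded, let $g=(g_{ij})$ be a Riemannian metric of class $C^2$ on $\Omega$, with inverse $(g^{ij})$, Christoffel symbols $\Gamma^k_{ij}=\tfrac12 g^{kl}(\partial_jg_{il}+\partial_ig_{jl}-\partial_lg_{ij})$ and curvature tensor $R_{ijkl}=g_{lm}(\partial_k\Gamma^m_{ij}-\partial_j\Gamma^m_{ik}+\Gamma^n_{ij}\Gamma^m_{nk}-\Gamma^n_{ik}\Gamma^m_{nj})$, and let $2<p<\infty$. Repeated indices are summed; $i,j,k,l,\dots$ run over $1,\dots,d$ and $a,b,c$ over $1,\dots,m$. For $\sigma\in\{1,-1\}$ consider, for $h^a_{ij}=h^a_{ji}$ and $\kappa^a_{kb}=-\kappa^b_{ka}$, the Gauss–Codazzi–Ricci system $$h^a_{ji}h^a_{kl}-h^a_{ki}h^a_{jl}=R_{ijkl},$$ $$\partial_kh^a_{lj}-\partial_lh^a_{kj}+\Gamma^m_{lj}h^a_{km}-\Gamma^m_{kj}h^a_{lm}+\kappa^a_{kb}h^b_{lj}-\kappa^a_{lb}h^b_{kj}=0,$$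 $$\partial_k\kappa^a_{lb}-\partial_l\kappa^a_{kb}-\sigma\, g^{mn}\left(h^a_{ml}h^b_{kn}-h^a_{mk}h^b_{ln}\right)+\kappa^a_{kc}\kappa^c_{lb}-\kappa^a_{lc}\kappa^c_{kb}=0.$$ (The sign $\sigma=-1$ is the one satisfied by immersed submanifolds with the conventions of (ii) below; $\sigma=1$ is also allowed.) A weak solution is a field $(h,\kappa)\in L^2_{\rm loc}(\Omega)$ with these symmetries a.e. that satisfies the three equations in the sense of distributions on $\Omega$. (i) Let $(h^n,\kappa^n)_n$ be a sequence of weak solutions that is uniformly bounded in $L^p(\Omega)$. If it converges weakly in $L^p(\Omega)$ to $(h,\kappa)$, then $(h,\kappa)$ is a weak solution. Moreover, the sequence always has a subsequence that converges weakly in $L^p(\Omega)$, and the limit is a weak solution. (ii) A $W^{2,p}_{\rm loc}$ isometric immersion $y:\Omega\to\mathbb R^{d+m}$ with normal frame $\nu=(\nu_1,\dots,\nu_m)$ and coefficients $(h,\kappa)$ means: $y$ has weak derivatives up to order two, those of order two being in $L^p_{\rm loc}(\Omega)$, the $\nu_a$ have weak first derivatives in $L^p_{\rm loc}(\Omega)$,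 and a.e. in $\Omega$ $$\partial_iy\cdot\partial_jy=g_{ij},\quad \nu_a\cdot\nu_b=\delta_{ab},\quad \partial_iy\cdot\nu_a=0,\quad h^a_{ij}=\partial_i\partial_jy\cdot\nu_a,\quad \kappa^a_{kb}=\partial_k\nu_b\cdot\nu_a .$$ Let $y^n$ be such isometric immersions with normal frames $\nu^n$ and coefficients $(h^n,\kappa^n)$ that are uniformly bounded in $L^p(\Omega)$, and let $y\in L^1_{\rm loc}(\Omega;\mathbb R^{d+m})$ be the limit of $y^n$ in the sense of distributions on $\Omega$. Then $y$ is again a $W^{2,p}_{\rm loc}$ isometric immersion: there are a subsequence along which $(h^n,\kappa^n)$ converges weakly in $L^p(\Omega)$ to some $(h,\kappa)$, and a normal frame $\nu$ of $y$, such that $y$ is a $W^{2,p}_{\rm loc}$ isometric immersion with normal frame $\nu$ and coefficients $(h,\kappa)$. -/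

import Mathlib

open MeasureTheory Filter Topology
open scoped ContDiff ENNReal NNReal

noncomputable section

namespace GCR

/-- Coordinate space `ℝ^d` with its Euclidean norm. -/
abbrev Space (d : ℕ) := EuclideanSpace ℝ (Fin d)

/-- The classical partial derivative `∂f/∂x^k` (used only where `f` is differentiable). -/
def pd {d : ℕ} (k : Fin d) (f : Space d → ℝ) (x : Space d) : ℝ :=
  fderiv ℝ f x (EuclideanSpace.single k 1)

/-- Smooth test functions with compact support in `Ω`. -/
structure IsTest {d : ℕ} (Ω : Set (Space d)) (φ : Space d → ℝ) : Prop where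
  smooth : ContDiff ℝ ∞ φ
  compact : HasCompactSupport φ
  subset : tsupport φ ⊆ Ω

/-- A Riemannian metric of class `C²` on the open set `Ω`, in coordinates. -/
structure IsMetricOn {d : ℕ} (Ω : Set (Space d))
    (g : Space d → Matrix (Fin d) (Fin d) ℝ) : Prop where
  contDiffOn : ∀ i j, ContDiffOn ℝ 2 (fun x => g x i j) Ω
  posDef : ∀ x ∈ Ω, (g x).PosDef

/-- Christoffel symbols `Γ^k_{ij} = ½ g^{kl} (∂_j g_{il} + ∂_i g_{jl} - ∂_l g_{ij})`. -/
def christoffel {d : ℕ} (g : Space d → Matrix (Fin d) (Fin d) ℝ) (k i j : Fin d)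
    (x : Space d) : ℝ :=
  (1 / 2 : ℝ) * ∑ l, (g x)⁻¹ k l *
    (pd j (fun z => g z i l) x + pd i (fun z => g z j l) x - pd l (fun z => g z i j) x)

/-- Riemann curvature tensor
`R_{ijkl} = g_{lm} (∂_k Γ^m_{ij} - ∂_j Γ^m_{ik} + Γ^n_{ij} Γ^m_{nk} - Γ^n_{ik} Γ^m_{nj})`. -/
def riemann {d : ℕ} (g : Space d → Matrix (Fin d) (Fin d) ℝ) (i j k l : Fin d)
    (x : Space d) : ℝ :=
  ∑ m, g x l m *
    (pd k (christoffel g m i j) x - pd j (christoffel g m i k) x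
      + ∑ n, (christoffel g n i j x * christoffel g m n k x
          - christoffel g n i k x * christoffel g m n j x))

/-- A pair `(h, κ)`: `u.h a i j` is `h^a_{ij}` and `u.κ a l b` is `κ^a_{lb}`.  The tangential
indices run over `Fin d`, the normal indices over `Fin m`. -/
structure Field (d m : ℕ) where
  h : Fin m → Fin d → Fin d → Space d → ℝ
  κ : Fin m → Fin d → Fin m → Space d → ℝ

/-- All components of `(h, κ)` are in `L^p(Ω)`. -/
def Field.InLp {d m : ℕ} (Ω : Set (Space d)) (p : ℝ) (u : Field d m) : Prop :=
  (∀ a i j, MemLp (u.h a i j) (ENNReal.ofReal p) (volume.restrict Ω)) ∧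
    ∀ a l b, MemLp (u.κ a l b) (ENNReal.ofReal p) (volume.restrict Ω)

/-- All components of `(h, κ)` have `L^p(Ω)` norm at most `C`. -/
def Field.LpBound {d m : ℕ} (Ω : Set (Space d)) (p : ℝ) (C : ℝ≥0) (u : Field d m) : Prop :=
  (∀ a i j, eLpNorm (u.h a i j) (ENNReal.ofReal p) (volume.restrict Ω) ≤ C) ∧
    ∀ a l b, eLpNorm (u.κ a l b) (ENNReal.ofReal p) (volume.restrict Ω) ≤ C

/-- A sequence of fields lies in `L^p(Ω)` and is uniformly bounded there. -/
def UniformlyBounded {d m : ℕ} (Ω : Set (Space d)) (p : ℝ) (u : ℕ → Field d m) : Prop :=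
  (∀ n, (u n).InLp Ω p) ∧ ∃ C : ℝ≥0, ∀ n, (u n).LpBound Ω p C

/-- Weak convergence of scalar functions in `L^p(Ω)`, `1 < p < ∞`: convergence of the pairings
with every function of the dual space `L^{p/(p-1)}(Ω)`. -/
def WeakLp {d : ℕ} (Ω : Set (Space d)) (p : ℝ) (f : ℕ → Space d → ℝ) (f₀ : Space d → ℝ) :
    Prop :=
  ∀ ψ : Space d → ℝ, MemLp ψ (ENNReal.ofReal (p / (p - 1))) (volume.restrict Ω) →
    Tendsto (fun n => ∫ x in Ω, f n x * ψ x) atTop (𝓝 (∫ x in Ω, f₀ x * ψ x))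

/-- `u₀` is in `L^p(Ω)` and `u n` converges to it weakly in `L^p(Ω)`. -/
structure WeakLimit {d m : ℕ} (Ω : Set (Space d)) (p : ℝ) (u : ℕ → Field d m)
    (u₀ : Field d m) : Prop where
  inLp : u₀.InLp Ω p
  h : ∀ a i j, WeakLp Ω p (fun n => (u n).h a i j) (u₀.h a i j)
  κ : ∀ a l b, WeakLp Ω p (fun n => (u n).κ a l b) (u₀.κ a l b)

/-- `f ∈ L^q_loc(Ω)`. -/
def LpLoc {d : ℕ} {F : Type*} [NormedAddCommGroup F] (Ω : Set (Space d)) (q : ℝ)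
    (f : Space d → F) : Prop :=
  ∀ K : Set (Space d), IsCompact K → K ⊆ Ω → MemLp f (ENNReal.ofReal q) (volume.restrict K)

/-- `(h, κ) ∈ L²_loc(Ω)` is a weak (distributional) solution of the Gauss-Codazzi-Ricci system
of `g`.  The number `σ` (`1` or `-1`) is the sign in front of the `h`-terms of the Ricci
equations. -/
structure IsWeakSolution {d m : ℕ} (Ω : Set (Space d))
    (g : Space d → Matrix (Fin d) (Fin d) ℝ) (σ : ℝ) (u : Field d m) : Prop where
  h_loc : ∀ a i j, LpLoc Ω 2 (u.h a i j)
  κ_loc : ∀ a l b, LpLoc Ω 2 (u.κ a l b)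
  /-- `h^a_{ij} = h^a_{ji}` -/
  symm : ∀ a i j, ∀ᵐ x ∂(volume.restrict Ω), u.h a i j x = u.h a j i x
  /-- `κ^a_{kb} = - κ^b_{ka}` -/
  antisymm : ∀ a k b, ∀ᵐ x ∂(volume.restrict Ω), u.κ a k b x = -u.κ b k a x
  /-- `h^a_{ji} h^a_{kl} - h^a_{ki} h^a_{jl} = R_{ijkl}` -/
  gauss : ∀ i j k l, ∀ φ, IsTest Ω φ →
    ∫ x in Ω, φ x * ∑ a, (u.h a j i x * u.h a k l x - u.h a k i x * u.h a j l x)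
      = ∫ x in Ω, φ x * riemann g i j k l x
  /-- `∂_k h^a_{lj} - ∂_l h^a_{kj} + Γ^m_{lj} h^a_{km} - Γ^m_{kj} h^a_{lm}
  + κ^a_{kb} h^b_{lj} - κ^a_{lb} h^b_{kj} = 0` -/
  codazzi : ∀ a j k l, ∀ φ, IsTest Ω φ →
    ∫ x in Ω, (-(pd k φ x * u.h a l j x) + pd l φ x * u.h a k j x
      + φ x * ((∑ m, (christoffel g m l j x * u.h a k m x
            - christoffel g m k j x * u.h a l m x))
        + ∑ b, (u.κ a k b x * u.h b l j x - u.κ a l b x * u.h b k j x))) = 0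
  /-- `∂_k κ^a_{lb} - ∂_l κ^a_{kb} - σ g^{mn} (h^a_{ml} h^b_{kn} - h^a_{mk} h^b_{ln})
  + κ^a_{kc} κ^c_{lb} - κ^a_{lc} κ^c_{kb} = 0` -/
  ricci : ∀ a b k l, ∀ φ, IsTest Ω φ →
    ∫ x in Ω, (-(pd k φ x * u.κ a l b x) + pd l φ x * u.κ a k b x
      + φ x * (-(σ * ∑ m, ∑ n, (g x)⁻¹ m n *
            (u.h a m l x * u.h b k n x - u.h a m k x * u.h b l n x))
        + ∑ c, (u.κ a k c x * u.κ c l b x - u.κ a l c x * u.κ c k b x))) = 0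

/-- `f'` is the weak partial derivative `∂f/∂x^k` on `Ω` (vector valued). -/
structure HasWeakPartial {d N : ℕ} (Ω : Set (Space d)) (k : Fin d)
    (f f' : Space d → Space N) : Prop where
  left : LocallyIntegrableOn f Ω
  right : LocallyIntegrableOn f' Ω
  eq : ∀ φ, IsTest Ω φ → ∫ x in Ω, pd k φ x • f x = -∫ x in Ω, φ x • f' x

/-- `y : Ω → ℝ^{d+m}` is an isometric immersion of `(Ω, g)` of class `W^{2,p}_loc`, `ν` is an
orthonormal frame of its normal bundle of class `W^{1,p}_loc`, and `u = (h, κ)` consists of the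
coefficients of its second fundamental form and of its normal connection in that frame:
`∂_i y ⬝ ∂_j y = g_{ij}`, `h^a_{ij} = ∂_i ∂_j y ⬝ ν_a`, `κ^a_{kb} = ∂_k ν_b ⬝ ν_a`. -/
def IsIsometricImmersion {d m : ℕ} (Ω : Set (Space d))
    (g : Space d → Matrix (Fin d) (Fin d) ℝ) (p : ℝ) (y : Space d → Space (d + m))
    (ν : Fin m → Space d → Space (d + m)) (u : Field d m) : Prop :=
  ∃ (Dy : Fin d → Space d → Space (d + m)) (DDy : Fin d → Fin d → Space d → Space (d + m))
    (Dν : Fin d → Fin m → Space d → Space (d + m)),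
    (∀ i, HasWeakPartial Ω i y (Dy i)) ∧
    (∀ i j, HasWeakPartial Ω i (Dy j) (DDy i j) ∧ LpLoc Ω p (DDy i j)) ∧
    (∀ k a, HasWeakPartial Ω k (ν a) (Dν k a) ∧ LpLoc Ω p (Dν k a)) ∧
    (∀ᵐ x ∂(volume.restrict Ω),
      (∀ i j, inner ℝ (Dy i x) (Dy j x) = g x i j) ∧
      (∀ a b, inner ℝ (ν a x) (ν b x) = if a = b then (1 : ℝ) else 0) ∧
      (∀ i a, inner ℝ (Dy i x) (ν a x) = 0) ∧
      (∀ a i j, u.h a i j x = inner ℝ (DDy i j x) (ν a x)) ∧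
      (∀ a k b, u.κ a k b x = inner ℝ (Dν k b x) (ν a x)))

/-- Convergence of locally integrable maps in the sense of distributions on `Ω`. -/
structure DistribLimit {d N : ℕ} (Ω : Set (Space d)) (y : ℕ → Space d → Space N)
    (y₀ : Space d → Space N) : Prop where
  seq : ∀ n, LocallyIntegrableOn (y n) Ω
  lim : LocallyIntegrableOn y₀ Ω
  tendsto : ∀ φ, IsTest Ω φ →
    Tendsto (fun n => ∫ x in Ω, φ x • y n x) atTop (𝓝 (∫ x in Ω, φ x • y₀ x))

end GCR

end

/-! The quadratic terms of the Gauss-Codazzi-Ricci system are exterior products of one-forms: for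
fixed `a, j` the form `l ↦ h^a_{lj}`, for fixed `a, b` the form `l ↦ κ^a_{lb}`. Codazzi and Ricci
express the curls of these forms through terms linear in `h` and products of two fields bounded in
`L^p`, `p > 2`. Hence the curls are locally bounded in `L¹`, and weak continuity is a div-curl
statement: if two sequences of forms converge weakly in `L^p` and have curls bounded in `L¹`, their
exterior product converges in the sense of distributions (`tendsto_integral_wedge`, localised in
`BddForms.locConv_wedge`). The remaining terms are linear with continuous coefficients.

The div-curl statement is proved by mollification. At a fixed scale `s`, mollified forms converge
strongly, so everything rests on an error estimate uniform in the sequence (`wedge_defect_le`,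
`exists_wedge_defect_le`). The mollifiers are divergences of truncated Newtonian fields `x
|x|^{-d}`. The difference of two of them is therefore `div G` with `G` curl-free and `‖G‖_{L¹} ≤ C
ε`. Convolving a form `α` with `div G` and exchanging derivatives gives `∇u + w`: here `u = Σ α_i *
G_i` is small in `L¹`, while `w`, a convolution of the curl with `G`, is small in `L¹` and bounded
in `L²` (`exists_hodge_splitting`). The `L²` bound needs no singular integrals: a compactly
supported curl-free field has gradient and divergence of equal `L²` norm (`sum_integral_pd_sq`).
Since the curl of the other form `β` is only in `L¹`, the potential `u` is replaced by a bounded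
smooth truncation before integrating by parts. What remains is bounded in `L²` and small in `L¹` up
to the size of the truncation defect; it is negligible against `β` because `|β|²` is uniformly
integrable, and this is where `p > 2` enters.

Weakly convergent subsequences are extracted in the Hilbert space `L²`; the `L^p` bound passes to
the limit because `L^p` balls are convex and closed in `L²`, and density then upgrades the
convergence to `L^p`.

For immersions, differentiating the constraints on the frame yields the Gauss-Weingarten equations,
in which the derivatives of `(∂y, ν)` are linear in the frame with coefficients `Γ`, `g^{-1} h`,
`h`, `κ` (`IsIsometricImmersion.exists_gaussWeingarten`). The frame is locally bounded with gradient
locally bounded in `L¹`, so its products with weakly convergent sequences converge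
(`locConv_mul_of_weakPD`). The equations and the orthonormality relations thus pass to the limit,
and the limiting equations give back an isometric immersion
(`GaussWeingarten.isIsometricImmersion`). -/

noncomputable section

namespace GCR

section


/-! ### Radial mollifiers and the vector kernels connecting them -/

/-- A smooth step function: `0` for `t ≤ 1/4` and `1` for `t ≥ 1`. -/
def step (t : ℝ) : ℝ := Real.smoothTransition ((t - 1 / 4) * (4 / 3))

lemma step_contDiff : ContDiff ℝ ∞ step := by
  unfold step
  exact Real.smoothTransition.contDiff.comp (by fun_prop)

lemma step_of_le {t : ℝ} (h : t ≤ 1 / 4) : step t = 0 :=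
  Real.smoothTransition.zero_of_nonpos (by linarith)

lemma step_of_ge {t : ℝ} (h : 1 ≤ t) : step t = 1 :=
  Real.smoothTransition.one_of_one_le (by linarith)

lemma step_mono : Monotone step := fun a b h =>
  Real.smoothTransition.monotone (by linarith)

lemma step_nonneg (t : ℝ) : 0 ≤ step t := Real.smoothTransition.nonneg _

lemma step_le_one (t : ℝ) : step t ≤ 1 := Real.smoothTransition.le_one _

lemma step_deriv_nonneg (t : ℝ) : 0 ≤ deriv step t := step_mono.deriv_nonneg

lemma step_deriv_of_gt {t : ℝ} (h : 1 < t) : deriv step t = 0 := by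
  have : step =ᶠ[𝓝 t] fun _ => 1 := by
    filter_upwards [lt_mem_nhds h] with s hs using step_of_ge hs.le
  rw [this.deriv_eq]; simp

/-- Radial profile of the truncated Newtonian field. -/
def prof (d : ℕ) (t : ℝ) : ℝ := t ^ (-(d : ℝ) / 2) * step t

lemma prof_of_le {d : ℕ} {t : ℝ} (h : t ≤ 1 / 4) : prof d t = 0 := by
  simp [prof, step_of_le h]

lemma prof_contDiff (d : ℕ) : ContDiff ℝ ∞ (prof d) := by
  rw [contDiff_iff_contDiffAt]
  intro t
  by_cases h : t < 1 / 4
  · have : prof d =ᶠ[𝓝 t] fun _ => 0 := by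
      filter_upwards [gt_mem_nhds h] with s hs using prof_of_le hs.le
    exact contDiffAt_const.congr_of_eventuallyEq this
  · have ht : t ≠ 0 := by intro h0; apply h; rw [h0]; norm_num
    exact (contDiffAt_id.rpow_const_of_ne ht).mul step_contDiff.contDiffAt

lemma prof_hasDerivAt {d : ℕ} {t : ℝ} (ht : 0 < t) :
    HasDerivAt (prof d)
      (-(d : ℝ) / 2 * t ^ (-(d : ℝ) / 2 - 1) * step t + t ^ (-(d : ℝ) / 2) * deriv step t) t := by
  have h1 := Real.hasDerivAt_rpow_const (x := t) (p := -(d : ℝ) / 2) (Or.inl ht.ne')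
  have h2 : HasDerivAt step (deriv step t) t :=
    ((step_contDiff.differentiable (by simp)) t).hasDerivAt
  exact h1.mul h2

/-- Profile of the divergence of the truncated Newtonian field. -/
def divProf (d : ℕ) (t : ℝ) : ℝ := d * prof d t + 2 * t * deriv (prof d) t

lemma divProf_contDiff (d : ℕ) : ContDiff ℝ ∞ (divProf d) := by
  unfold divProf
  have : ContDiff ℝ ∞ (deriv (prof d)) := by
    have := prof_contDiff d
    rw [contDiff_infty_iff_deriv] at this
    exact this.2
  have h2 := prof_contDiff d
  fun_prop

/-- The field `x |x|^{-d}` is divergence-free away from the origin, so the derivative of the power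
cancels `d * prof` and only the derivative of the cut-off survives. This gives the sign and the
support of the mollifier. -/
lemma divProf_eq {d : ℕ} {t : ℝ} (ht : 0 < t) :
    divProf d t = 2 * t * t ^ (-(d : ℝ) / 2) * deriv step t := by
  rw [divProf, (prof_hasDerivAt ht).deriv, prof]
  have : t ^ (-(d : ℝ) / 2) = t * t ^ (-(d : ℝ) / 2 - 1) := by
    rw [Real.rpow_sub_one ht.ne']; field_simp
  rw [this]; ring

lemma divProf_of_lt {d : ℕ} {t : ℝ} (ht : t < 1 / 4) : divProf d t = 0 := by
  have : prof d =ᶠ[𝓝 t] fun _ => 0 := by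
    filter_upwards [gt_mem_nhds ht] with s hs using prof_of_le hs.le
  rw [divProf, this.deriv_eq, this.eq_of_nhds]; simp

lemma divProf_nonneg (d : ℕ) (t : ℝ) : 0 ≤ divProf d t := by
  by_cases h : t < 1 / 4
  · rw [divProf_of_lt h]
  · have ht : 0 < t := by linarith
    rw [divProf_eq ht]
    have := step_deriv_nonneg t
    positivity

lemma divProf_of_gt {d : ℕ} {t : ℝ} (h : 1 < t) : divProf d t = 0 := by
  rw [divProf_eq (by linarith), step_deriv_of_gt h, mul_zero]

/-- The mean value theorem supplies a point where `step` has the slope of its chord. A nonzero value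
is what makes the total mass positive, so that it can be normalised to one. -/
lemma exists_divProf_pos (d : ℕ) : ∃ t, 0 < t ∧ divProf d t ≠ 0 := by
  obtain ⟨t, ht, h⟩ := exists_deriv_eq_slope step (a := 1 / 4) (b := 1) (by norm_num)
    step_contDiff.continuous.continuousOn
    ((step_contDiff.differentiable (by simp)).differentiableOn)
  have ht0 : (0 : ℝ) < t := lt_trans (by norm_num) ht.1
  refine ⟨t, ht0, ?_⟩
  rw [divProf_eq ht0, h, step_of_le le_rfl, step_of_ge le_rfl]
  positivity

/-! ### Partial derivatives and the truncated Newtonian field -/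

variable {d : ℕ}

lemma pd_coord (i j : Fin d) (x : Space d) :
    pd j (fun y : Space d => y i) x = if i = j then 1 else 0 := by
  have h : HasFDerivAt (fun y : Space d => y i) (EuclideanSpace.proj i : Space d →L[ℝ] ℝ) x :=
    (EuclideanSpace.proj i : Space d →L[ℝ] ℝ).hasFDerivAt
  rw [pd, h.fderiv]
  simp

lemma pd_mul {f g : Space d → ℝ} {x : Space d} (hf : DifferentiableAt ℝ f x)
    (hg : DifferentiableAt ℝ g x) (k : Fin d) :
    pd k (fun y => f y * g y) x = pd k f x * g x + f x * pd k g x := by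
  unfold pd
  rw [fderiv_fun_mul hf hg]
  simp only [_root_.add_apply, _root_.smul_apply, smul_eq_mul]
  ring

lemma pd_sub {f g : Space d → ℝ} {x : Space d} (hf : DifferentiableAt ℝ f x)
    (hg : DifferentiableAt ℝ g x) (k : Fin d) :
    pd k (fun y => f y - g y) x = pd k f x - pd k g x := by
  unfold pd
  rw [fderiv_fun_sub hf hg]
  simp only [_root_.sub_apply]

lemma pd_const_mul {f : Space d → ℝ} {x : Space d} (hf : DifferentiableAt ℝ f x) (c : ℝ)
    (k : Fin d) : pd k (fun y => c * f y) x = c * pd k f x := by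
  unfold pd
  rw [fderiv_const_mul hf]
  simp

lemma pd_sum {ι : Type*} {s : Finset ι} {f : ι → Space d → ℝ} {x : Space d}
    (hf : ∀ i ∈ s, DifferentiableAt ℝ (f i) x) (k : Fin d) :
    pd k (fun y => ∑ i ∈ s, f i y) x = ∑ i ∈ s, pd k (f i) x := by
  unfold pd
  rw [fderiv_fun_sum hf]
  simp

lemma pd_comp {f : Space d → ℝ} {θ : ℝ → ℝ} {x : Space d} (hθ : DifferentiableAt ℝ θ (f x))
    (hf : DifferentiableAt ℝ f x) (k : Fin d) :
    pd k (fun y => θ (f y)) x = deriv θ (f x) * pd k f x := by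
  have h := (hθ.hasDerivAt.comp_hasFDerivAt x hf.hasFDerivAt).fderiv
  unfold pd
  have h2 : (fun y => θ (f y)) = θ ∘ f := rfl
  rw [h2, h]; simp

lemma pd_normSq (j : Fin d) (x : Space d) : pd j (fun y : Space d => ‖y‖ ^ 2) x = 2 * x j := by
  have h : HasFDerivAt (fun y : Space d => ‖y‖ ^ 2) (2 • innerSL ℝ x) x :=
    (hasStrictFDerivAt_norm_sq x).hasFDerivAt
  rw [pd, h.fderiv]
  simp [EuclideanSpace.inner_single_right]

lemma contDiff_pd {f : Space d → ℝ} {n m : WithTop ℕ∞} (hf : ContDiff ℝ n f) (h : m + 1 ≤ n)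
    (k : Fin d) : ContDiff ℝ m (pd k f) := by
  unfold pd
  exact (hf.fderiv_right h).clm_apply contDiff_const

lemma contDiff_pd_infty {f : Space d → ℝ} (hf : ContDiff ℝ ∞ f) (k : Fin d) :
    ContDiff ℝ ∞ (pd k f) := contDiff_pd hf (by simp) k

lemma tsupport_pd_subset (f : Space d → ℝ) (k : Fin d) : tsupport (pd k f) ⊆ tsupport f := by
  apply closure_minimal _ (isClosed_tsupport f)
  intro x hx
  apply support_fderiv_subset ℝ
  intro h
  apply hx
  simp [pd, h]

lemma hasCompactSupport_pd {f : Space d → ℝ} (hf : HasCompactSupport f) (k : Fin d) :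
    HasCompactSupport (pd k f) :=
  hf.mono' (subset_closure.trans (tsupport_pd_subset f k))

/-- The Newtonian field truncated at scale `s`. -/
def newt (d : ℕ) (s : ℝ) (i : Fin d) (x : Space d) : ℝ :=
  x i * ((s ^ d)⁻¹ * prof d ((s ^ 2)⁻¹ * ‖x‖ ^ 2))

/-- Its divergence. -/
def divNewt (d : ℕ) (s : ℝ) (x : Space d) : ℝ := (s ^ d)⁻¹ * divProf d ((s ^ 2)⁻¹ * ‖x‖ ^ 2)

lemma prof_comp_contDiff (s : ℝ) :
    ContDiff ℝ ∞ (fun x : Space d => (s ^ d)⁻¹ * prof d ((s ^ 2)⁻¹ * ‖x‖ ^ 2)) :=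
  contDiff_const.mul ((prof_contDiff d).comp (contDiff_const.mul (contDiff_norm_sq ℝ)))

lemma contDiff_coord (i : Fin d) : ContDiff ℝ ∞ (fun x : Space d => x i) :=
  (EuclideanSpace.proj i : Space d →L[ℝ] ℝ).contDiff

lemma newt_contDiff (s : ℝ) (i : Fin d) : ContDiff ℝ ∞ (newt d s i) :=
  (contDiff_coord i).mul (prof_comp_contDiff s)

lemma divNewt_contDiff (s : ℝ) : ContDiff ℝ ∞ (divNewt d s) :=
  contDiff_const.mul ((divProf_contDiff d).comp (contDiff_const.mul (contDiff_norm_sq ℝ)))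

lemma pd_prof_comp (s : ℝ) (j : Fin d) (x : Space d) :
    pd j (fun x : Space d => (s ^ d)⁻¹ * prof d ((s ^ 2)⁻¹ * ‖x‖ ^ 2)) x
      = (s ^ d)⁻¹ * (deriv (prof d) ((s ^ 2)⁻¹ * ‖x‖ ^ 2) * ((s ^ 2)⁻¹ * (2 * x j))) := by
  have h1 : DifferentiableAt ℝ (fun y : Space d => ‖y‖ ^ 2) x :=
    (contDiff_norm_sq ℝ (n := 1)).differentiable (by simp) x
  have h2 : DifferentiableAt ℝ (fun y : Space d => (s ^ 2)⁻¹ * ‖y‖ ^ 2) x := h1.const_mul _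
  have h3 : DifferentiableAt ℝ (prof d) ((s ^ 2)⁻¹ * ‖x‖ ^ 2) :=
    (prof_contDiff d).differentiable (by simp) _
  rw [pd_const_mul (f := fun x : Space d => prof d ((s ^ 2)⁻¹ * ‖x‖ ^ 2)) (h3.fun_comp' x h2),
    pd_comp (f := fun x : Space d => (s ^ 2)⁻¹ * ‖x‖ ^ 2) h3 h2, pd_const_mul h1, pd_normSq]

lemma pd_newt (s : ℝ) (i j : Fin d) (x : Space d) :
    pd j (newt d s i) x = (if i = j then 1 else 0) * ((s ^ d)⁻¹ * prof d ((s ^ 2)⁻¹ * ‖x‖ ^ 2))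
      + x i * ((s ^ d)⁻¹ * (deriv (prof d) ((s ^ 2)⁻¹ * ‖x‖ ^ 2) * ((s ^ 2)⁻¹ * (2 * x j)))) := by
  have h := pd_mul (x := x) ((contDiff_coord i).differentiable (by simp) x)
    ((prof_comp_contDiff (d := d) s).differentiable (by simp) x) j
  rw [pd_prof_comp, pd_coord] at h
  exact h

/-- A radial function times `x` is a gradient; in coordinates, the off-diagonal part of its
derivative is a multiple of `x i * x j`. -/
lemma pd_newt_symm (s : ℝ) (i j : Fin d) (x : Space d) :
    pd j (newt d s i) x = pd i (newt d s j) x := by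
  rw [pd_newt, pd_newt]
  simp only [eq_comm (a := i)]
  ring

lemma sum_pd_newt (s : ℝ) (x : Space d) : ∑ i, pd i (newt d s i) x = divNewt d s x := by
  simp only [pd_newt, if_true, one_mul, Finset.sum_add_distrib]
  rw [Finset.sum_const, Finset.card_univ, Fintype.card_fin, nsmul_eq_mul, divNewt, divProf]
  have : ∀ i : Fin d, x i * ((s ^ d)⁻¹ * (deriv (prof d) ((s ^ 2)⁻¹ * ‖x‖ ^ 2) *
      ((s ^ 2)⁻¹ * (2 * x i)))) = (2 * (s ^ d)⁻¹ * (s ^ 2)⁻¹ *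
        deriv (prof d) ((s ^ 2)⁻¹ * ‖x‖ ^ 2)) * (x i ^ 2) := fun i => by ring
  simp only [this, ← Finset.mul_sum]
  rw [← EuclideanSpace.real_norm_sq_eq]
  ring

/-- The scale drops out once the cut-off equals one. Fields truncated at two scales therefore agree
outside the larger ball, and their difference has compact support. -/
lemma newt_eq_of_le {s : ℝ} (hs : 0 < s) {x : Space d} (hx : s ≤ ‖x‖) (i : Fin d) :
    newt d s i x = x i * ‖x‖ ^ (-(d : ℝ)) := by
  have h1 : 1 ≤ (s ^ 2)⁻¹ * ‖x‖ ^ 2 := by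
    rw [← div_eq_inv_mul, one_le_div (by positivity)]
    gcongr
  have hx0 : 0 < ‖x‖ := hs.trans_le hx
  rw [newt, prof, step_of_ge h1, mul_one]
  congr 1
  rw [Real.mul_rpow (by positivity) (by positivity), Real.inv_rpow (by positivity),
    ← Real.rpow_natCast s 2, ← Real.rpow_natCast ‖x‖ 2, ← Real.rpow_mul hs.le,
    ← Real.rpow_mul hx0.le, ← Real.rpow_natCast s d, ← Real.rpow_neg hs.le, ← Real.rpow_neg hs.le,
    ← mul_assoc, ← Real.rpow_add hs]
  have : -(d : ℝ) + -(((2 : ℕ) : ℝ) * (-(d : ℝ) / 2)) = 0 := by push_cast; ring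
  rw [this, Real.rpow_zero, one_mul]
  congr 1
  push_cast; ring

/-- The majorant does not see the scale; this is the source of the `L¹` bound on the kernels uniform
in `δ`. -/
lemma newt_bounds {s : ℝ} (hs : 0 < s) (x : Space d) :
    0 ≤ (s ^ d)⁻¹ * prof d ((s ^ 2)⁻¹ * ‖x‖ ^ 2) ∧
      (s ^ d)⁻¹ * prof d ((s ^ 2)⁻¹ * ‖x‖ ^ 2) ≤ ‖x‖ ^ (-(d : ℝ)) := by
  have h0 : 0 ≤ ((s ^ 2)⁻¹ * ‖x‖ ^ 2) ^ (-(d : ℝ) / 2) := by positivity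
  constructor
  · have := step_nonneg ((s ^ 2)⁻¹ * ‖x‖ ^ 2)
    unfold prof; positivity
  · rcases eq_or_ne x 0 with rfl | hx
    · rw [norm_zero]; rw [prof_of_le (by norm_num)]; simp
    have hx0 : 0 < ‖x‖ := norm_pos_iff.2 hx
    have : (s ^ d)⁻¹ * ((s ^ 2)⁻¹ * ‖x‖ ^ 2) ^ (-(d : ℝ) / 2) = ‖x‖ ^ (-(d : ℝ)) := by
      rw [Real.mul_rpow (by positivity) (by positivity), Real.inv_rpow (by positivity),
        ← Real.rpow_natCast s 2, ← Real.rpow_natCast ‖x‖ 2, ← Real.rpow_mul hs.le,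
        ← Real.rpow_mul hx0.le, ← Real.rpow_natCast s d, ← Real.rpow_neg hs.le,
        ← Real.rpow_neg hs.le, ← mul_assoc, ← Real.rpow_add hs]
      have : -(d : ℝ) + -(((2 : ℕ) : ℝ) * (-(d : ℝ) / 2)) = 0 := by push_cast; ring
      rw [this, Real.rpow_zero, one_mul]
      congr 1
      push_cast; ring
    rw [← this, prof]
    gcongr
    exact mul_le_of_le_one_right h0 (step_le_one _)

lemma divNewt_nonneg {s : ℝ} (hs : 0 < s) (x : Space d) : 0 ≤ divNewt d s x := by
  have := divProf_nonneg d ((s ^ 2)⁻¹ * ‖x‖ ^ 2)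
  unfold divNewt; positivity

lemma divNewt_of_gt {s : ℝ} (hs : 0 < s) {x : Space d} (hx : s < ‖x‖) : divNewt d s x = 0 := by
  rw [divNewt, divProf_of_gt, mul_zero]
  rw [← div_eq_inv_mul, one_lt_div (by positivity)]
  gcongr

lemma divNewt_hasCompactSupport {s : ℝ} (hs : 0 < s) : HasCompactSupport (divNewt d s) :=
  HasCompactSupport.intro (isCompact_closedBall (0 : Space d) s) fun x hx =>
    divNewt_of_gt hs (by simpa using hx)

/-- The prefactor `(s ^ d)⁻¹` is the Jacobian of the dilation by `s`, so a single normalising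
constant serves all scales. -/
lemma integral_divNewt {s : ℝ} (hs : 0 < s) :
    ∫ x, divNewt d s x = ∫ x, divNewt d 1 x := by
  have h : ∀ x : Space d, divNewt d s x = (s ^ d)⁻¹ * divNewt d 1 (s⁻¹ • x) := by
    intro x
    simp only [divNewt, norm_smul, one_pow, inv_one, one_mul, Real.norm_eq_abs, mul_pow, sq_abs,
      inv_pow]
  simp only [h]
  rw [integral_const_mul, Measure.integral_comp_inv_smul]
  rw [finrank_euclideanSpace, Fintype.card_fin, abs_of_pos (by positivity), smul_eq_mul,
    ← mul_assoc, inv_mul_cancel₀ (by positivity), one_mul]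

lemma integral_divNewt_pos (hd : 0 < d) : 0 < ∫ x, divNewt d 1 x := by
  obtain ⟨t, ht, h⟩ := exists_divProf_pos d
  refine (divNewt_contDiff 1).continuous.integral_pos_of_hasCompactSupport_nonneg_nonzero
    (divNewt_hasCompactSupport one_pos) (fun x => divNewt_nonneg one_pos x)
    (x := EuclideanSpace.single (⟨0, hd⟩ : Fin d) (√t)) ?_
  simp [divNewt, Real.sq_sqrt ht.le, h]

/-- In polar coordinates the weight `r ^ (d - 1)` cancels the singularity `r ^ (1 - d)` exactly,
leaving the length of the interval up to `ε`. Hence the kernels have `L¹` norm linear in `ε`. -/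
lemma integrable_norm_rpow_ball (hd : 0 < d) (ε : ℝ) :
    Integrable (fun x : Space d => (Set.Iic ε).indicator (fun r => r * r ^ (-(d : ℝ))) ‖x‖) ∧
    ∫ x : Space d, (Set.Iic ε).indicator (fun r => r * r ^ (-(d : ℝ))) ‖x‖
      = d * (volume.real (Metric.ball (0 : Space d) 1) * max ε 0) := by
  have : Nonempty (Fin d) := ⟨⟨0, hd⟩⟩
  have : Nontrivial (Space d) := inferInstance
  have hf : Module.finrank ℝ (Space d) = d := by simp
  have key : ∀ r ∈ Set.Ioi (0 : ℝ), r ^ (d - 1) * (Set.Iic ε).indicator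
      (fun r => r * r ^ (-(d : ℝ))) r = (Set.Iic ε).indicator (fun _ => (1 : ℝ)) r := by
    intro r hr
    have hr : (0 : ℝ) < r := hr
    by_cases h : r ∈ Set.Iic ε
    · simp only [Set.indicator_of_mem h]
      rw [← mul_assoc, ← pow_succ, Nat.sub_add_cancel hd, Real.rpow_neg hr.le, Real.rpow_natCast,
        mul_inv_cancel₀ (by positivity)]
    · simp [Set.indicator_of_notMem h]
  have hi : IntegrableOn ((Set.Iic ε).indicator (fun _ => (1 : ℝ))) (Set.Ioi 0) := by
    rw [IntegrableOn, integrable_indicator_iff measurableSet_Iic, IntegrableOn,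
      Measure.restrict_restrict measurableSet_Iic, Set.inter_comm, Set.Ioi_inter_Iic]
    exact integrableOn_const (by simp)
  constructor
  · rw [integrable_fun_norm_addHaar volume (f := (Set.Iic ε).indicator
      (fun r => r * r ^ (-(d : ℝ)))), hf]
    refine (integrableOn_congr_fun (fun r hr => ?_) measurableSet_Ioi).2 hi
    exact key r hr
  · rw [integral_fun_norm_addHaar volume ((Set.Iic ε).indicator (fun r => r * r ^ (-(d : ℝ)))), hf]
    simp only [smul_eq_mul, nsmul_eq_mul]
    rw [setIntegral_congr_fun measurableSet_Ioi key, setIntegral_indicator measurableSet_Iic,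
      Set.Ioi_inter_Iic]
    simp [Real.volume_real_Ioc]

/-- Mollifiers `η s` at every scale `s`, together with curl-free kernels whose divergence is
`η ε - η δ` and whose `L¹` norm is at most `C * ε`, uniformly in `δ`. -/
structure IsMollifierFamily (η : ℝ → Space d → ℝ) (C : ℝ) : Prop where
  const_nonneg : 0 ≤ C
  smooth : ∀ s, 0 < s → ContDiff ℝ ∞ (η s)
  nonneg : ∀ s, 0 < s → ∀ x, 0 ≤ η s x
  zero_of_lt : ∀ s, 0 < s → ∀ x, s < ‖x‖ → η s x = 0
  integral_eq_one : ∀ s, 0 < s → ∫ x, η s x = 1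
  exists_kernel : ∀ δ ε, 0 < δ → δ ≤ ε → ∃ G : Fin d → Space d → ℝ,
    (∀ i, ContDiff ℝ ∞ (G i)) ∧ (∀ i, HasCompactSupport (G i)) ∧
    (∀ i j x, pd j (G i) x = pd i (G j) x) ∧
    (∀ x, ∑ i, pd i (G i) x = η ε x - η δ x) ∧
    ∀ i, ∫ x, |G i x| ≤ C * ε

lemma hasCompactSupport_of_zero_of_lt {f : Space d → ℝ} {s : ℝ} (h : ∀ x, s < ‖x‖ → f x = 0) :
    HasCompactSupport f :=
  HasCompactSupport.intro (isCompact_closedBall (0 : Space d) s) fun x hx => h x (by simpa using hx)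

/-- The mollifier is the divergence of the truncated Newtonian field divided by its mass, and the
connecting kernel is the difference of the fields at the two scales divided by the same mass. -/
theorem exists_isMollifierFamily (hd : 0 < d) :
    ∃ (η : ℝ → Space d → ℝ) (C : ℝ), IsMollifierFamily η C := by
  set c := ∫ x, divNewt d 1 x with hc
  have hc0 : 0 < c := integral_divNewt_pos hd
  refine ⟨fun s x => c⁻¹ * divNewt d s x,
    c⁻¹ * (d * volume.real (Metric.ball (0 : Space d) 1)), by positivity,
    fun s hs => contDiff_const.mul (divNewt_contDiff s), fun s hs x => ?_, fun s hs x hx => ?_,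
    fun s hs => ?_, ?_⟩
  · have := divNewt_nonneg hs x; positivity
  · simp [divNewt_of_gt hs hx]
  · rw [integral_const_mul, integral_divNewt hs, ← hc, inv_mul_cancel₀ hc0.ne']
  · intro δ ε hδ hδε
    have hε : 0 < ε := hδ.trans_le hδε
    have hdiff : ∀ s i x, DifferentiableAt ℝ (newt d s i) x := fun s i x =>
      (newt_contDiff s i).differentiable (by simp) x
    have hpd : ∀ i j x, pd j (fun x => c⁻¹ * (newt d ε i x - newt d δ i x)) x
        = c⁻¹ * (pd j (newt d ε i) x - pd j (newt d δ i) x) := by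
      intro i j x
      rw [pd_const_mul ((hdiff ε i x).fun_sub (hdiff δ i x)), pd_sub (hdiff _ _ _) (hdiff _ _ _)]
    have hzero : ∀ i (x : Space d), ε < ‖x‖ → newt d ε i x - newt d δ i x = 0 := by
      intro i x hx
      rw [newt_eq_of_le hε hx.le, newt_eq_of_le hδ (hδε.trans hx.le), sub_self]
    refine ⟨fun i x => c⁻¹ * (newt d ε i x - newt d δ i x), fun i => ?_,
      fun i => hasCompactSupport_of_zero_of_lt (s := ε) fun x hx => ?_,
      fun i j x => ?_, fun x => ?_, fun i => ?_⟩
    · exact contDiff_const.mul ((newt_contDiff ε i).sub (newt_contDiff δ i))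
    · simp [hzero i x hx]
    · rw [hpd, hpd, pd_newt_symm, pd_newt_symm δ]
    · simp only [hpd]
      rw [← Finset.mul_sum, Finset.sum_sub_distrib, sum_pd_newt, sum_pd_newt, mul_sub]
    · obtain ⟨h1, h2⟩ := integrable_norm_rpow_ball hd ε
      have hle : ∀ x, |c⁻¹ * (newt d ε i x - newt d δ i x)| ≤
          c⁻¹ * (Set.Iic ε).indicator (fun r => r * r ^ (-(d : ℝ))) ‖x‖ := by
        intro x
        rw [abs_mul, abs_of_pos (inv_pos.2 hc0)]
        gcongr
        by_cases hx : ‖x‖ ≤ ε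
        · rw [Set.indicator_of_mem (by exact hx), newt, newt, ← mul_sub, abs_mul]
          have hb1 := newt_bounds (d := d) hε x
          have hb2 := newt_bounds (d := d) hδ x
          gcongr
          · exact PiLp.norm_apply_le x i
          -- Both radial factors lie between `0` and `‖x‖ ^ (-d)`, so their difference costs no
          -- factor two.
          · rw [abs_le]; constructor <;> linarith [hb1.1, hb1.2, hb2.1, hb2.2]
        · rw [hzero i x (not_le.1 hx), abs_zero, Set.indicator_of_notMem (by exact hx)]
      calc ∫ x, |c⁻¹ * (newt d ε i x - newt d δ i x)|
          ≤ ∫ x : Space d, c⁻¹ * (Set.Iic ε).indicator (fun r => r * r ^ (-(d : ℝ))) ‖x‖ := by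
            apply integral_mono_of_nonneg (Eventually.of_forall fun x => abs_nonneg _)
              (h1.const_mul _) (Eventually.of_forall hle)
        _ = _ := by rw [integral_const_mul, h2, max_eq_left hε.le]; ring

end

section


variable {d : ℕ}

/-! ### Convolution with smooth compactly supported kernels -/

/-- Convolution of scalar functions. -/
def cv (f K : Space d → ℝ) : Space d → ℝ :=
  convolution f K (ContinuousLinearMap.mul ℝ ℝ) volume

lemma cv_apply (f K : Space d → ℝ) (x : Space d) : cv f K x = ∫ t, f t * K (x - t) := rfl

lemma integrable_cv_integrand {f K : Space d → ℝ} (hf : LocallyIntegrable f)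
    (hK : Continuous K) (hKc : HasCompactSupport K) (x : Space d) :
    Integrable fun t => f t * K (x - t) :=
  hKc.convolutionExists_right (ContinuousLinearMap.mul ℝ ℝ) hf hK x

lemma cv_contDiff {f K : Space d → ℝ} (hf : LocallyIntegrable f) (hK : ContDiff ℝ ∞ K)
    (hKc : HasCompactSupport K) : ContDiff ℝ ∞ (cv f K) :=
  hKc.contDiff_convolution_right _ hf hK

lemma cv_hasCompactSupport {f K : Space d → ℝ} (hf : HasCompactSupport f)
    (hKc : HasCompactSupport K) : HasCompactSupport (cv f K) :=
  hf.convolution _ hKc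

lemma pd_cv {f K : Space d → ℝ} (hf : LocallyIntegrable f) (hK : ContDiff ℝ ∞ K)
    (hKc : HasCompactSupport K) (k : Fin d) (x : Space d) : pd k (cv f K) x = cv f (pd k K) x := by
  have h := hKc.hasFDerivAt_convolution_right (ContinuousLinearMap.mul ℝ ℝ) (μ := volume) hf
    (hK.of_le (by simp)) x
  have h2 : pd k (cv f K) x = _ := congrArg (fun L => L (EuclideanSpace.single k 1)) h.fderiv
  rw [h2, convolution_precompR_apply _ hf (hKc.fderiv ℝ) (hK.continuous_fderiv (by simp))]
  rfl

lemma integrable_cv {f K : Space d → ℝ} (hf : Integrable f) (hK : Integrable K) :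
    Integrable (cv f K) :=
  hf.integrable_convolution _ hK

lemma integral_cv {f K : Space d → ℝ} (hf : Integrable f) (hK : Integrable K) :
    ∫ x, cv f K x = (∫ x, f x) * ∫ x, K x := by
  have := integral_convolution (ContinuousLinearMap.mul ℝ ℝ) (μ := volume) (ν := volume) hf hK
  simpa [cv] using this

lemma abs_cv_le (f K : Space d → ℝ) (x : Space d) :
    |cv f K x| ≤ cv (fun t => |f t|) (fun t => |K t|) x := by
  rw [cv_apply, cv_apply]
  refine (abs_integral_le_integral_abs).trans_eq ?_
  simp only [abs_mul]

lemma integral_abs_cv_le {f K : Space d → ℝ} (hf : Integrable f) (hK : Integrable K) :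
    ∫ x, |cv f K x| ≤ (∫ x, |f x|) * ∫ x, |K x| := by
  rw [← integral_cv hf.abs hK.abs]
  exact integral_mono (integrable_cv hf hK).abs (integrable_cv hf.abs hK.abs)
    fun x => abs_cv_le f K x

lemma cv_sub_left {f g K : Space d → ℝ} (hf : LocallyIntegrable f) (hg : LocallyIntegrable g)
    (hK : Continuous K) (hKc : HasCompactSupport K) (x : Space d) :
    cv (fun t => f t - g t) K x = cv f K x - cv g K x := by
  simp only [cv_apply, sub_mul]
  exact integral_sub (integrable_cv_integrand hf hK hKc x) (integrable_cv_integrand hg hK hKc x)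

lemma cv_sub_right {f K L : Space d → ℝ} (hf : LocallyIntegrable f)
    (hK : Continuous K) (hKc : HasCompactSupport K) (hL : Continuous L)
    (hLc : HasCompactSupport L) (x : Space d) :
    cv f (fun t => K t - L t) x = cv f K x - cv f L x := by
  simp only [cv_apply, mul_sub]
  exact integral_sub (integrable_cv_integrand hf hK hKc x) (integrable_cv_integrand hf hL hLc x)

lemma cv_sum_right {ι : Type*} (s : Finset ι) {f : Space d → ℝ} {K : ι → Space d → ℝ}
    (hf : LocallyIntegrable f) (hK : ∀ i, Continuous (K i)) (hKc : ∀ i, HasCompactSupport (K i))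
    (x : Space d) : cv f (fun t => ∑ i ∈ s, K i t) x = ∑ i ∈ s, cv f (K i) x := by
  simp only [cv_apply, Finset.mul_sum]
  exact integral_finsetSum _ fun i _ => integrable_cv_integrand hf (hK i) (hKc i) x

/-- Jensen's inequality for the probability density `η (x - ·)`: the variance of `f` about its mean
`cv f η x` is nonnegative. -/
lemma cv_sq_le {f η : Space d → ℝ} (hf : LocallyIntegrable f)
    (hf2 : LocallyIntegrable fun x => f x ^ 2)
    (hη : Continuous η) (hηc : HasCompactSupport η) (h0 : ∀ x, 0 ≤ η x) (h1 : ∫ x, η x = 1)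
    (x : Space d) : cv f η x ^ 2 ≤ cv (fun t => f t ^ 2) η x := by
  set c := cv f η x with hc
  have hi1 := integrable_cv_integrand hf hη hηc x
  have hi2 := integrable_cv_integrand hf2 hη hηc x
  have hi3 : Integrable fun t => η (x - t) :=
    (hη.integrable_of_hasCompactSupport hηc).comp_sub_left x
  have key : 0 ≤ ∫ t, (f t - c) ^ 2 * η (x - t) :=
    integral_nonneg fun t => mul_nonneg (sq_nonneg _) (h0 _)
  have he : ∀ t, (f t - c) ^ 2 * η (x - t)
      = f t ^ 2 * η (x - t) - 2 * c * (f t * η (x - t)) + c ^ 2 * η (x - t) := fun t => by ring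
  simp only [he] at key
  have hi4 : Integrable fun t => f t ^ 2 * η (x - t) - 2 * c * (f t * η (x - t)) :=
    hi2.sub (hi1.const_mul _)
  rw [integral_add hi4 (hi3.const_mul _),
    integral_sub hi2 (hi1.const_mul _), integral_const_mul, integral_const_mul,
    integral_sub_left_eq_self, h1, ← cv_apply, ← cv_apply, ← hc] at key
  linarith

lemma MemLp.locallyIntegrable_two {f : Space d → ℝ} (hf : MemLp f 2) : LocallyIntegrable f :=
  hf.locallyIntegrable (by norm_num)

lemma memLp_cv {f η : Space d → ℝ} (hf : MemLp f 2) (hη : ContDiff ℝ ∞ η)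
    (hηc : HasCompactSupport η) (h0 : ∀ x, 0 ≤ η x) (h1 : ∫ x, η x = 1) : MemLp (cv f η) 2 := by
  have hf1 := MemLp.locallyIntegrable_two hf
  have hc := (cv_contDiff hf1 hη hηc).continuous
  rw [memLp_two_iff_integrable_sq hc.aestronglyMeasurable]
  refine (integrable_cv hf.integrable_sq
    (hη.continuous.integrable_of_hasCompactSupport hηc)).mono' (hc.pow 2).aestronglyMeasurable
    (Eventually.of_forall fun x => ?_)
  rw [Real.norm_eq_abs, abs_of_nonneg (sq_nonneg _)]
  exact cv_sq_le hf1 hf.integrable_sq.locallyIntegrable hη.continuous hηc h0 h1 x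

lemma integral_cv_sq_le {f η : Space d → ℝ} (hf : MemLp f 2) (hη : ContDiff ℝ ∞ η)
    (hηc : HasCompactSupport η) (h0 : ∀ x, 0 ≤ η x) (h1 : ∫ x, η x = 1) :
    ∫ x, cv f η x ^ 2 ≤ ∫ x, f x ^ 2 := by
  have hηi := hη.continuous.integrable_of_hasCompactSupport (μ := volume) hηc
  calc ∫ x, cv f η x ^ 2 ≤ ∫ x, cv (fun t => f t ^ 2) η x :=
        integral_mono (memLp_cv hf hη hηc h0 h1).integrable_sq (integrable_cv hf.integrable_sq hηi)
          fun x => cv_sq_le (MemLp.locallyIntegrable_two hf) hf.integrable_sq.locallyIntegrable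
            hη.continuous hηc h0 h1 x
    _ = ∫ x, f x ^ 2 := by rw [integral_cv hf.integrable_sq hηi, h1, mul_one]

lemma integral_sq_le_of_eLpNorm_le {α : Type*} [MeasurableSpace α] {μ : Measure α} {f : α → ℝ}
    (hf : MemLp f 2 μ) {c : ℝ} (hc : 0 ≤ c)
    (h : eLpNorm f 2 μ ≤ ENNReal.ofReal c) : ∫ x, f x ^ 2 ∂μ ≤ c ^ 2 := by
  rw [hf.eLpNorm_eq_integral_rpow_norm (by norm_num) (by norm_num),
    ENNReal.ofReal_le_ofReal_iff hc] at h
  simp only [ENNReal.toReal_ofNat, Real.rpow_ofNat, Real.norm_eq_abs, sq_abs] at h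
  have h0 : 0 ≤ ∫ x, f x ^ 2 ∂μ := integral_nonneg fun x => sq_nonneg _
  calc ∫ x, f x ^ 2 ∂μ = ((∫ x, f x ^ 2 ∂μ) ^ ((2 : ℝ)⁻¹)) ^ 2 := by
        rw [← Real.rpow_natCast, ← Real.rpow_mul h0]; norm_num
    _ ≤ c ^ 2 := by gcongr

lemma abs_cv_sub_le {g η : Space d → ℝ} {ε r : ℝ} (hg : LocallyIntegrable g)
    (hη : Continuous η) (hηs : ∀ x, ε < ‖x‖ → η x = 0) (h0 : ∀ x, 0 ≤ η x) (h1 : ∫ x, η x = 1)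
    (x : Space d) (h : ∀ t, ‖x - t‖ ≤ ε → |g t - g x| ≤ r) : |cv g η x - g x| ≤ r := by
  have hηc := hasCompactSupport_of_zero_of_lt hηs
  have hi3 : Integrable fun t => η (x - t) :=
    (hη.integrable_of_hasCompactSupport hηc).comp_sub_left x
  have h2 : g x = ∫ t, g x * η (x - t) := by
    rw [integral_const_mul, integral_sub_left_eq_self, h1, mul_one]
  have h3 : r = ∫ t, r * η (x - t) := by
    rw [integral_const_mul, integral_sub_left_eq_self, h1, mul_one]
  have h4 : cv g η x - g x = ∫ t, (g t * η (x - t) - g x * η (x - t)) := by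
    rw [integral_sub (integrable_cv_integrand hg hη hηc x) (hi3.const_mul _), ← h2, cv_apply]
  rw [h4, h3, ← Real.norm_eq_abs]
  refine norm_integral_le_of_norm_le (hi3.const_mul _) (Eventually.of_forall fun t => ?_)
  rw [← sub_mul, norm_mul, Real.norm_eq_abs, Real.norm_eq_abs, abs_of_nonneg (h0 _)]
  by_cases ht : ‖x - t‖ ≤ ε
  · exact mul_le_mul_of_nonneg_right (h t ht) (h0 _)
  · simp [hηs _ (not_le.1 ht)]

section Family

variable {η : ℝ → Space d → ℝ} {C : ℝ}

lemma IsMollifierFamily.hasCompactSupport (hη : IsMollifierFamily η C) {s : ℝ} (hs : 0 < s) :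
    HasCompactSupport (η s) := hasCompactSupport_of_zero_of_lt (hη.zero_of_lt s hs)

lemma IsMollifierFamily.memLp_cv (hη : IsMollifierFamily η C) {s : ℝ} (hs : 0 < s)
    {f : Space d → ℝ} (hf : MemLp f 2) : MemLp (cv f (η s)) 2 :=
  GCR.memLp_cv hf (hη.smooth s hs) (hη.hasCompactSupport hs) (hη.nonneg s hs)
    (hη.integral_eq_one s hs)

lemma IsMollifierFamily.integral_cv_sq_le (hη : IsMollifierFamily η C) {s : ℝ} (hs : 0 < s)
    {f : Space d → ℝ} (hf : MemLp f 2) : ∫ x, cv f (η s) x ^ 2 ≤ ∫ x, f x ^ 2 :=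
  GCR.integral_cv_sq_le hf (hη.smooth s hs) (hη.hasCompactSupport hs) (hη.nonneg s hs)
    (hη.integral_eq_one s hs)

lemma IsMollifierFamily.tendsto_integral_sq_of_continuous (hη : IsMollifierFamily η C)
    {g : Space d → ℝ} (hg : Continuous g) (hgc : HasCompactSupport g) {τ : ℝ} (hτ : 0 < τ) :
    ∀ᶠ s in 𝓝[>] (0 : ℝ), ∫ x, (cv g (η s) x - g x) ^ 2 ≤ τ := by
  -- For scales below one, both `g` and its mollification vanish off this compact set, so a uniform
  -- bound on the difference gives an `L²` bound.
  set K := Metric.cthickening 1 (tsupport g) with hK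
  have hKc : IsCompact K := hgc.isCompact.cthickening
  set V := volume.real K
  obtain ⟨r, hr0, hr⟩ : ∃ r : ℝ, 0 < r ∧ r ^ 2 * V ≤ τ := by
    have hV : 0 ≤ V := measureReal_nonneg
    refine ⟨√(τ / (V + 1)), by positivity, ?_⟩
    rw [Real.sq_sqrt (by positivity), div_mul_eq_mul_div, div_le_iff₀ (by positivity)]
    nlinarith
  obtain ⟨δ, hδ, hgδ⟩ := Metric.uniformContinuous_iff.1
    (hgc.uniformContinuous_of_continuous hg) r hr0
  have hmin : 0 < min δ 1 := lt_min hδ one_pos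
  filter_upwards [Ioo_mem_nhdsGT hmin] with s hs
  have hs0 := hs.1
  have hpt : ∀ x, |cv g (η s) x - g x| ≤ r := fun x =>
    abs_cv_sub_le hg.locallyIntegrable (hη.smooth s hs0).continuous
    (hη.zero_of_lt s hs0) (hη.nonneg s hs0) (hη.integral_eq_one s hs0) x fun t ht => by
      rw [← Real.dist_eq]
      refine (hgδ ?_).le
      rw [dist_comm, dist_eq_norm]
      exact ht.trans_lt (hs.2.trans_le (min_le_left _ _))
  have hout : ∀ x, x ∉ K → cv g (η s) x - g x = 0 := by
    intro x hx
    have hgt : ∀ t, g t * η s (x - t) = 0 := by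
      intro t
      by_cases ht : s < ‖x - t‖
      · rw [hη.zero_of_lt s hs0 _ ht, mul_zero]
      · suffices h : t ∉ tsupport g by rw [image_eq_zero_of_notMem_tsupport h, zero_mul]
        intro h
        apply hx
        refine Metric.mem_cthickening_of_dist_le x t 1 _ h ?_
        rw [dist_eq_norm]
        exact (not_lt.1 ht).trans (hs.2.trans_le (min_le_right _ _)).le
    have hgx : g x = 0 := image_eq_zero_of_notMem_tsupport fun h =>
      hx (Metric.self_subset_cthickening _ h)
    rw [cv_apply]
    simp [hgt, hgx]
  calc ∫ x, (cv g (η s) x - g x) ^ 2 = ∫ x in K, (cv g (η s) x - g x) ^ 2 := by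
        rw [setIntegral_eq_integral_of_forall_compl_eq_zero]
        intro x hx; rw [hout x hx]; simp
    _ ≤ ∫ x in K, r ^ 2 := by
        have hcont : Continuous fun x => (cv g (η s) x - g x) ^ 2 :=
          ((cv_contDiff hg.locallyIntegrable (hη.smooth s hs0)
            (hη.hasCompactSupport hs0)).continuous.sub hg).pow 2
        refine setIntegral_mono (hcont.continuousOn.integrableOn_compact hKc)
          (integrableOn_const hKc.measure_lt_top.ne) fun x => ?_
        exact sq_le_sq.2 ((hpt x).trans (le_abs_self _))
    _ = r ^ 2 * V := by simp [V, mul_comm]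
    _ ≤ τ := hr

/-- Mollifications converge in `L²`. -/
lemma IsMollifierFamily.tendsto_integral_sq (hη : IsMollifierFamily η C) {f : Space d → ℝ}
    (hf : MemLp f 2) : Tendsto (fun s => ∫ x, (cv f (η s) x - f x) ^ 2) (𝓝[>] 0) (𝓝 0) := by
  rw [Metric.tendsto_nhds]
  intro τ hτ
  -- The error splits into three differences, each with squared norm at most `τ / 12`; the square of
  -- a sum of three terms costs a factor three, for a total of `3 τ / 4 < τ`.
  set c := √(τ / 12)
  have hc0 : 0 < c := by positivity
  have hc : c ^ 2 = τ / 12 := Real.sq_sqrt (by positivity)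
  obtain ⟨g, hgc, hgs, hfg⟩ := hf.exist_eLpNorm_sub_le (by norm_num) (by norm_num) hc0
  have hg2 : MemLp g 2 := hgs.continuous.memLp_of_hasCompactSupport hgc
  have hfg2 : MemLp (fun x => f x - g x) 2 := hf.sub hg2
  have hfgi : ∫ x, (f x - g x) ^ 2 ≤ τ / 12 := by
    rw [← hc]; exact integral_sq_le_of_eLpNorm_le hfg2 hc0.le hfg
  have hτ12 : 0 < τ / 12 := by positivity
  filter_upwards [hη.tendsto_integral_sq_of_continuous hgs.continuous hgc hτ12,
    self_mem_nhdsWithin] with s hs (hs0 : 0 < s)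
  have h1 := hη.memLp_cv hs0 hf
  have h2 := hη.memLp_cv hs0 hg2
  have h3 := hη.memLp_cv hs0 hfg2
  have h4 : MemLp (fun x => cv g (η s) x - g x) 2 := h2.sub hg2
  have h5 : MemLp (fun x => cv f (η s) x - f x) 2 := h1.sub hf
  have hle : ∀ x, (cv f (η s) x - f x) ^ 2 ≤ 3 * (cv (fun x => f x - g x) (η s) x ^ 2
      + (cv g (η s) x - g x) ^ 2 + (f x - g x) ^ 2) := by
    intro x
    rw [cv_sub_left (MemLp.locallyIntegrable_two hf) (MemLp.locallyIntegrable_two hg2)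
      (hη.smooth s hs0).continuous (hη.hasCompactSupport hs0)]
    nlinarith [sq_nonneg ((cv f (η s) x - cv g (η s) x) - (cv g (η s) x - g x)),
      sq_nonneg ((cv f (η s) x - cv g (η s) x) + (f x - g x)),
      sq_nonneg ((cv g (η s) x - g x) + (f x - g x))]
  have hint : ∫ x, (cv f (η s) x - f x) ^ 2 ≤ 3 * ((τ / 12) + τ / 12 + τ / 12) := by
    refine (integral_mono h5.integrable_sq
      (((h3.integrable_sq.fun_add h4.integrable_sq).fun_add hfg2.integrable_sq).const_mul 3) hle).trans ?_
    rw [integral_const_mul]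
    rw [integral_add (h3.integrable_sq.fun_add h4.integrable_sq) hfg2.integrable_sq,
      integral_add h3.integrable_sq h4.integrable_sq]
    have := (hη.integral_cv_sq_le hs0 hfg2).trans hfgi
    linarith
  rw [Real.dist_eq, sub_zero, abs_of_nonneg (integral_nonneg fun x => sq_nonneg _)]
  linarith

end Family

/-! ### Weak derivatives on the whole space -/

/-- `F i j` is the weak `(i, j)` component `∂_i α_j - ∂_j α_i` of the curl of `α`. -/
def WeakCurl (α : Fin d → Space d → ℝ) (F : Fin d → Fin d → Space d → ℝ) : Prop :=
  ∀ i j, ∀ ψ : Space d → ℝ, ContDiff ℝ ∞ ψ → HasCompactSupport ψ →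
    ∫ x, (pd i ψ x * α j x - pd j ψ x * α i x) = -∫ x, ψ x * F i j x

/-- `f' i` are the weak partial derivatives of `f`. -/
def WeakGrad (f : Space d → ℝ) (f' : Fin d → Space d → ℝ) : Prop :=
  ∀ i, ∀ ψ : Space d → ℝ, ContDiff ℝ ∞ ψ → HasCompactSupport ψ →
    ∫ x, pd i ψ x * f x = -∫ x, ψ x * f' i x

lemma contDiff_reflect {K : Space d → ℝ} (hK : ContDiff ℝ ∞ K) (x : Space d) :
    ContDiff ℝ ∞ fun t => K (x - t) := hK.comp (contDiff_const.sub contDiff_id)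

lemma hasCompactSupport_reflect {K : Space d → ℝ} (hK : HasCompactSupport K) (x : Space d) :
    HasCompactSupport fun t => K (x - t) :=
  hK.comp_homeomorph (Homeomorph.subLeft x)

lemma pd_reflect {K : Space d → ℝ} (hK : ContDiff ℝ ∞ K) (x t : Space d) (i : Fin d) :
    pd i (fun t => K (x - t)) t = -pd i K (x - t) := by
  have h1 : HasFDerivAt (fun t : Space d => x - t) (-ContinuousLinearMap.id ℝ _) t := by
    simpa using (hasFDerivAt_id t).const_sub x
  have h2 : HasFDerivAt K (fderiv ℝ K (x - t)) (x - t) :=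
    ((hK.differentiable (by simp)) _).hasFDerivAt
  have h3 := (h2.comp t h1).fderiv
  have h4 : (fun t => K (x - t)) = K ∘ fun t => x - t := rfl
  unfold pd
  rw [h4, h3]; simp

/-- The reflected translate `t ↦ K (x - t)` is an admissible test function; the reflection sign
cancels the sign in the definition of the weak curl. -/
lemma WeakCurl.cv_eq {α : Fin d → Space d → ℝ} {F : Fin d → Fin d → Space d → ℝ}
    (h : WeakCurl α F) (hα : ∀ j, LocallyIntegrable (α j)) {K : Space d → ℝ}
    (hK : ContDiff ℝ ∞ K) (hKc : HasCompactSupport K) (i j : Fin d) (x : Space d) :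
    cv (α j) (pd i K) x - cv (α i) (pd j K) x = cv (F i j) K x := by
  have h1 := h i j _ (contDiff_reflect hK x) (hasCompactSupport_reflect hKc x)
  simp only [pd_reflect hK] at h1
  have hi : ∀ i j, Integrable fun t => α j t * pd i K (x - t) := fun i j =>
    integrable_cv_integrand (hα j) (contDiff_pd_infty hK i).continuous (hasCompactSupport_pd hKc i) x
  have h2 : ∫ t, (-pd i K (x - t) * α j t - -pd j K (x - t) * α i t)
      = -(cv (α j) (pd i K) x - cv (α i) (pd j K) x) := by
    rw [cv_apply, cv_apply, ← integral_sub (hi i j) (hi j i), ← integral_neg]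
    congr 1; ext t; ring
  rw [h2, neg_inj] at h1
  rw [h1, cv_apply]
  simp only [mul_comm]

lemma WeakGrad.cv_eq {f : Space d → ℝ} {f' : Fin d → Space d → ℝ}
    (h : WeakGrad f f') {K : Space d → ℝ}
    (hK : ContDiff ℝ ∞ K) (hKc : HasCompactSupport K) (i : Fin d) (x : Space d) :
    cv f (pd i K) x = cv (f' i) K x := by
  have h1 := h i _ (contDiff_reflect hK x) (hasCompactSupport_reflect hKc x)
  simp only [pd_reflect hK, neg_mul] at h1
  rw [integral_neg, neg_inj] at h1
  rw [cv_apply, cv_apply]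
  simp only [mul_comm] at h1 ⊢
  exact h1

/-! ### Integration by parts and the energy identity -/

lemma pd_comm {f : Space d → ℝ} (hf : ContDiff ℝ ∞ f) (i j : Fin d) (x : Space d) :
    pd i (pd j f) x = pd j (pd i f) x := by
  have hs : IsSymmSndFDerivAt ℝ f x :=
    (hf.contDiffAt (x := x)).isSymmSndFDerivAt
      (by rw [minSmoothness_of_isRCLikeNormedField]; exact WithTop.coe_le_coe.2 le_top)
  have hd : DifferentiableAt ℝ (fderiv ℝ f) x :=
    (hf.fderiv_right (m := ∞) (by simp)).differentiable (by simp) x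
  have key : ∀ v w : Space d,
      fderiv ℝ (fun y => fderiv ℝ f y v) x w = fderiv ℝ (fderiv ℝ f) x w v := by
    intro v w
    rw [fderiv_clm_apply hd (differentiableAt_const v)]
    simp
  have h := hs.eq (EuclideanSpace.single i 1) (EuclideanSpace.single j 1)
  unfold pd
  rw [key, key, h]

lemma integral_mul_pd {f g : Space d → ℝ} (hf : ContDiff ℝ ∞ f) (hg : ContDiff ℝ ∞ g)
    (hgc : HasCompactSupport g) (k : Fin d) :
    ∫ x, f x * pd k g x = -∫ x, pd k f x * g x := by
  unfold pd
  apply integral_mul_fderiv_eq_neg_fderiv_mul_of_integrable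
  · exact ((contDiff_pd_infty hf k).continuous.mul hg.continuous).integrable_of_hasCompactSupport
      hgc.mul_left
  · exact (hf.continuous.mul (contDiff_pd_infty hg k).continuous).integrable_of_hasCompactSupport
      (hasCompactSupport_pd hgc k).mul_left
  · exact (hf.continuous.mul hg.continuous).integrable_of_hasCompactSupport hgc.mul_left
  · exact fun x _ => hf.differentiable (by simp) x
  · exact fun x _ => hg.differentiable (by simp) x

/-- Both sides become the pairing of a second derivative of `f` with `g`, and mixed partial
derivatives commute. -/
lemma integral_pd_mul_pd_comm {f g : Space d → ℝ} (hf : ContDiff ℝ ∞ f) (hg : ContDiff ℝ ∞ g)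
    (hgc : HasCompactSupport g) (i j : Fin d) :
    ∫ x, pd j f x * pd i g x = ∫ x, pd i f x * pd j g x := by
  rw [integral_mul_pd (contDiff_pd_infty hf j) hg hgc,
    integral_mul_pd (contDiff_pd_infty hf i) hg hgc]
  simp only [pd_comm hf i j]

/-- For a compactly supported curl-free field, the `L²` norm of the gradient is that of the
divergence. -/
lemma sum_integral_pd_sq {U : Fin d → Space d → ℝ} (hU : ∀ i, ContDiff ℝ ∞ (U i))
    (hUc : ∀ i, HasCompactSupport (U i)) (hsymm : ∀ i j x, pd j (U i) x = pd i (U j) x) :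
    ∑ i, ∑ j, ∫ x, pd j (U i) x ^ 2 = ∫ x, (∑ i, pd i (U i) x) ^ 2 := by
  have hint : ∀ i j k l, Integrable fun x => pd i (U j) x * pd k (U l) x := fun i j k l =>
    ((contDiff_pd_infty (hU j) i).continuous.mul
      (contDiff_pd_infty (hU l) k).continuous).integrable_of_hasCompactSupport
      (hasCompactSupport_pd (hUc l) k).mul_left
  simp only [sq, Finset.sum_mul_sum]
  rw [integral_finsetSum _ fun i _ => integrable_finsetSum _ fun j _ => hint i i j j]
  refine Finset.sum_congr rfl fun i _ => ?_
  rw [integral_finsetSum _ fun j _ => hint i i j j]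
  refine Finset.sum_congr rfl fun j _ => ?_
  -- Exchanging the derivatives turns `∂_i U_i ∂_j U_j` into `∂_j U_i ∂_i U_j`, which is a square
  -- because the field is curl-free.
  rw [← integral_pd_mul_pd_comm (hU i) (hU j) (hUc j)]
  simp only [hsymm i j]

end

section


variable {d : ℕ}

/-! ### Tails of square integrable functions -/

/-- `s²` where `|s| > N`, and `0` elsewhere. -/
def tailSq (N s : ℝ) : ℝ := if N < |s| then s ^ 2 else 0

lemma tailSq_nonneg (N s : ℝ) : 0 ≤ tailSq N s := by
  unfold tailSq; split_ifs <;> positivity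

lemma tailSq_le_sq (N s : ℝ) : tailSq N s ≤ s ^ 2 := by
  unfold tailSq; split_ifs
  · exact le_rfl
  · positivity

lemma sq_le_add_tailSq {N : ℝ} (s : ℝ) : s ^ 2 ≤ N ^ 2 + tailSq N s := by
  unfold tailSq; split_ifs with h
  · nlinarith [sq_nonneg N]
  · rw [add_zero]; exact sq_le_sq.2 ((not_lt.1 h).trans (le_abs_self N))

lemma measurable_tailSq (N : ℝ) : Measurable (tailSq N) := by
  unfold tailSq
  exact Measurable.ite (measurableSet_lt measurable_const measurable_norm)
    (measurable_id.pow_const 2) measurable_const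

lemma integrable_tailSq {α : Type*} [MeasurableSpace α] {ν : Measure α} {f : α → ℝ}
    (hf : MemLp f 2 ν) (N : ℝ) : Integrable (fun x => tailSq N (f x)) ν := by
  refine hf.integrable_sq.mono'
    ((measurable_tailSq N).comp_aemeasurable
      hf.aestronglyMeasurable.aemeasurable).aestronglyMeasurable
    (Eventually.of_forall fun x => ?_)
  rw [Real.norm_eq_abs, abs_of_nonneg (tailSq_nonneg _ _)]
  exact tailSq_le_sq _ _

lemma mul_le_of_pos {t : ℝ} (ht : 0 < t) (a b : ℝ) : a * b ≤ t / 2 * a ^ 2 + 1 / (2 * t) * b ^ 2 := by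
  have h : t / 2 * a ^ 2 + 1 / (2 * t) * b ^ 2 - a * b = (t * a - b) ^ 2 / (2 * t) := by
    field_simp; ring
  have : 0 ≤ (t * a - b) ^ 2 / (2 * t) := by positivity
  linarith

/-- Young's inequality with `b ^ 2 ≤ b`. The weight is used where `|y| ≤ N` and discarded on the
tail, so a weight small in `L¹` suffices once the tails of `y` are small. -/
lemma weighted_mul_le {t N b x y : ℝ} (ht : 0 < t) (hb0 : 0 ≤ b) (hb1 : b ≤ 1) :
    b * (|x| * |y|) ≤ t / 2 * x ^ 2 + 1 / (2 * t) * (N ^ 2 * b + tailSq N y) := by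
  have h1 := mul_le_of_pos ht |x| (b * |y|)
  have h2 : (b * |y|) ^ 2 ≤ N ^ 2 * b + tailSq N y := by
    have h3 := sq_le_add_tailSq (N := N) y
    have h4 := tailSq_nonneg N y
    rw [mul_pow, sq_abs]
    have hbb : b ^ 2 ≤ b := by nlinarith
    calc b ^ 2 * y ^ 2 ≤ b * (N ^ 2 + tailSq N y) := by gcongr
      _ ≤ N ^ 2 * b + tailSq N y := by nlinarith
  rw [sq_abs] at h1
  have h5 : 1 / (2 * t) * (b * |y|) ^ 2 ≤ 1 / (2 * t) * (N ^ 2 * b + tailSq N y) := by gcongr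
  nlinarith

/-- Where `|y| ≤ N` only the `L¹` size of `x` is spent; on the tail, Young's inequality spends its
`L²` size with the small factor `t`. -/
lemma mul_le_tail {t N x y : ℝ} (ht : 0 < t) (hN : 0 ≤ N) :
    |x| * |y| ≤ N * |x| + (t / 2 * x ^ 2 + 1 / (2 * t) * tailSq N y) := by
  have h0 := tailSq_nonneg N y
  by_cases h : N < |y|
  · have h1 := mul_le_of_pos ht |x| |y|
    rw [sq_abs, sq_abs] at h1
    rw [tailSq, if_pos h]
    have := mul_nonneg hN (abs_nonneg x)
    linarith
  · have h1 : |x| * |y| ≤ N * |x| := by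
      rw [mul_comm]; exact mul_le_mul_of_nonneg_right (not_lt.1 h) (abs_nonneg x)
    have : 0 ≤ t / 2 * x ^ 2 + 1 / (2 * t) * tailSq N y := by positivity
    linarith

/-! ### A smooth truncation -/

/-- A smooth function with values in `[-2μ, 2μ]` that is close to the identity near `0`. -/
def trunc (μ s : ℝ) : ℝ := μ * Real.arctan (s / μ)

lemma trunc_contDiff (μ : ℝ) : ContDiff ℝ ∞ (trunc μ) := by
  unfold trunc
  exact contDiff_const.mul (Real.contDiff_arctan.comp (contDiff_id.div_const μ))

lemma abs_trunc_le {μ : ℝ} (hμ : 0 < μ) (s : ℝ) : |trunc μ s| ≤ 2 * μ := by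
  rw [trunc, abs_mul, abs_of_pos hμ, mul_comm]
  gcongr
  have h1 := Real.arctan_lt_pi_div_two (s / μ)
  have h2 := Real.neg_pi_div_two_lt_arctan (s / μ)
  rw [abs_le]
  constructor <;> linarith [Real.pi_le_four]

lemma deriv_trunc {μ : ℝ} (hμ : 0 < μ) (s : ℝ) : deriv (trunc μ) s = 1 / (1 + (s / μ) ^ 2) := by
  have h : HasDerivAt (trunc μ) (μ * (1 / (1 + (s / μ) ^ 2) * (1 / μ))) s :=
    ((hasDerivAt_id s).div_const μ).arctan.const_mul μ
  rw [h.deriv]; field_simp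

/-- This quantity measures the part of `∇u` lost when `u` is truncated. With `r = s / μ` it equals
`r² / (1 + r²)`, which is at most both `1` and `|r|`; the last bound makes it small in `L¹` when `u`
is. -/
lemma one_sub_deriv_trunc_bounds {μ : ℝ} (hμ : 0 < μ) (s : ℝ) :
    0 ≤ 1 - deriv (trunc μ) s ∧ 1 - deriv (trunc μ) s ≤ 1 ∧
      1 - deriv (trunc μ) s ≤ |s| / μ := by
  rw [deriv_trunc hμ]
  have hp : 0 < 1 + (s / μ) ^ 2 := by positivity
  have hr : 1 - 1 / (1 + (s / μ) ^ 2) = (s / μ) ^ 2 / (1 + (s / μ) ^ 2) := by field_simp; ring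
  refine ⟨?_, ?_, ?_⟩
  · rw [hr]; positivity
  · have : 0 < 1 / (1 + (s / μ) ^ 2) := by positivity
    linarith
  · rw [hr, div_le_iff₀ hp]
    have : |s| / μ = |s / μ| := by rw [abs_div, abs_of_pos hμ]
    rw [this, ← sq_abs (s / μ)]
    nlinarith [abs_nonneg (s / μ), sq_nonneg (|s / μ| - 1), sq_nonneg (|s / μ|),
      mul_nonneg (abs_nonneg (s / μ)) (sq_nonneg (|s / μ| - 1))]

lemma continuous_deriv_trunc (μ : ℝ) : Continuous (deriv (trunc μ)) :=
  (trunc_contDiff μ).continuous_deriv (by simp)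

/-! ### Forms with integrable curl -/

/-- Compactly supported forms with uniform bounds in `L¹` and `L²`, uniformly small tails, and
curl bounded in `L¹`. -/
structure ControlledForm (A : ℝ) (T : ℝ → ℝ) (α : Fin d → Space d → ℝ) : Prop where
  compact : ∀ j, HasCompactSupport (α j)
  memLp : ∀ j, MemLp (α j) 2
  l1 : ∀ j, ∫ x, |α j x| ≤ A
  l2 : ∀ j, ∫ x, α j x ^ 2 ≤ A
  tail : ∀ j N, 0 < N → ∫ x, tailSq N (α j x) ≤ T N
  curl : ∃ F : Fin d → Fin d → Space d → ℝ, (∀ i j, Integrable (F i j)) ∧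
    (∀ i j, ∫ x, |F i j x| ≤ A) ∧ WeakCurl α F

lemma integrable_of_memLp_two {f : Space d → ℝ} (hf : MemLp f 2) (hc : HasCompactSupport f) :
    Integrable f :=
  (integrableOn_iff_integrable_of_support_subset (subset_tsupport f)).1
    ((MemLp.locallyIntegrable_two hf).integrableOn_isCompact hc.isCompact)

lemma integrable_mul_of_locallyIntegrable {g f : Space d → ℝ} (hg : Continuous g)
    (hgc : HasCompactSupport g) (hf : LocallyIntegrable f) : Integrable fun x => g x * f x :=
  hf.integrable_smul_left_of_hasCompactSupport hg hgc

lemma memLp_two_of_continuous {g : Space d → ℝ} (hg : Continuous g) (hgc : HasCompactSupport g) :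
    MemLp g 2 := hg.memLp_of_hasCompactSupport hgc

lemma integral_sq_sum_le {ι : Type*} (s : Finset ι) {f : ι → Space d → ℝ}
    (hf : ∀ i, MemLp (f i) 2) :
    ∫ x, (∑ i ∈ s, f i x) ^ 2 ≤ s.card * ∑ i ∈ s, ∫ x, f i x ^ 2 := by
  rw [← integral_finsetSum _ fun i _ => (hf i).integrable_sq, ← integral_const_mul]
  refine integral_mono (memLp_finsetSum s fun i _ => hf i).integrable_sq
    ((integrable_finsetSum _ fun i _ => (hf i).integrable_sq).const_mul _) fun x => ?_
  exact sq_sum_le_card_mul_sum_sq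

lemma integral_abs_sum_le {ι : Type*} (s : Finset ι) {f : ι → Space d → ℝ}
    (hf : ∀ i, Integrable (f i)) :
    ∫ x, |∑ i ∈ s, f i x| ≤ ∑ i ∈ s, ∫ x, |f i x| := by
  rw [← integral_finsetSum _ fun i _ => (hf i).abs]
  exact integral_mono (integrable_finsetSum _ fun i _ => hf i).abs
    (integrable_finsetSum _ fun i _ => (hf i).abs) fun x => Finset.abs_sum_le_sum_abs _ _

lemma integral_sq_sub_le {f g : Space d → ℝ} (hf : MemLp f 2) (hg : MemLp g 2) :
    ∫ x, (f x - g x) ^ 2 ≤ 2 * (∫ x, f x ^ 2) + 2 * ∫ x, g x ^ 2 := by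
  rw [← integral_const_mul, ← integral_const_mul,
    ← integral_add (hf.integrable_sq.const_mul 2) (hg.integrable_sq.const_mul 2)]
  refine integral_mono (hf.sub hg).integrable_sq
    ((hf.integrable_sq.const_mul 2).add (hg.integrable_sq.const_mul 2)) fun x => ?_
  nlinarith [sq_nonneg (f x + g x)]

section

variable {η : ℝ → Space d → ℝ} {C : ℝ}

lemma integral_cv_sub_sq_le (hη : IsMollifierFamily η C) {f : Space d → ℝ} (hf : MemLp f 2)
    {δ ε : ℝ} (hδ : 0 < δ) (hε : 0 < ε) :
    ∫ x, (cv f (η ε) x - cv f (η δ) x) ^ 2 ≤ 4 * ∫ x, f x ^ 2 := by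
  have h := integral_sq_sub_le (hη.memLp_cv hε hf) (hη.memLp_cv hδ hf)
  linarith [hη.integral_cv_sq_le hε hf, hη.integral_cv_sq_le hδ hf]

/-- This replaces a Calderón-Zygmund bound. The field `i ↦ cv f (G i)` is compactly supported and
curl-free, so its full gradient is controlled in `L²` by its divergence, a difference of two
mollifications of `f`. -/
lemma integral_cv_pd_kernel_sq_le (hη : IsMollifierFamily η C) {f : Space d → ℝ} (hf : MemLp f 2)
    (hfc : HasCompactSupport f) {δ ε : ℝ} (hδ : 0 < δ) (hε : 0 < ε)
    {G : Fin d → Space d → ℝ} (hG : ∀ i, ContDiff ℝ ∞ (G i)) (hGc : ∀ i, HasCompactSupport (G i))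
    (hsymm : ∀ i j x, pd j (G i) x = pd i (G j) x)
    (hdiv : ∀ x, ∑ i, pd i (G i) x = η ε x - η δ x) (i j : Fin d) :
    ∫ x, cv f (pd j (G i)) x ^ 2 ≤ 4 * ∫ x, f x ^ 2 := by
  have hfl := MemLp.locallyIntegrable_two hf
  have hpd : ∀ i j x, pd j (cv f (G i)) x = cv f (pd j (G i)) x := fun i j x =>
    pd_cv hfl (hG i) (hGc i) j x
  have hs := sum_integral_pd_sq (U := fun i => cv f (G i)) (fun i => cv_contDiff hfl (hG i) (hGc i))
    (fun i => cv_hasCompactSupport hfc (hGc i)) (fun i j x => by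
      rw [hpd, hpd]; congr 1; ext y; exact hsymm i j y)
  have hd : ∀ x, ∑ i, pd i (cv f (G i)) x = cv f (η ε) x - cv f (η δ) x := by
    intro x
    simp only [hpd]
    rw [← cv_sum_right _ hfl (fun i => (contDiff_pd_infty (hG i) i).continuous)
      (fun i => hasCompactSupport_pd (hGc i) i), ← cv_sub_right hfl (hη.smooth ε hε).continuous
        (hη.hasCompactSupport hε) (hη.smooth δ hδ).continuous (hη.hasCompactSupport hδ)]
    congr 1; ext y; exact hdiv y
  simp only [hd] at hs
  simp only [hpd] at hs
  have h0 : ∀ i j, 0 ≤ ∫ x, cv f (pd j (G i)) x ^ 2 := fun i j =>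
    integral_nonneg fun x => sq_nonneg _
  calc ∫ x, cv f (pd j (G i)) x ^ 2 ≤ ∑ j, ∫ x, cv f (pd j (G i)) x ^ 2 :=
        Finset.single_le_sum (f := fun j => ∫ x, cv f (pd j (G i)) x ^ 2)
          (fun j _ => h0 i j) (Finset.mem_univ j)
    _ ≤ ∑ i, ∑ j, ∫ x, cv f (pd j (G i)) x ^ 2 :=
        Finset.single_le_sum (f := fun i => ∑ j, ∫ x, cv f (pd j (G i)) x ^ 2)
          (fun i _ => Finset.sum_nonneg fun j _ => h0 i j) (Finset.mem_univ i)
    _ ≤ 4 * ∫ x, f x ^ 2 := by rw [hs]; exact integral_cv_sub_sq_le hη hf hδ hε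

/-- The difference of two mollifications of a form with integrable curl is the sum of an exact
form with small potential in `L¹` and of a form which is small in `L¹` and bounded in `L²`. -/
lemma exists_hodge_splitting (hη : IsMollifierFamily η C) {A : ℝ} {T : ℝ → ℝ}
    {α : Fin d → Space d → ℝ} (hα : ControlledForm A T α) {δ ε : ℝ} (hδ : 0 < δ) (hδε : δ ≤ ε) :
    ∃ (u : Space d → ℝ) (w : Fin d → Space d → ℝ), ContDiff ℝ ∞ u ∧ HasCompactSupport u ∧
      (∀ j, Continuous (w j)) ∧ (∀ j, HasCompactSupport (w j)) ∧
      (∀ j x, cv (α j) (η ε) x - cv (α j) (η δ) x = pd j u x + w j x) ∧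
      ∫ x, |u x| ≤ d * (A * (C * ε)) ∧ (∀ j, ∫ x, |w j x| ≤ d * (A * (C * ε))) ∧
      ∀ j, ∫ x, w j x ^ 2 ≤ (8 + 8 * d ^ 2) * A := by
  obtain ⟨G, hG, hGc, hsymm, hdiv, hGL⟩ := hη.exists_kernel δ ε hδ hδε
  obtain ⟨F, hFi, hFA, hF⟩ := hα.curl
  have hε : 0 < ε := hδ.trans_le hδε
  have hαl : ∀ j, LocallyIntegrable (α j) := fun j => MemLp.locallyIntegrable_two (hα.memLp j)
  have hGi : ∀ i, Integrable (G i) := fun i =>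
    (hG i).continuous.integrable_of_hasCompactSupport (hGc i)
  have hαi : ∀ j, Integrable (α j) := fun j =>
    integrable_of_memLp_two (hα.memLp j) (hα.compact j)
  have hcu : ∀ i, ContDiff ℝ ∞ (cv (α i) (G i)) := fun i => cv_contDiff (hαl i) (hG i) (hGc i)
  have hu : ContDiff ℝ ∞ fun x => ∑ i, cv (α i) (G i) x := ContDiff.sum fun i _ => hcu i
  have huc : HasCompactSupport fun x => ∑ i, cv (α i) (G i) x := by
    have : (fun x => ∑ i, cv (α i) (G i) x) = ∑ i, cv (α i) (G i) := by ext x; simp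
    rw [this]
    exact HasCompactSupport.finset_sum fun i _ => cv_hasCompactSupport (hα.compact i) (hGc i)
  have hpdu : ∀ j x, pd j (fun x => ∑ i, cv (α i) (G i) x) x = ∑ i, cv (α i) (pd j (G i)) x := by
    intro j x
    rw [pd_sum fun i _ => (hcu i).differentiable (by simp) x]
    exact Finset.sum_congr rfl fun i _ => pd_cv (hαl i) (hG i) (hGc i) j x
  -- Write `η ε - η δ` as `Σ ∂_i G_i` and trade `α_j * ∂_i G_i` for `α_i * ∂_j G_i + F_ij * G_i`.
  have hsplit : ∀ j x, cv (α j) (η ε) x - cv (α j) (η δ) x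
      = pd j (fun x => ∑ i, cv (α i) (G i) x) x + ∑ i, cv (F i j) (G i) x := by
    intro j x
    rw [hpdu, ← cv_sub_right (hαl j) (hη.smooth ε hε).continuous
        (hη.hasCompactSupport hε) (hη.smooth δ hδ).continuous (hη.hasCompactSupport hδ),
      ← Finset.sum_add_distrib]
    have : (fun t => η ε t - η δ t) = fun t => ∑ i, pd i (G i) t := by ext t; rw [hdiv]
    rw [this, cv_sum_right _ (hαl j) (fun i => (contDiff_pd_infty (hG i) i).continuous)
      (fun i => hasCompactSupport_pd (hGc i) i)]
    refine Finset.sum_congr rfl fun i _ => ?_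
    rw [← hF.cv_eq hαl (hG i) (hGc i) i j x]; ring
  -- Since `F` is only integrable, `w` is estimated in `L²` as a difference of two terms that
  -- involve `α` alone.
  have hw : ∀ j x, ∑ i, cv (F i j) (G i) x = (cv (α j) (η ε) x - cv (α j) (η δ) x)
      - ∑ i, cv (α i) (pd j (G i)) x := by
    intro j x; rw [hsplit, hpdu]; ring
  have hwcont : ∀ j, Continuous fun x => ∑ i, cv (F i j) (G i) x := fun j =>
    continuous_finsetSum _ fun i _ =>
      (cv_contDiff (hFi i j).locallyIntegrable (hG i) (hGc i)).continuous
  have hcpd : ∀ i j, MemLp (cv (α i) (pd j (G i))) 2 := fun i j =>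
    memLp_two_of_continuous (cv_contDiff (hαl i) (contDiff_pd_infty (hG i) j)
      (hasCompactSupport_pd (hGc i) j)).continuous
      (cv_hasCompactSupport (hα.compact i) (hasCompactSupport_pd (hGc i) j))
  refine ⟨_, fun j x => ∑ i, cv (F i j) (G i) x, hu, huc, hwcont, fun j => ?_, hsplit, ?_,
    fun j => ?_, fun j => ?_⟩
  -- No support is prescribed for the curl, so compact support of `w` is also read off from the
  -- other terms of the splitting.
  · have h1 : HasCompactSupport (cv (α j) (η ε) - cv (α j) (η δ) -
        pd j (fun x => ∑ i, cv (α i) (G i) x)) :=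
      ((cv_hasCompactSupport (hα.compact j) (hη.hasCompactSupport hε)).sub
        (cv_hasCompactSupport (hα.compact j) (hη.hasCompactSupport hδ))).sub
        (hasCompactSupport_pd huc j)
    convert h1 using 1
    ext x
    simp only [Pi.sub_apply]
    rw [hsplit]; ring
  · refine (integral_abs_sum_le _ fun i => integrable_cv (hαi i) (hGi i)).trans ?_
    calc ∑ i, ∫ x, |cv (α i) (G i) x| ≤ ∑ _i : Fin d, A * (C * ε) := by
          refine Finset.sum_le_sum fun i _ => (integral_abs_cv_le (hαi i) (hGi i)).trans ?_
          exact mul_le_mul (hα.l1 i) (hGL i) (integral_nonneg fun x => abs_nonneg _)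
            ((integral_nonneg fun x => abs_nonneg _).trans (hα.l1 i))
      _ = d * (A * (C * ε)) := by simp
  · refine (integral_abs_sum_le _ fun i => integrable_cv (hFi i j) (hGi i)).trans ?_
    calc ∑ i, ∫ x, |cv (F i j) (G i) x| ≤ ∑ _i : Fin d, A * (C * ε) := by
          refine Finset.sum_le_sum fun i _ => (integral_abs_cv_le (hFi i j) (hGi i)).trans ?_
          exact mul_le_mul (hFA i j) (hGL i) (integral_nonneg fun x => abs_nonneg _)
            ((integral_nonneg fun x => abs_nonneg _).trans (hFA i j))
      _ = d * (A * (C * ε)) := by simp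
  · simp only [hw]
    refine (integral_sq_sub_le ((hη.memLp_cv hε (hα.memLp j)).sub (hη.memLp_cv hδ (hα.memLp j)))
      (memLp_finsetSum _ fun i _ => hcpd i j)).trans ?_
    have h1 := integral_cv_sub_sq_le hη (hα.memLp j) hδ hε
    have h2 := integral_sq_sum_le Finset.univ fun i => hcpd i j
    have h3 : ∑ i, ∫ x, cv (α i) (pd j (G i)) x ^ 2 ≤ ∑ _i : Fin d, 4 * A :=
      Finset.sum_le_sum fun i _ => (integral_cv_pd_kernel_sq_le hη (hα.memLp i) (hα.compact i)
        hδ hε hG hGc hsymm hdiv i j).trans (by linarith [hα.l2 i])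
    simp only [Finset.sum_const, Finset.card_univ, Fintype.card_fin, nsmul_eq_mul] at h2 h3
    have h4 : (d : ℝ) * ∑ i, ∫ x, cv (α i) (pd j (G i)) x ^ 2 ≤ d * (d * (4 * A)) := by gcongr
    have h5 := hα.l2 j
    simp only [Pi.sub_apply]
    nlinarith

end

end

/-! ### The uniform defect estimate for exterior products -/

section


variable {d : ℕ}

section

variable {η : ℝ → Space d → ℝ} {C : ℝ}

lemma abs_integral_mul_le {φ f g : Space d → ℝ} {M : ℝ} (hM : ∀ x, |φ x| ≤ M)
    (hg : Integrable g) (hfg : ∀ x, |f x| ≤ g x) : |∫ x, φ x * f x| ≤ M * ∫ x, g x := by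
  have hM0 : 0 ≤ M := (abs_nonneg _).trans (hM 0)
  rw [← integral_const_mul, ← Real.norm_eq_abs]
  refine norm_integral_le_of_norm_le (hg.const_mul M) (Eventually.of_forall fun x => ?_)
  rw [Real.norm_eq_abs, abs_mul]
  exact mul_le_mul (hM x) (hfg x) (abs_nonneg _) hM0

/-- The factor `b * γ` is handled by `weighted_mul_le`, with `b ≤ |u| / μ` as the small weight, and
`(1 - b) * w` by `mul_le_tail`, with `w` itself small in `L¹`. Each leaves half of the tail term of
`β`. -/
lemma abs_integral_remainder_le {φ b γ w β u : Space d → ℝ} {M t N μ : ℝ} (ht : 0 < t) (hN : 0 ≤ N)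
    (hM : ∀ x, |φ x| ≤ M) (hγ : MemLp γ 2) (hw : MemLp w 2)
    (hwi : Integrable w) (hβ : MemLp β 2) (hui : Integrable u) (hb : ∀ x, 0 ≤ b x)
    (hb1 : ∀ x, b x ≤ 1) (hbu : ∀ x, b x ≤ |u x| / μ) :
    |∫ x, φ x * ((b x * γ x + (1 - b x) * w x) * β x)| ≤
      M * (t / 2 * (∫ x, γ x ^ 2) + 1 / (2 * t) * (N ^ 2 * ((∫ x, |u x|) / μ))
        + 1 / t * (∫ x, tailSq N (β x)) + N * (∫ x, |w x|) + t / 2 * ∫ x, w x ^ 2) := by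
  have hγ2 := hγ.integrable_sq.const_mul (t / 2)
  have hu2 := (hui.abs.div_const μ).const_mul (1 / (2 * t) * N ^ 2)
  have hβ2 := (integrable_tailSq hβ N).const_mul (1 / t)
  have hw1 := hwi.abs.const_mul N
  have hw2 := hw.integrable_sq.const_mul (t / 2)
  have h1 := hγ2.fun_add hu2
  have h2 := h1.fun_add hβ2
  have h3 := h2.fun_add hw1
  have h4 := h3.fun_add hw2
  refine (abs_integral_mul_le hM h4 fun x => ?_).trans_eq ?_
  · have e1 := weighted_mul_le (N := N) (x := γ x) (y := β x) ht (hb x) (hb1 x)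
    have e2 := mul_le_tail (x := w x) (y := β x) ht hN
    have e3 : |(b x * γ x + (1 - b x) * w x) * β x|
        ≤ b x * (|γ x| * |β x|) + (|w x| * |β x|) := by
      rw [add_mul]
      refine (abs_add_le _ _).trans ?_
      rw [abs_mul, abs_mul, abs_mul, abs_mul, abs_of_nonneg (hb x),
        abs_of_nonneg (by linarith [hb1 x] : 0 ≤ 1 - b x), mul_assoc, mul_assoc]
      have : (1 - b x) * (|w x| * |β x|) ≤ 1 * (|w x| * |β x|) := by
        gcongr; linarith [hb x]
      linarith
    have e4 : 1 / (2 * t) * (N ^ 2 * b x) ≤ 1 / (2 * t) * N ^ 2 * (|u x| / μ) := by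
      rw [← mul_assoc]; gcongr; exact hbu x
    have e5 : 1 / t * tailSq N (β x) = 1 / (2 * t) * tailSq N (β x)
        + 1 / (2 * t) * tailSq N (β x) := by field_simp; ring
    rw [mul_add] at e1
    linarith
  · rw [integral_add h3 hw2, integral_add h2 hw1, integral_add h1 hβ2, integral_add hγ2 hu2]
    simp only [integral_const_mul, integral_div]
    ring

/-- Quantitative bound for the pairing of a difference of mollifications with a form with
integrable curl. -/
lemma wedge_defect_le (hη : IsMollifierFamily η C) {A : ℝ} {T : ℝ → ℝ} {α β : Fin d → Space d → ℝ}
    (hα : ControlledForm A T α) (hβ : ControlledForm A T β) {φ : Space d → ℝ}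
    (hφ : ContDiff ℝ ∞ φ) (hφc : HasCompactSupport φ) {M : ℝ} (hM : ∀ x, |φ x| ≤ M)
    (hM' : ∀ i x, |pd i φ x| ≤ M) {δ ε t N μ : ℝ} (hδ : 0 < δ) (hδε : δ ≤ ε) (ht : 0 < t)
    (hN : 0 < N) (hμ : 0 < μ) (k l : Fin d) :
    |∫ x, φ x * ((cv (α k) (η ε) x - cv (α k) (η δ) x) * β l x
        - (cv (α l) (η ε) x - cv (α l) (η δ) x) * β k x)| ≤
      6 * M * μ * A + 2 * (M * (t / 2 * (4 * A)
        + 1 / (2 * t) * (N ^ 2 * (d * (A * (C * ε)) / μ)) + 1 / t * T N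
        + N * (d * (A * (C * ε))) + t / 2 * ((8 + 8 * d ^ 2) * A))) := by
  have hε : 0 < ε := hδ.trans_le hδε
  have hM0 : 0 ≤ M := (abs_nonneg _).trans (hM 0)
  obtain ⟨u, w, hu, huc, hwc, hws, hsp, huL, hwL, hwQ⟩ := exists_hodge_splitting hη hα hδ hδε
  obtain ⟨B, hBi, hBA, hB⟩ := hβ.curl
  set γ : Fin d → Space d → ℝ := fun j x => cv (α j) (η ε) x - cv (α j) (η δ) x with hγ
  -- The curl of `β` is only in `L¹`, so the function tested against it must be small uniformly; the
  -- potential itself is small only in `L¹`.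
  set Θ : Space d → ℝ := fun x => trunc μ (u x) with hΘ
  set b : Space d → ℝ := fun x => 1 - deriv (trunc μ) (u x) with hb
  have hΘs : ContDiff ℝ ∞ Θ := (trunc_contDiff μ).comp hu
  have hbb := fun x => one_sub_deriv_trunc_bounds hμ (u x)
  have hbc : Continuous b := continuous_const.sub ((continuous_deriv_trunc μ).comp hu.continuous)
  have hγ2 : ∀ j, MemLp (γ j) 2 := fun j =>
    (hη.memLp_cv hε (hα.memLp j)).sub (hη.memLp_cv hδ (hα.memLp j))
  have hγc : ∀ j, Continuous (γ j) := fun j =>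
    (cv_contDiff (MemLp.locallyIntegrable_two (hα.memLp j)) (hη.smooth ε hε)
      (hη.hasCompactSupport hε)).continuous.sub
    (cv_contDiff (MemLp.locallyIntegrable_two (hα.memLp j)) (hη.smooth δ hδ)
      (hη.hasCompactSupport hδ)).continuous
  have hβl : ∀ j, LocallyIntegrable (β j) := fun j => MemLp.locallyIntegrable_two (hβ.memLp j)
  have hβi : ∀ j, Integrable (β j) := fun j =>
    integrable_of_memLp_two (hβ.memLp j) (hβ.compact j)
  have hψ : ContDiff ℝ ∞ fun x => φ x * Θ x := hφ.mul hΘs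
  have hψc : HasCompactSupport fun x => φ x * Θ x := hφc.mul_right
  have hpdψ : ∀ k x, pd k (fun x => φ x * Θ x) x
      = pd k φ x * Θ x + φ x * ((1 - b x) * pd k u x) := by
    intro k x
    rw [pd_mul (hφ.differentiable (by simp) x) (hΘs.differentiable (by simp) x), hΘ,
      pd_comp ((trunc_contDiff μ).differentiable (by simp) _) (hu.differentiable (by simp) x)]
    simp only [hb, sub_sub_cancel]
  -- This is `γ - ∇Θ`: from `γ = ∇u + w` and `∇Θ = (1 - b) ∇u` one gets `b ∇u + w = b (γ - w) + w`.
  -- The gradient of `u` is thus eliminated in favour of quantities bounded in `L²`.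
  set ρ : Fin d → Space d → ℝ := fun j x => b x * γ j x + (1 - b x) * w j x with hρ
  have hρc : ∀ j, Continuous (ρ j) := fun j =>
    (hbc.mul (hγc j)).add ((continuous_const.sub hbc).mul (hwc j))
  have hid : ∀ x, φ x * (γ k x * β l x - γ l x * β k x)
      = (pd k (fun x => φ x * Θ x) x * β l x - pd l (fun x => φ x * Θ x) x * β k x)
        - Θ x * (pd k φ x * β l x) + Θ x * (pd l φ x * β k x)
        + φ x * (ρ k x * β l x) - φ x * (ρ l x * β k x) := by
    intro x
    have h1 := hsp k x
    have h2 := hsp l x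
    simp only [hpdψ, hρ, hγ, h1, h2]
    ring
  have hi1 : ∀ k l, Integrable fun x => pd k (fun x => φ x * Θ x) x * β l x := fun k l =>
    integrable_mul_of_locallyIntegrable (contDiff_pd_infty hψ k).continuous
      (hasCompactSupport_pd hψc k) (hβl l)
  have hi2 : ∀ k l, Integrable fun x => Θ x * (pd k φ x * β l x) := fun k l => by
    simp only [← mul_assoc]
    exact integrable_mul_of_locallyIntegrable (hΘs.continuous.mul (contDiff_pd_infty hφ k).continuous)
      (hasCompactSupport_pd hφc k).mul_left (hβl l)
  have hi3 : ∀ k l, Integrable fun x => φ x * (ρ k x * β l x) := fun k l => by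
    simp only [← mul_assoc]
    exact integrable_mul_of_locallyIntegrable (hφ.continuous.mul (hρc k)) hφc.mul_right (hβl l)
  have hi4 := (hi1 k l).sub' (hi1 l k)
  have hi5 := hi4.sub' (hi2 k l)
  have hi6 := hi5.fun_add (hi2 l k)
  have hi7 := hi6.fun_add (hi3 k l)
  refine (congrArg abs (integral_congr_ae (Eventually.of_forall hid))).trans_le ?_
  rw [integral_sub hi7 (hi3 l k), integral_add hi6 (hi3 k l), integral_add hi5 (hi2 l k),
    integral_sub hi4 (hi2 k l), hB k l _ hψ hψc]
  -- The exact part, integrated by parts, meets the curl of `β` here, and the bound `|Θ| ≤ 2 μ`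
  -- gives the smallness.
  have b1 : |∫ x, φ x * Θ x * B k l x| ≤ 2 * M * μ * A := by
    calc |∫ x, φ x * Θ x * B k l x| ≤ (M * (2 * μ)) * ∫ x, |B k l x| := by
          refine abs_integral_mul_le (fun x => ?_) (hBi k l).abs fun x => le_rfl
          rw [abs_mul]
          exact mul_le_mul (hM x) (abs_trunc_le hμ _) (abs_nonneg _) hM0
      _ ≤ (M * (2 * μ)) * A := by gcongr; exact hBA k l
      _ = _ := by ring
  have b2 : ∀ k l, |∫ x, Θ x * (pd k φ x * β l x)| ≤ 2 * M * μ * A := by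
    intro k l
    calc |∫ x, Θ x * (pd k φ x * β l x)| = |∫ x, (Θ x * pd k φ x) * β l x| := by
          simp only [mul_assoc]
      _ ≤ (2 * μ * M) * ∫ x, |β l x| := by
          refine abs_integral_mul_le (fun x => ?_) (hβi l).abs fun x => le_rfl
          rw [abs_mul]
          exact mul_le_mul (abs_trunc_le hμ _) (hM' k x) (abs_nonneg _) (by positivity)
      _ ≤ (2 * μ * M) * A := by gcongr; exact hβ.l1 l
      _ = _ := by ring
  have b3 : ∀ k l, |∫ x, φ x * (ρ k x * β l x)| ≤ M * (t / 2 * (4 * A)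
        + 1 / (2 * t) * (N ^ 2 * (d * (A * (C * ε)) / μ)) + 1 / t * T N
        + N * (d * (A * (C * ε))) + t / 2 * ((8 + 8 * d ^ 2) * A)) := by
    intro k l
    refine (abs_integral_remainder_le (u := u) (μ := μ) ht hN.le hM (hγ2 k)
      (memLp_two_of_continuous (hwc k) (hws k)) ((hwc k).integrable_of_hasCompactSupport (hws k))
      (hβ.memLp l) (hu.continuous.integrable_of_hasCompactSupport huc) (fun x => (hbb x).1)
      (fun x => (hbb x).2.1) (fun x => (hbb x).2.2)).trans ?_
    have e1 : ∫ x, γ k x ^ 2 ≤ 4 * A :=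
      (integral_cv_sub_sq_le hη (hα.memLp k) hδ hε).trans (by linarith [hα.l2 k])
    have e2 := hβ.tail l N hN
    have e3 := hwL k
    have e4 := hwQ k
    gcongr
  have c1 := b2 k l
  have c2 := b2 l k
  have c3 := b3 k l
  have c4 := b3 l k
  rw [abs_le] at *
  constructor <;> linarith [b1.1, b1.2, c1.1, c1.2, c2.1, c2.2, c3.1, c3.2, c4.1, c4.2]

lemma exists_bound_of_hasCompactSupport {f : Space d → ℝ} (hf : Continuous f)
    (hc : HasCompactSupport f) : ∃ M, 0 ≤ M ∧ ∀ x, |f x| ≤ M := by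
  obtain ⟨M, hM⟩ := hc.exists_bound_of_continuous hf
  exact ⟨M, (norm_nonneg _).trans (hM 0), hM⟩

/-- The defect is small uniformly over all controlled forms. -/
theorem exists_wedge_defect_le (hη : IsMollifierFamily η C) (A : ℝ) {T : ℝ → ℝ}
    (hT : Tendsto T atTop (𝓝 0)) {φ : Space d → ℝ}
    (hφ : ContDiff ℝ ∞ φ) (hφc : HasCompactSupport φ) {τ : ℝ} (hτ : 0 < τ) :
    ∀ᶠ ε in 𝓝[>] (0 : ℝ), ∀ δ, 0 < δ → δ ≤ ε → ∀ α β : Fin d → Space d → ℝ,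
      ControlledForm A T α → ControlledForm A T β → ∀ k l,
      |∫ x, φ x * ((cv (α k) (η ε) x - cv (α k) (η δ) x) * β l x
        - (cv (α l) (η ε) x - cv (α l) (η δ) x) * β k x)| ≤ τ := by
  obtain ⟨M, hM0, hM, hM'⟩ : ∃ M, 0 ≤ M ∧ (∀ x, |φ x| ≤ M) ∧ ∀ i x, |pd i φ x| ≤ M := by
    obtain ⟨M1, h1, hM1⟩ := exists_bound_of_hasCompactSupport hφ.continuous hφc
    choose M2 h2 hM2 using fun i => exists_bound_of_hasCompactSupport
      (contDiff_pd_infty hφ i).continuous (hasCompactSupport_pd hφc i)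
    refine ⟨M1 + ∑ i, M2 i, add_nonneg h1 (Finset.sum_nonneg fun i _ => h2 i), fun x => ?_,
      fun i x => ?_⟩
    · linarith [hM1 x, Finset.sum_nonneg fun i (_ : i ∈ Finset.univ) => h2 i]
    · have := Finset.single_le_sum (fun i _ => h2 i) (Finset.mem_univ i)
      linarith [hM2 i x]
  set P := 2 * M * (2 * A + (4 + 4 * d ^ 2) * A) with hP
  have small : ∀ c : ℝ, ∃ s : ℝ, 0 < s ∧ c * s ≤ τ / 4 := by
    intro c
    refine ⟨τ / (4 * (|c| + 1)), by positivity, ?_⟩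
    rw [mul_div_assoc', div_le_div_iff₀ (by positivity) (by norm_num)]
    nlinarith [le_abs_self c, abs_nonneg c]
  -- The order of choice matters: `t` and `μ` absorb the terms that are merely bounded, then `N` is
  -- taken large depending on `t`, and `ε₀` comes last because its coefficient `Q` involves `t`, `μ`
  -- and `N`.
  obtain ⟨t, ht, htP⟩ := small P
  obtain ⟨μ, hμ, hμP⟩ := small (6 * M * A)
  obtain ⟨N, hN, hNT⟩ : ∃ N, 0 < N ∧ 2 * M / t * T N ≤ τ / 4 := by
    have h := hT.const_mul (2 * M / t)
    rw [mul_zero] at h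
    obtain ⟨N, h1, h2⟩ := ((h.eventually_le_const (by positivity : (0 : ℝ) < τ / 4)).and
      (eventually_gt_atTop 0)).exists
    exact ⟨N, h2, h1⟩
  set Q := M * (1 / t * (N ^ 2 * (d * (A * C) / μ))) + 2 * M * (N * (d * (A * C))) with hQ
  obtain ⟨ε₀, hε₀, hεQ⟩ := small |Q|
  filter_upwards [Ioo_mem_nhdsGT hε₀] with ε hε δ hδ hδε α β hα hβ k l
  refine (wedge_defect_le hη hα hβ hφ hφc hM hM' hδ hδε ht hN hμ k l).trans ?_
  have e1 : 6 * M * μ * A + 2 * (M * (t / 2 * (4 * A)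
        + 1 / (2 * t) * (N ^ 2 * (d * (A * (C * ε)) / μ)) + 1 / t * T N
        + N * (d * (A * (C * ε))) + t / 2 * ((8 + 8 * d ^ 2) * A)))
      = 6 * M * A * μ + P * t + 2 * M / t * T N + Q * ε := by
    rw [hP, hQ]; field_simp; ring
  have e2 : Q * ε ≤ |Q| * ε₀ := mul_le_mul (le_abs_self Q) hε.2.le hε.1.le (abs_nonneg _)
  rw [e1]
  linarith

end

end

section


variable {d : ℕ}

/-! ### Weak convergence and products -/

/-- Cauchy-Schwarz through the discriminant of `t ↦ ∫ (t f + g)²`. -/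
lemma sq_integral_mul_le {α : Type*} [MeasurableSpace α] {ν : Measure α} {f g : α → ℝ}
    (hf : MemLp f 2 ν) (hg : MemLp g 2 ν) :
    (∫ x, f x * g x ∂ν) ^ 2 ≤ (∫ x, f x ^ 2 ∂ν) * ∫ x, g x ^ 2 ∂ν := by
  have h1 := hf.integrable_sq
  have h2 := hg.integrable_sq
  have h3 : Integrable (fun x => f x * g x) ν := hf.integrable_mul hg
  have key : ∀ t : ℝ, 0 ≤ (∫ x, f x ^ 2 ∂ν) * (t * t) + (2 * ∫ x, f x * g x ∂ν) * t
      + ∫ x, g x ^ 2 ∂ν := by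
    intro t
    have h : 0 ≤ ∫ x, (t * f x + g x) ^ 2 ∂ν := integral_nonneg fun x => sq_nonneg _
    have he : ∀ x, (t * f x + g x) ^ 2
        = t * t * f x ^ 2 + 2 * t * (f x * g x) + g x ^ 2 := fun x => by ring
    simp only [he] at h
    rw [integral_add ((h1.const_mul _).fun_add (h3.const_mul _)) h2,
      integral_add (h1.const_mul _) (h3.const_mul _), integral_const_mul, integral_const_mul] at h
    linarith
  have := discrim_le_zero key
  unfold discrim at this
  linarith

lemma tendsto_integral_mul_zero {α ι : Type*} [MeasurableSpace α] {ν : Measure α} {l : Filter ι}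
    {f g : ι → α → ℝ} (hf : ∀ᶠ i in l, MemLp (f i) 2 ν) (hg : ∀ i, MemLp (g i) 2 ν)
    (h0 : Tendsto (fun i => ∫ x, f i x ^ 2 ∂ν) l (𝓝 0)) {B : ℝ} (hB : ∀ i, ∫ x, g i x ^ 2 ∂ν ≤ B) :
    Tendsto (fun i => ∫ x, f i x * g i x ∂ν) l (𝓝 0) := by
  have h1 : Tendsto (fun i => √((∫ x, f i x ^ 2 ∂ν) * B)) l (𝓝 0) := by
    have := (h0.mul_const B).sqrt
    simpa using this
  refine squeeze_zero_norm' ?_ h1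
  filter_upwards [hf] with i hi
  rw [Real.norm_eq_abs]
  apply Real.abs_le_sqrt
  refine (sq_integral_mul_le hi (hg i)).trans ?_
  exact mul_le_mul_of_nonneg_left (hB i) (integral_nonneg fun x => sq_nonneg _)

/-- Weak convergence in `L²`. -/
def WeakL2 {α : Type*} [MeasurableSpace α] (ν : Measure α) (f : ℕ → α → ℝ) (f₀ : α → ℝ) : Prop :=
  ∀ ψ : α → ℝ, MemLp ψ 2 ν → Tendsto (fun n => ∫ x, f n x * ψ x ∂ν) atTop (𝓝 (∫ x, f₀ x * ψ x ∂ν))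

lemma MemLp.continuous_mul {φ f : Space d → ℝ} (hf : MemLp f 2) (hφ : Continuous φ)
    (hφc : HasCompactSupport φ) : MemLp (fun x => φ x * f x) 2 := by
  obtain ⟨M, -, hM⟩ := exists_bound_of_hasCompactSupport hφ hφc
  refine hf.of_le_mul (c := M) (hφ.aestronglyMeasurable.mul hf.aestronglyMeasurable)
    (Eventually.of_forall fun x => ?_)
  rw [norm_mul]
  exact mul_le_mul_of_nonneg_right (hM x) (norm_nonneg _)

section

variable {η : ℝ → Space d → ℝ} {C : ℝ}

lemma tendsto_integral_cv_mul (hη : IsMollifierFamily η C) {f b φ : Space d → ℝ}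
    (hf : MemLp f 2) (hb : MemLp b 2) (hφ : Continuous φ) (hφc : HasCompactSupport φ) :
    Tendsto (fun s => ∫ x, φ x * (cv f (η s) x * b x)) (𝓝[>] 0) (𝓝 (∫ x, φ x * (f x * b x))) := by
  have hφb := MemLp.continuous_mul hb hφ hφc
  have hm : ∀ᶠ s in 𝓝[>] (0 : ℝ), MemLp (fun x => cv f (η s) x - f x) 2 := by
    filter_upwards [self_mem_nhdsWithin] with s hs using (hη.memLp_cv hs hf).sub hf
  have h := tendsto_integral_mul_zero hm (fun _ => hφb) (hη.tendsto_integral_sq hf) fun _ => le_rfl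
  rw [← tendsto_sub_nhds_zero_iff]
  refine h.congr' ?_
  filter_upwards [self_mem_nhdsWithin] with s (hs : 0 < s)
  rw [← integral_sub ?_ ?_]
  · congr 1; ext x; ring
  · have := (hη.memLp_cv hs hf).integrable_mul hφb
    refine this.congr (Eventually.of_forall fun x => ?_)
    simp only [Pi.mul_apply]; ring
  · have := hf.integrable_mul hφb
    refine this.congr (Eventually.of_forall fun x => ?_)
    simp only [Pi.mul_apply]; ring

lemma abs_cv_le_of_sq {f K : Space d → ℝ} (hf : MemLp f 2) (hK : Continuous K)
    (hKc : HasCompactSupport K) {A : ℝ} (hA : ∫ x, f x ^ 2 ≤ A) (x : Space d) :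
    |cv f K x| ≤ √(A * ∫ x, K x ^ 2) := by
  have hr : MemLp (fun t => K (x - t)) 2 :=
    (memLp_two_of_continuous hK hKc).comp_measurePreserving
      (Measure.measurePreserving_sub_left volume x)
  apply Real.abs_le_sqrt
  rw [cv_apply]
  refine (sq_integral_mul_le hf hr).trans ?_
  rw [integral_sub_left_eq_self (fun t => K t ^ 2)]
  exact mul_le_mul_of_nonneg_right hA (integral_nonneg fun x => sq_nonneg _)

/-- Convolution with a fixed kernel tests against a translate of it. Weak convergence of `a n`
therefore becomes pointwise convergence with a uniform bound, and after multiplication by `φ` strong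
`L²` convergence; a strongly and a weakly convergent factor can be multiplied. -/
lemma WeakL2.tendsto_integral_cv_mul {K φ : Space d → ℝ} (hK : ContDiff ℝ ∞ K)
    (hKc : HasCompactSupport K) {a b : ℕ → Space d → ℝ} {a₀ b₀ : Space d → ℝ}
    (ha : WeakL2 volume a a₀) (hb : WeakL2 volume b b₀) (ham : ∀ n, MemLp (a n) 2)
    (ha₀ : MemLp a₀ 2) (hbm : ∀ n, MemLp (b n) 2) {A : ℝ}
    (haA : ∀ n, ∫ x, a n x ^ 2 ≤ A) (hbA : ∀ n, ∫ x, b n x ^ 2 ≤ A)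
    (hφ : Continuous φ) (hφc : HasCompactSupport φ) :
    Tendsto (fun n => ∫ x, φ x * (cv (a n) K x * b n x)) atTop
      (𝓝 (∫ x, φ x * (cv a₀ K x * b₀ x))) := by
  have hcont : ∀ {f : Space d → ℝ}, MemLp f 2 → Continuous (cv f K) := fun hf =>
    (cv_contDiff (MemLp.locallyIntegrable_two hf) hK hKc).continuous
  have hcm : ∀ {f : Space d → ℝ}, MemLp f 2 → MemLp (fun x => φ x * cv f K x) 2 := fun hf =>
    memLp_two_of_continuous (hφ.mul (hcont hf)) hφc.mul_right
  have hpt : ∀ x, Tendsto (fun n => cv (a n) K x) atTop (𝓝 (cv a₀ K x)) := fun x =>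
    ha _ (memLp_two_of_continuous (hK.continuous.comp (continuous_const.sub continuous_id))
      (hasCompactSupport_reflect hKc x))
  have h2 := hb _ (hcm ha₀)
  have hd : Tendsto (fun n => ∫ x, (φ x * cv (a n) K x - φ x * cv a₀ K x) ^ 2) atTop (𝓝 0) := by
    set R := √(A * ∫ x, K x ^ 2) + √((∫ x, a₀ x ^ 2) * ∫ x, K x ^ 2) with hR
    have h := tendsto_integral_of_dominated_convergence (μ := volume)
      (F := fun n x => (φ x * cv (a n) K x - φ x * cv a₀ K x) ^ 2) (f := fun _ => 0)
      (fun x => φ x ^ 2 * R ^ 2)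
      (fun n => (((hφ.mul (hcont (ham n))).sub (hφ.mul (hcont ha₀))).pow 2).aestronglyMeasurable)
      ((memLp_two_of_continuous hφ hφc).integrable_sq.mul_const _)
      (fun n => Eventually.of_forall fun x => ?_) (Eventually.of_forall fun x => ?_)
    · simpa using h
    · rw [Real.norm_eq_abs, abs_of_nonneg (sq_nonneg _), ← mul_sub, mul_pow]
      gcongr ?_ * ?_
      apply sq_le_sq.2
      refine (abs_sub _ _).trans ((add_le_add (abs_cv_le_of_sq (ham n) hK.continuous hKc (haA n) x)
        (abs_cv_le_of_sq ha₀ hK.continuous hKc le_rfl x)).trans (le_abs_self _))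
    · have := ((((hpt x).const_mul (φ x)).sub_const (φ x * cv a₀ K x)).pow 2)
      simpa using this
  have h1 := tendsto_integral_mul_zero
    (Eventually.of_forall fun n => (hcm (ham n)).sub (hcm ha₀)) hbm hd hbA
  have h3 := h1.add h2
  rw [zero_add] at h3
  refine (h3.congr fun n => ?_).trans_eq ?_
  · have i1 : Integrable fun x => (φ x * cv (a n) K x - φ x * cv a₀ K x) * b n x :=
      ((hcm (ham n)).sub (hcm ha₀)).integrable_mul (hbm n)
    have i2 : Integrable fun x => b n x * (φ x * cv a₀ K x) :=
      (hbm n).integrable_mul (hcm ha₀)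
    refine (integral_add i1 i2).symm.trans ?_
    congr 1; ext x; ring
  · congr 2; ext x; ring

/-- Interchange of the limits in `n` and in the scale, legitimate because the approximation error is
uniform in `n`. -/
lemma tendsto_of_uniform_approx {X : ℕ → ℝ} {x₀ : ℝ} {Y : ℝ → ℕ → ℝ} {y : ℝ → ℝ}
    (h1 : ∀ s, 0 < s → Tendsto (Y s) atTop (𝓝 (y s))) (h2 : Tendsto y (𝓝[>] 0) (𝓝 x₀))
    (h3 : ∀ τ, 0 < τ → ∀ᶠ s in 𝓝[>] (0 : ℝ), ∀ n, |Y s n - X n| ≤ τ) :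
    Tendsto X atTop (𝓝 x₀) := by
  rw [Metric.tendsto_nhds]
  intro τ hτ
  obtain ⟨s, ⟨hs1, hs2⟩, hs3⟩ := ((((Metric.tendsto_nhds.1 h2) (τ / 3) (by positivity)).and
    (h3 (τ / 3) (by positivity))).and self_mem_nhdsWithin).exists
  filter_upwards [(Metric.tendsto_nhds.1 (h1 s hs3)) (τ / 3) (by positivity)] with n hn
  have h4 := hs2 n
  rw [Real.dist_eq] at *
  rw [abs_lt] at *
  rw [abs_le] at h4
  constructor <;> linarith [hn.1, hn.2, hs1.1, hs1.2, h4.1, h4.2]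

lemma integrable_mul_mul {φ f g : Space d → ℝ} (hφ : Continuous φ) (hφc : HasCompactSupport φ)
    (hf : MemLp f 2) (hg : MemLp g 2) : Integrable fun x => φ x * (f x * g x) := by
  refine ((MemLp.continuous_mul hf hφ hφc).integrable_mul hg).congr
    (Eventually.of_forall fun x => ?_)
  simp only [Pi.mul_apply]; ring

/-- Weak continuity of the exterior product of forms with curl bounded in `L¹`. -/
theorem tendsto_integral_wedge (hd : 0 < d) {A : ℝ} {T : ℝ → ℝ} (hT : Tendsto T atTop (𝓝 0))
    {α β : ℕ → Fin d → Space d → ℝ} {α₀ β₀ : Fin d → Space d → ℝ}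
    (hα : ∀ n, ControlledForm A T (α n)) (hβ : ∀ n, ControlledForm A T (β n))
    (hα₀ : ∀ j, MemLp (α₀ j) 2) (hβ₀ : ∀ j, MemLp (β₀ j) 2)
    (hαw : ∀ j, WeakL2 volume (fun n => α n j) (α₀ j))
    (hβw : ∀ j, WeakL2 volume (fun n => β n j) (β₀ j)) {φ : Space d → ℝ}
    (hφ : ContDiff ℝ ∞ φ) (hφc : HasCompactSupport φ) (k l : Fin d) :
    Tendsto (fun n => ∫ x, φ x * (α n k x * β n l x - α n l x * β n k x)) atTop
      (𝓝 (∫ x, φ x * (α₀ k x * β₀ l x - α₀ l x * β₀ k x))) := by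
  obtain ⟨η, C, hη⟩ := exists_isMollifierFamily hd
  have hφ' := hφ.continuous
  have hsplit : ∀ {f g f' g' : Space d → ℝ}, MemLp f 2 → MemLp g 2 → MemLp f' 2 → MemLp g' 2 →
      ∫ x, φ x * (f x * g x - f' x * g' x)
        = (∫ x, φ x * (f x * g x)) - ∫ x, φ x * (f' x * g' x) := by
    intro f g f' g' hf hg hf' hg'
    rw [← integral_sub (integrable_mul_mul hφ' hφc hf hg) (integrable_mul_mul hφ' hφc hf' hg')]
    simp only [mul_sub]
  refine tendsto_of_uniform_approx
    (Y := fun s n => ∫ x, φ x * (cv (α n k) (η s) x * β n l x - cv (α n l) (η s) x * β n k x))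
    (y := fun s => ∫ x, φ x * (cv (α₀ k) (η s) x * β₀ l x - cv (α₀ l) (η s) x * β₀ k x))
    (fun s hs => ?_) ?_ fun τ hτ => ?_
  · have hp : ∀ k l, _ := fun k l => WeakL2.tendsto_integral_cv_mul (hη.smooth s hs)
      (hη.hasCompactSupport hs)
      (hαw k) (hβw l) (fun n => (hα n).memLp k) (hα₀ k) (fun n => (hβ n).memLp l)
      (fun n => (hα n).l2 k) (fun n => (hβ n).l2 l) hφ' hφc
    refine (((hp k l).sub (hp l k)).congr fun n => ?_).trans_eq ?_
    · rw [hsplit (hη.memLp_cv hs ((hα n).memLp k)) ((hβ n).memLp l)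
        (hη.memLp_cv hs ((hα n).memLp l)) ((hβ n).memLp k)]
    · rw [hsplit (hη.memLp_cv hs (hα₀ k)) (hβ₀ l) (hη.memLp_cv hs (hα₀ l)) (hβ₀ k)]
  · rw [hsplit (hα₀ k) (hβ₀ l) (hα₀ l) (hβ₀ k)]
    refine ((tendsto_integral_cv_mul hη (hα₀ k) (hβ₀ l) hφ' hφc).sub
      (tendsto_integral_cv_mul hη (hα₀ l) (hβ₀ k) hφ' hφc)).congr' ?_
    filter_upwards [self_mem_nhdsWithin] with s (hs : 0 < s)
    rw [hsplit (hη.memLp_cv hs (hα₀ k)) (hβ₀ l) (hη.memLp_cv hs (hα₀ l)) (hβ₀ k)]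
  · filter_upwards [exists_wedge_defect_le hη A hT hφ hφc hτ, self_mem_nhdsWithin]
      with s hs (hs0 : 0 < s) n
    -- The defect estimate compares two mollifications. Letting the finer scale tend to zero
    -- compares the mollification with the form itself, since the bound does not depend on `δ`.
    have hl : Tendsto (fun δ => (∫ x, φ x * (cv (α n k) (η s) x * β n l x
        - cv (α n l) (η s) x * β n k x)) - ((∫ x, φ x * (cv (α n k) (η δ) x * β n l x))
        - ∫ x, φ x * (cv (α n l) (η δ) x * β n k x))) (𝓝[>] 0)
        (𝓝 ((∫ x, φ x * (cv (α n k) (η s) x * β n l x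
        - cv (α n l) (η s) x * β n k x)) - ∫ x, φ x * (α n k x * β n l x
        - α n l x * β n k x))) := by
      rw [hsplit ((hα n).memLp k) ((hβ n).memLp l) ((hα n).memLp l) ((hβ n).memLp k)]
      exact ((tendsto_integral_cv_mul hη ((hα n).memLp k) ((hβ n).memLp l) hφ' hφc).sub
        (tendsto_integral_cv_mul hη ((hα n).memLp l) ((hβ n).memLp k) hφ' hφc)).const_sub _
    refine le_of_tendsto hl.abs ?_
    filter_upwards [Ioo_mem_nhdsGT hs0] with δ hδ
    refine le_trans (le_of_eq ?_) (hs δ hδ.1 hδ.2.le (α n) (β n) (hα n) (hβ n) k l)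
    congr 1
    have m1 := fun j => hη.memLp_cv hs0 ((hα n).memLp j)
    have m2 := fun j => hη.memLp_cv hδ.1 ((hα n).memLp j)
    have m3 : ∀ j, MemLp (fun x => cv (α n j) (η s) x - cv (α n j) (η δ) x) 2 := fun j =>
      (m1 j).sub (m2 j)
    rw [hsplit (m1 k) ((hβ n).memLp l) (m1 l) ((hβ n).memLp k),
      hsplit (m3 k) ((hβ n).memLp l) (m3 l) ((hβ n).memLp k)]
    have e : ∀ k l, ∫ x, φ x * ((cv (α n k) (η s) x - cv (α n k) (η δ) x) * β n l x)
        = (∫ x, φ x * (cv (α n k) (η s) x * β n l x))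
          - ∫ x, φ x * (cv (α n k) (η δ) x * β n l x) := by
      intro k l
      rw [← hsplit (m1 k) ((hβ n).memLp l) (m2 k) ((hβ n).memLp l)]
      simp only [sub_mul]
    rw [e, e]; ring

/-! ### Products with a factor whose gradient is bounded in `L¹` -/

/-- Compactly supported functions bounded in `L²` whose weak gradients are bounded in `L¹`. -/
structure ControlledFun (A : ℝ) (f : Space d → ℝ) : Prop where
  memLp : MemLp f 2
  l2 : ∫ x, f x ^ 2 ≤ A
  grad : ∃ f' : Fin d → Space d → ℝ, (∀ i, Integrable (f' i)) ∧
    (∀ i, ∫ x, |f' i x| ≤ A) ∧ WeakGrad f f'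

/-- With a full gradient at hand, `f * div G` equals `Σ ∂_i f * G_i`, and the `L¹` norm of `G` gives
the rate: a quantitative form of Rellich compactness. -/
lemma integral_abs_cv_sub_le (hη : IsMollifierFamily η C) {A : ℝ} {f : Space d → ℝ}
    (hf : ControlledFun A f) {δ ε : ℝ} (hδ : 0 < δ) (hδε : δ ≤ ε) :
    Integrable (fun x => cv f (η ε) x - cv f (η δ) x) ∧
    ∫ x, |cv f (η ε) x - cv f (η δ) x| ≤ d * (A * (C * ε)) := by
  obtain ⟨G, hG, hGc, -, hdiv, hGL⟩ := hη.exists_kernel δ ε hδ hδε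
  obtain ⟨F, hFi, hFA, hF⟩ := hf.grad
  have hε : 0 < ε := hδ.trans_le hδε
  have hfl := MemLp.locallyIntegrable_two hf.memLp
  have hGi : ∀ i, Integrable (G i) := fun i =>
    (hG i).continuous.integrable_of_hasCompactSupport (hGc i)
  have h : ∀ x, cv f (η ε) x - cv f (η δ) x = ∑ i, cv (F i) (G i) x := by
    intro x
    rw [← cv_sub_right hfl (hη.smooth ε hε).continuous (hη.hasCompactSupport hε)
      (hη.smooth δ hδ).continuous (hη.hasCompactSupport hδ)]
    have : (fun t => η ε t - η δ t) = fun t => ∑ i, pd i (G i) t := by ext t; rw [hdiv]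
    rw [this, cv_sum_right _ hfl (fun i => (contDiff_pd_infty (hG i) i).continuous)
      (fun i => hasCompactSupport_pd (hGc i) i)]
    exact Finset.sum_congr rfl fun i _ => hF.cv_eq (hG i) (hGc i) i x
  simp only [h]
  refine ⟨integrable_finsetSum _ fun i _ => integrable_cv (hFi i) (hGi i),
    (integral_abs_sum_le _ fun i => integrable_cv (hFi i) (hGi i)).trans ?_⟩
  calc ∑ i, ∫ x, |cv (F i) (G i) x| ≤ ∑ _i : Fin d, A * (C * ε) := by
        refine Finset.sum_le_sum fun i _ => (integral_abs_cv_le (hFi i) (hGi i)).trans ?_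
        exact mul_le_mul (hFA i) (hGL i) (integral_nonneg fun x => abs_nonneg _)
          ((integral_nonneg fun x => abs_nonneg _).trans (hFA i))
    _ = d * (A * (C * ε)) := by simp

/-- The difference of mollifications is itself small in `L¹` and bounded in `L²`, so it can be
paired directly with a function of small tails; no integration by parts and no truncation are
involved. -/
lemma exists_fun_defect_le (hη : IsMollifierFamily η C) (A : ℝ) {T : ℝ → ℝ}
    (hT : Tendsto T atTop (𝓝 0)) {φ : Space d → ℝ}
    (hφ : Continuous φ) (hφc : HasCompactSupport φ) {τ : ℝ} (hτ : 0 < τ) :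
    ∀ᶠ ε in 𝓝[>] (0 : ℝ), ∀ δ, 0 < δ → δ ≤ ε → ∀ f h : Space d → ℝ,
      ControlledFun A f → MemLp h 2 → (∀ N, 0 < N → ∫ x, tailSq N (h x) ≤ T N) →
      |∫ x, φ x * ((cv f (η ε) x - cv f (η δ) x) * h x)| ≤ τ := by
  obtain ⟨M, hM0, hM⟩ := exists_bound_of_hasCompactSupport hφ hφc
  have small : ∀ c : ℝ, ∃ s : ℝ, 0 < s ∧ c * s ≤ τ / 3 := by
    intro c
    refine ⟨τ / (3 * (|c| + 1)), by positivity, ?_⟩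
    rw [mul_div_assoc', div_le_div_iff₀ (by positivity) (by norm_num)]
    nlinarith [le_abs_self c, abs_nonneg c]
  obtain ⟨t, ht, htP⟩ := small (M * (2 * A))
  obtain ⟨N, hN, hNT⟩ : ∃ N, 0 < N ∧ M / (2 * t) * T N ≤ τ / 3 := by
    have h := hT.const_mul (M / (2 * t))
    rw [mul_zero] at h
    obtain ⟨N, h1, h2⟩ := ((h.eventually_le_const (by positivity : (0 : ℝ) < τ / 3)).and
      (eventually_gt_atTop 0)).exists
    exact ⟨N, h2, h1⟩
  set Q := M * (N * (d * (A * C))) with hQ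
  obtain ⟨ε₀, hε₀, hεQ⟩ := small |Q|
  filter_upwards [Ioo_mem_nhdsGT hε₀] with ε hε δ hδ hδε f h hf hh hhT
  obtain ⟨hxi, hx1⟩ := integral_abs_cv_sub_le hη hf hδ hδε
  set x : Space d → ℝ := fun y => cv f (η ε) y - cv f (η δ) y with hx
  have hx2 : MemLp x 2 := (hη.memLp_cv hε.1 hf.memLp).sub (hη.memLp_cv hδ hf.memLp)
  have hxq : ∫ y, x y ^ 2 ≤ 4 * A :=
    (integral_cv_sub_sq_le hη hf.memLp hδ hε.1).trans (by linarith [hf.l2])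
  have i1 := hxi.abs.const_mul N
  have i2 := hx2.integrable_sq.const_mul (t / 2)
  have i3 := (integrable_tailSq hh N).const_mul (1 / (2 * t))
  have i4 := i2.fun_add i3
  have i5 := i1.fun_add i4
  refine (abs_integral_mul_le hM i5 fun y => ?_).trans ?_
  · rw [abs_mul]; exact mul_le_tail ht hN.le
  · rw [integral_add i1 i4, integral_add i2 i3]
    simp only [integral_const_mul]
    calc _ ≤ M * (N * (d * (A * (C * ε))) + (t / 2 * (4 * A) + 1 / (2 * t) * T N)) := by
          have := hhT N hN
          gcongr
      _ = M * (2 * A) * t + M / (2 * t) * T N + Q * ε := by rw [hQ]; field_simp; ring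
      _ ≤ τ / 3 + τ / 3 + τ / 3 := by
          have e2 : Q * ε ≤ |Q| * ε₀ := mul_le_mul (le_abs_self Q) hε.2.le hε.1.le (abs_nonneg _)
          linarith
      _ = τ := by ring

/-- Products of functions with gradients bounded in `L¹` with weakly convergent functions. -/
theorem tendsto_integral_controlledFun_mul (hd : 0 < d) {A : ℝ} {T : ℝ → ℝ}
    (hT : Tendsto T atTop (𝓝 0)) {f h : ℕ → Space d → ℝ} {f₀ h₀ : Space d → ℝ}
    (hf : ∀ n, ControlledFun A (f n)) (hh : ∀ n, MemLp (h n) 2) (hhA : ∀ n, ∫ x, h n x ^ 2 ≤ A)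
    (hhT : ∀ n N, 0 < N → ∫ x, tailSq N (h n x) ≤ T N) (hf₀ : MemLp f₀ 2) (hh₀ : MemLp h₀ 2)
    (hfw : WeakL2 volume f f₀) (hhw : WeakL2 volume h h₀) {φ : Space d → ℝ}
    (hφ : Continuous φ) (hφc : HasCompactSupport φ) :
    Tendsto (fun n => ∫ x, φ x * (f n x * h n x)) atTop (𝓝 (∫ x, φ x * (f₀ x * h₀ x))) := by
  obtain ⟨η, C, hη⟩ := exists_isMollifierFamily hd
  refine tendsto_of_uniform_approx
    (Y := fun s n => ∫ x, φ x * (cv (f n) (η s) x * h n x))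
    (y := fun s => ∫ x, φ x * (cv f₀ (η s) x * h₀ x))
    (fun s hs => ?_) (tendsto_integral_cv_mul hη hf₀ hh₀ hφ hφc) fun τ hτ => ?_
  · exact WeakL2.tendsto_integral_cv_mul (hη.smooth s hs) (hη.hasCompactSupport hs) hfw hhw
      (fun n => (hf n).memLp) hf₀ hh (fun n => (hf n).l2) hhA hφ hφc
  · filter_upwards [exists_fun_defect_le hη A hT hφ hφc hτ, self_mem_nhdsWithin]
      with s hs (hs0 : 0 < s) n
    have hl := (tendsto_integral_cv_mul hη (hf n).memLp (hh n) hφ hφc).const_sub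
      (∫ x, φ x * (cv (f n) (η s) x * h n x))
    refine le_of_tendsto hl.abs ?_
    filter_upwards [Ioo_mem_nhdsGT hs0] with δ hδ
    refine le_trans (le_of_eq ?_) (hs δ hδ.1 hδ.2.le (f n) (h n) (hf n) (hh n) (hhT n))
    congr 1
    rw [← integral_sub (integrable_mul_mul hφ hφc (hη.memLp_cv hs0 (hf n).memLp) (hh n))
      (integrable_mul_mul hφ hφc (hη.memLp_cv hδ.1 (hf n).memLp) (hh n))]
    congr 1; ext x; ring

end

end

section


/-! ### Weak sequential compactness -/

section

variable {X : Type*} [MeasurableSpace X] {ν : Measure X}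

lemma L2.inner_toLp_eq {f g : X → ℝ} (hf : MemLp f 2 ν) (hg : MemLp g 2 ν) :
    inner ℝ (hf.toLp f) (hg.toLp g) = ∫ x, f x * g x ∂ν := by
  rw [L2.inner_def]
  refine integral_congr_ae ?_
  filter_upwards [hf.coeFn_toLp, hg.coeFn_toLp] with x h1 h2
  rw [h1, h2]
  simp [mul_comm]

lemma norm_toLp_two_le {f : X → ℝ} (hf : MemLp f 2 ν) {R : ℝ} (hR : 0 ≤ R)
    (h : eLpNorm f 2 ν ≤ ENNReal.ofReal R) : ‖hf.toLp f‖ ≤ R := by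
  rw [Lp.norm_toLp]
  exact ENNReal.toReal_le_of_le_ofReal hR h

/-- Bounded sequences in `L²` have weakly convergent subsequences. -/
lemma exists_weakL2_subseq [TopologicalSpace.SeparableSpace (Lp ℝ 2 ν)] {f : ℕ → X → ℝ}
    (hf : ∀ n, MemLp (f n) 2 ν) {R : ℝ} (hR : 0 ≤ R)
    (h : ∀ n, eLpNorm (f n) 2 ν ≤ ENNReal.ofReal R) :
    ∃ (s : ℕ → ℕ) (f₀ : X → ℝ), StrictMono s ∧ MemLp f₀ 2 ν ∧ WeakL2 ν (fun n => f (s n)) f₀ := by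
  set F : ℕ → WeakDual ℝ (Lp ℝ 2 ν) := fun n =>
    StrongDual.toWeakDual (InnerProductSpace.toDual ℝ (Lp ℝ 2 ν) ((hf n).toLp (f n))) with hF
  have hmem : ∀ n, F n ∈ WeakDual.toStrongDual ⁻¹'
      Metric.closedBall (0 : StrongDual ℝ (Lp ℝ 2 ν)) R := by
    intro n
    rw [Set.mem_preimage, mem_closedBall_zero_iff]
    refine le_trans (le_of_eq ?_) (norm_toLp_two_le (hf n) hR (h n))
    exact (InnerProductSpace.toDual ℝ (Lp ℝ 2 ν)).norm_map _
  -- Sequential Banach-Alaoglu for the functionals attached by the Riesz isomorphism; separability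
  -- of `L²` provides the sequential form.
  obtain ⟨L, -, s, hs, hL⟩ := WeakDual.isSeqCompact_closedBall ℝ (Lp ℝ 2 ν) 0 R hmem
  set f₀ : Lp ℝ 2 ν := (InnerProductSpace.toDual ℝ (Lp ℝ 2 ν)).symm (WeakDual.toStrongDual L)
  refine ⟨s, f₀, hs, Lp.memLp f₀, fun ψ hψ => ?_⟩
  have h1 : Tendsto (fun n => F (s n) (hψ.toLp ψ)) atTop (𝓝 (L (hψ.toLp ψ))) :=
    ((WeakDual.eval_continuous (hψ.toLp ψ)).tendsto L).comp hL
  refine (h1.congr fun n => ?_).trans_eq ?_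
  · rw [← L2.inner_toLp_eq (hf (s n)) hψ]; rfl
  · rw [← L2.inner_toLp_eq (Lp.memLp f₀) hψ, Lp.toLp_coeFn]
    congr 1
    exact (InnerProductSpace.toDual_symm_apply (𝕜 := ℝ) (E := Lp ℝ 2 ν)
      (x := hψ.toLp ψ) (y := WeakDual.toStrongDual L)).symm

/-- Balls of `L^p` are weakly closed in `L²`. -/
lemma WeakL2.eLpNorm_le {f : ℕ → X → ℝ} {f₀ : X → ℝ} (hf : ∀ n, MemLp (f n) 2 ν)
    (hf₀ : MemLp f₀ 2 ν) (hw : WeakL2 ν f f₀) {p : ℝ≥0∞} (hp : 1 ≤ p) {c : ℝ≥0∞}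
    (h : ∀ n, eLpNorm (f n) p ν ≤ c) : eLpNorm f₀ p ν ≤ c := by
  set S : Set (Lp ℝ 2 ν) := {u | eLpNorm u p ν ≤ c} with hS
  have hconv : Convex ℝ S := by
    intro u hu v hv a b ha hb hab
    have hu : eLpNorm u p ν ≤ c := hu
    have hv : eLpNorm v p ν ≤ c := hv
    change eLpNorm (a • u + b • v : Lp ℝ 2 ν) p ν ≤ c
    have e : ((a • u + b • v : Lp ℝ 2 ν) : X → ℝ) =ᵐ[ν] a • (u : X → ℝ) + b • (v : X → ℝ) := by
      filter_upwards [Lp.coeFn_add (a • u) (b • v), Lp.coeFn_smul a u, Lp.coeFn_smul b v]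
        with x h1 h2 h3
      rw [h1, Pi.add_apply, h2, h3]; rfl
    rw [eLpNorm_congr_ae e]
    refine (eLpNorm_add_le ((Lp.aestronglyMeasurable u).const_smul a)
      ((Lp.aestronglyMeasurable v).const_smul b) hp).trans ?_
    rw [eLpNorm_const_smul, eLpNorm_const_smul]
    calc ‖a‖ₑ * eLpNorm u p ν + ‖b‖ₑ * eLpNorm v p ν ≤ ‖a‖ₑ * c + ‖b‖ₑ * c := by gcongr
      _ = c := by
        rw [← add_mul, Real.enorm_of_nonneg ha, Real.enorm_of_nonneg hb, ← ENNReal.ofReal_add ha hb,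
          hab, ENNReal.ofReal_one, one_mul]
  have hclosed : IsClosed S := by
    apply IsSeqClosed.isClosed
    intro u v hu huv
    -- Along an almost everywhere convergent subsequence, Fatou's lemma bounds the `L^p` norm of the
    -- limit.
    obtain ⟨ns, -, hns⟩ := (tendstoInMeasure_of_tendsto_Lp huv).exists_seq_tendsto_ae
    refine (Lp.eLpNorm_lim_le_liminf_eLpNorm (fun n => Lp.aestronglyMeasurable (u (ns n))) v
      hns).trans ?_
    refine liminf_le_of_frequently_le' (Eventually.frequently (Eventually.of_forall fun n => ?_))
    exact hu (ns n)
  have hmem : hf₀.toLp f₀ ∈ S := by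
    by_contra hno
    -- A separating functional is represented by an `L²` function, so weak convergence against it
    -- contradicts the strict separation.
    obtain ⟨L, r, hL1, hL2⟩ := geometric_hahn_banach_closed_point hconv hclosed hno
    set g : Lp ℝ 2 ν := (InnerProductSpace.toDual ℝ (Lp ℝ 2 ν)).symm L with hg
    have hLg : ∀ {u : X → ℝ} (hu : MemLp u 2 ν), L (hu.toLp u) = ∫ x, u x * g x ∂ν := by
      intro u hu
      rw [← L2.inner_toLp_eq hu (Lp.memLp g), Lp.toLp_coeFn, real_inner_comm]
      exact (InnerProductSpace.toDual_symm_apply (𝕜 := ℝ) (E := Lp ℝ 2 ν)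
        (x := hu.toLp u) (y := L)).symm
    have ht := hw g (Lp.memLp g)
    rw [← hLg hf₀] at ht
    refine absurd (le_of_tendsto ht (Eventually.of_forall fun n => ?_)) (not_le.2 hL2)
    rw [← hLg (hf n)]
    refine (hL1 _ ?_).le
    change eLpNorm _ p ν ≤ c
    rw [eLpNorm_congr_ae (hf n).coeFn_toLp]
    exact h n
  have hmem : eLpNorm (hf₀.toLp f₀) p ν ≤ c := hmem
  rwa [eLpNorm_congr_ae hf₀.coeFn_toLp] at hmem

end

variable {d : ℕ}

lemma abs_integral_mul_le_eLpNorm {X : Type*} [MeasurableSpace X] {ν : Measure X} {f g : X → ℝ}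
    {p q : ℝ≥0∞} [p.HolderConjugate q] {c e : ℝ} (hc : 0 ≤ c)
    (hf : MemLp f p ν) (hg : MemLp g q ν) (hfc : eLpNorm f p ν ≤ ENNReal.ofReal c)
    (hge : eLpNorm g q ν ≤ ENNReal.ofReal e) (he : 0 ≤ e) : |∫ x, f x * g x ∂ν| ≤ c * e := by
  have h1 : eLpNorm (f • g) 1 ν ≤ ENNReal.ofReal (c * e) := by
    refine (eLpNorm_smul_le_mul_eLpNorm (p := p) (q := q) hg.1 hf.1).trans ?_
    rw [ENNReal.ofReal_mul hc]
    gcongr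
  have h2 : ‖∫ x, (f • g) x ∂ν‖ ≤ (eLpNorm (f • g) 1 ν).toReal := by
    refine (norm_integral_le_lintegral_norm _).trans ?_
    rw [eLpNorm_one_eq_lintegral_enorm]
    simp only [ofReal_norm, le_refl]
  exact h2.trans (ENNReal.toReal_le_of_le_ofReal (by positivity) h1)

lemma holderConjugate_of_lt {p : ℝ} (hp : 2 < p) :
    (ENNReal.ofReal p).HolderConjugate (ENNReal.ofReal (p / (p - 1))) :=
  (Real.HolderConjugate.conjExponent (by linarith : 1 < p)).ennrealOfReal

lemma two_le_ofReal {p : ℝ} (hp : 2 < p) : (2 : ℝ≥0∞) ≤ ENNReal.ofReal p := by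
  rw [← ENNReal.ofReal_ofNat]; exact ENNReal.ofReal_le_ofReal hp.le

lemma ofReal_conj_le_two {p : ℝ} (hp : 2 < p) : ENNReal.ofReal (p / (p - 1)) ≤ 2 := by
  rw [← ENNReal.ofReal_ofNat]
  refine ENNReal.ofReal_le_ofReal ?_
  rw [div_le_iff₀ (by linarith)]; linarith

lemma one_le_ofReal_conj {p : ℝ} (hp : 2 < p) : 1 ≤ ENNReal.ofReal (p / (p - 1)) := by
  rw [← ENNReal.ofReal_one]
  refine ENNReal.ofReal_le_ofReal ?_
  rw [le_div_iff₀ (by linarith)]; linarith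

lemma eLpNorm_two_le_of_eLpNorm_le {Ω : Set (Space d)} [IsFiniteMeasure (volume.restrict Ω)] {p : ℝ}
    (hp : 2 < p) (C : ℝ≥0) : ∃ R : ℝ, 0 ≤ R ∧ ∀ f : Space d → ℝ,
      AEStronglyMeasurable f (volume.restrict Ω) →
      eLpNorm f (ENNReal.ofReal p) (volume.restrict Ω) ≤ C →
      eLpNorm f 2 (volume.restrict Ω) ≤ ENNReal.ofReal R := by
  set V := (volume.restrict Ω) Set.univ ^ (1 / (2 : ℝ≥0∞).toReal - 1 / (ENNReal.ofReal p).toReal)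
  have hV : V ≠ ⊤ := by
    refine ENNReal.rpow_ne_top_of_nonneg ?_ (measure_ne_top _ _)
    rw [ENNReal.toReal_ofReal (by linarith), ENNReal.toReal_ofNat, sub_nonneg]
    exact one_div_le_one_div_of_le (by norm_num) hp.le
  refine ⟨(C * V).toReal, ENNReal.toReal_nonneg, fun f hf hfC => ?_⟩
  rw [ENNReal.ofReal_toReal (ENNReal.mul_ne_top ENNReal.coe_ne_top hV)]
  refine (eLpNorm_le_eLpNorm_mul_rpow_measure_univ (two_le_ofReal hp) hf).trans ?_
  gcongr

/-- Weak convergence in `L²(Ω)` of a sequence bounded in `L^p(Ω)` is weak convergence in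
`L^p(Ω)`. -/
lemma WeakL2.weakLp {Ω : Set (Space d)} [IsFiniteMeasure (volume.restrict Ω)] {p : ℝ} (hp : 2 < p)
    {f : ℕ → Space d → ℝ} {f₀ : Space d → ℝ}
    (hf : ∀ n, MemLp (f n) (ENNReal.ofReal p) (volume.restrict Ω)) {C : ℝ≥0}
    (hC : ∀ n, eLpNorm (f n) (ENNReal.ofReal p) (volume.restrict Ω) ≤ C)
    (hf₀ : MemLp f₀ (ENNReal.ofReal p) (volume.restrict Ω))
    (hC₀ : eLpNorm f₀ (ENNReal.ofReal p) (volume.restrict Ω) ≤ C)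
    (hw : WeakL2 (volume.restrict Ω) f f₀) : WeakLp Ω p f f₀ := by
  intro ψ hψ
  have := holderConjugate_of_lt hp
  rw [Metric.tendsto_nhds]
  intro τ hτ
  -- By Hölder, replacing `ψ` by an approximant within `e` costs at most `C * e ≤ τ / 3`; the `+ 1`
  -- covers `C = 0`.
  set e := τ / (3 * (C + 1)) with he
  have he0 : 0 < e := by positivity
  obtain ⟨g, hgc, hgs, hgψ⟩ := hψ.exist_eLpNorm_sub_le ENNReal.ofReal_ne_top
    (one_le_ofReal_conj hp) he0
  have hg2 : MemLp g 2 (volume.restrict Ω) := hgs.continuous.memLp_of_hasCompactSupport hgc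
  have hgq : MemLp g (ENNReal.ofReal (p / (p - 1))) (volume.restrict Ω) :=
    hgs.continuous.memLp_of_hasCompactSupport hgc
  have hd := hψ.sub hgq
  rw [← ENNReal.ofReal_coe_nnreal] at hC₀
  have key : ∀ {u : Space d → ℝ}, MemLp u (ENNReal.ofReal p) (volume.restrict Ω) →
      eLpNorm u (ENNReal.ofReal p) (volume.restrict Ω) ≤ ENNReal.ofReal C →
      |(∫ x in Ω, u x * ψ x) - ∫ x in Ω, u x * g x| ≤ τ / 3 := by
    intro u hu huC
    have i1 : Integrable (fun x => u x * ψ x) (volume.restrict Ω) := hu.integrable_mul hψ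
    have i2 : Integrable (fun x => u x * g x) (volume.restrict Ω) := hu.integrable_mul hgq
    rw [← integral_sub i1 i2]
    have h := abs_integral_mul_le_eLpNorm C.2 hu hd huC hgψ he0.le
    simp only [Pi.sub_apply, mul_sub] at h
    refine h.trans ?_
    rw [he, mul_div_assoc', div_le_div_iff₀ (by positivity) (by norm_num)]
    change (C : ℝ) * τ * 3 ≤ _
    nlinarith [C.2]
  filter_upwards [Metric.tendsto_nhds.1 (hw g hg2) (τ / 3) (by positivity)] with n hn
  have k1 := key (hf n) ((hC n).trans_eq ENNReal.ofReal_coe_nnreal.symm)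
  have k2 := key hf₀ hC₀
  rw [Real.dist_eq] at *
  rw [abs_le] at k1 k2
  rw [abs_lt] at *
  constructor <;> linarith [hn.1, hn.2, k1.1, k1.2, k2.1, k2.2]

/-- On a finite measure the `L^p` bound is also an `L²` bound, so Hilbert space compactness applies.
The limit inherits the `L^p` bound, which then upgrades the mode of convergence. -/
lemma exists_weakLp_subseq {Ω : Set (Space d)} [IsFiniteMeasure (volume.restrict Ω)] {p : ℝ}
    (hp : 2 < p) {f : ℕ → Space d → ℝ}
    (hf : ∀ n, MemLp (f n) (ENNReal.ofReal p) (volume.restrict Ω)) {C : ℝ≥0}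
    (hC : ∀ n, eLpNorm (f n) (ENNReal.ofReal p) (volume.restrict Ω) ≤ C) :
    ∃ (s : ℕ → ℕ) (f₀ : Space d → ℝ), StrictMono s ∧
      MemLp f₀ (ENNReal.ofReal p) (volume.restrict Ω) ∧
      eLpNorm f₀ (ENNReal.ofReal p) (volume.restrict Ω) ≤ C ∧ WeakLp Ω p (fun n => f (s n)) f₀ := by
  obtain ⟨R, hR, hfR⟩ := eLpNorm_two_le_of_eLpNorm_le (Ω := Ω) hp C
  have : Fact ((2 : ℝ≥0∞) ≠ ⊤) := ⟨by norm_num⟩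
  have hf2 := fun n => (hf n).mono_exponent (two_le_ofReal hp)
  obtain ⟨s, f₀, hs, hf₀, hw⟩ := exists_weakL2_subseq hf2 hR fun n => hfR _ (hf n).1 (hC n)
  have hle : eLpNorm f₀ (ENNReal.ofReal p) (volume.restrict Ω) ≤ C :=
    hw.eLpNorm_le (fun n => hf2 (s n)) hf₀ (le_trans (by norm_num) (two_le_ofReal hp))
      fun n => hC (s n)
  have hm : MemLp f₀ (ENNReal.ofReal p) (volume.restrict Ω) :=
    ⟨hf₀.1, hle.trans_lt ENNReal.coe_lt_top⟩
  exact ⟨s, f₀, hs, hm, hle, hw.weakLp hp (fun n => hf (s n)) (fun n => hC (s n)) hm hle⟩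

lemma WeakLp.comp {Ω : Set (Space d)} {p : ℝ} {f : ℕ → Space d → ℝ} {f₀ : Space d → ℝ}
    (h : WeakLp Ω p f f₀) {s : ℕ → ℕ} (hs : StrictMono s) : WeakLp Ω p (fun n => f (s n)) f₀ :=
  fun ψ hψ => (h ψ hψ).comp hs.tendsto_atTop

/-- A finite family of bounded sequences in `L^p` has a common weakly convergent subsequence. -/
theorem exists_weakLp_subseq_family {Ω : Set (Space d)} [IsFiniteMeasure (volume.restrict Ω)] {p : ℝ}
    (hp : 2 < p) {ι : Type*} [Finite ι] {f : ℕ → ι → Space d → ℝ}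
    (hf : ∀ n i, MemLp (f n i) (ENNReal.ofReal p) (volume.restrict Ω)) {C : ℝ≥0}
    (hC : ∀ n i, eLpNorm (f n i) (ENNReal.ofReal p) (volume.restrict Ω) ≤ C) :
    ∃ (s : ℕ → ℕ) (f₀ : ι → Space d → ℝ), StrictMono s ∧
      ∀ i, MemLp (f₀ i) (ENNReal.ofReal p) (volume.restrict Ω) ∧
        eLpNorm (f₀ i) (ENNReal.ofReal p) (volume.restrict Ω) ≤ C ∧
        WeakLp Ω p (fun n => f (s n) i) (f₀ i) := by
  classical
  cases nonempty_fintype ι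
  suffices H : ∀ t : Finset ι, ∃ (s : ℕ → ℕ) (f₀ : ι → Space d → ℝ), StrictMono s ∧
      ∀ i ∈ t, MemLp (f₀ i) (ENNReal.ofReal p) (volume.restrict Ω) ∧
        eLpNorm (f₀ i) (ENNReal.ofReal p) (volume.restrict Ω) ≤ C ∧
        WeakLp Ω p (fun n => f (s n) i) (f₀ i) by
    obtain ⟨s, f₀, hs, h⟩ := H Finset.univ
    exact ⟨s, f₀, hs, fun i => h i (Finset.mem_univ i)⟩
  intro t
  induction t using Finset.induction_on with
  | empty => exact ⟨id, fun _ _ => 0, strictMono_id, by simp⟩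
  | insert i t hi ih =>
    obtain ⟨s, f₀, hs, h⟩ := ih
    obtain ⟨r, g, hr, hg1, hg2, hg3⟩ := exists_weakLp_subseq hp (f := fun n => f (s n) i)
      (fun n => hf (s n) i) (fun n => hC (s n) i)
    refine ⟨s ∘ r, Function.update f₀ i g, hs.comp hr, fun j hj => ?_⟩
    rcases eq_or_ne j i with rfl | hji
    · rw [Function.update_self]; exact ⟨hg1, hg2, hg3⟩
    · rw [Function.update_of_ne hji]
      obtain ⟨h1, h2, h3⟩ := h j (Finset.mem_of_mem_insert_of_ne hj hji)
      exact ⟨h1, h2, h3.comp hr⟩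

end

section


variable {d : ℕ} {Ω : Set (Space d)}

/-! ### Localisation -/

lemma exists_cutoff (hΩ : IsOpen Ω) {K : Set (Space d)} (hK : IsCompact K) (hKΩ : K ⊆ Ω) :
    ∃ χ : Space d → ℝ, IsTest Ω χ ∧ (∀ x, 0 ≤ χ x ∧ χ x ≤ 1) ∧ ∀ x ∈ K, χ x = 1 := by
  obtain ⟨L, hL, hKL, hLΩ⟩ := exists_compact_between hK hΩ hKΩ
  obtain ⟨f, hf1, hf2, hf3⟩ := exists_contMDiffMap_one_nhds_of_subset_interior
    (modelWithCornersSelf ℝ (Space d)) (n := ⊤) hK.isClosed hKL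
  have hs : tsupport f ⊆ L := closure_minimal (fun x hx => by
    by_contra h; exact hx (hf2 x h)) hL.isClosed
  refine ⟨f, ⟨f.contMDiff.contDiff, hL.of_isClosed_subset (isClosed_tsupport _) hs,
    hs.trans hLΩ⟩, hf3, fun x hx => hf1.self_of_nhdsSet x hx⟩

/-- Continuous functions with compact support in `Ω`. -/
structure IsContTest (Ω : Set (Space d)) (φ : Space d → ℝ) : Prop where
  continuous : Continuous φ
  compact : HasCompactSupport φ
  subset : tsupport φ ⊆ Ω

lemma IsTest.isContTest {φ : Space d → ℝ} (h : IsTest Ω φ) : IsContTest Ω φ :=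
  ⟨h.smooth.continuous, h.compact, h.subset⟩

lemma IsTest.pd {φ : Space d → ℝ} (h : IsTest Ω φ) (k : Fin d) : IsTest Ω (pd k φ) :=
  ⟨contDiff_pd_infty h.smooth k, hasCompactSupport_pd h.compact k,
    (tsupport_pd_subset φ k).trans h.subset⟩

lemma IsTest.mul_left {φ ψ : Space d → ℝ} (h : IsTest Ω φ) (hψ : ContDiff ℝ ∞ ψ) :
    IsTest Ω fun x => ψ x * φ x :=
  ⟨hψ.mul h.smooth, h.compact.mul_left, (tsupport_mul_subset_right).trans h.subset⟩

lemma IsContTest.zero_of_notMem {φ : Space d → ℝ} (h : IsContTest Ω φ) {x : Space d}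
    (hx : x ∉ Ω) : φ x = 0 := image_eq_zero_of_notMem_tsupport fun hs => hx (h.subset hs)

lemma IsContTest.mul_continuousOn {φ c : Space d → ℝ} (h : IsContTest Ω φ) (hΩ : IsOpen Ω)
    (hc : ContinuousOn c Ω) : IsContTest Ω fun x => φ x * c x := by
  have hs : tsupport (fun x => φ x * c x) ⊆ tsupport φ := tsupport_mul_subset_left
  refine ⟨continuous_of_tsupport fun x hx => ?_, h.compact.mul_right, hs.trans h.subset⟩
  exact h.continuous.continuousAt.mul (hc.continuousAt (hΩ.mem_nhds (h.subset (hs hx))))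

lemma IsContTest.integrable_mul {φ f : Space d → ℝ} (h : IsContTest Ω φ)
    (hf : LocallyIntegrableOn f Ω) : Integrable fun x => φ x * f x := by
  have h1 : IntegrableOn f (tsupport φ) := hf.integrableOn_compact_subset h.subset h.compact
  refine (integrableOn_iff_integrable_of_support_subset (s := tsupport φ) ?_).1
    (h1.continuousOn_mul h.continuous.continuousOn h.compact)
  intro x hx
  by_contra hn
  exact hx (by simp [image_eq_zero_of_notMem_tsupport hn])

lemma IsContTest.integral_eq {φ : Space d → ℝ} (h : IsContTest Ω φ) (f : Space d → ℝ) :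
    ∫ x in Ω, φ x * f x = ∫ x, φ x * f x :=
  setIntegral_eq_integral_of_forall_compl_eq_zero fun x hx => by rw [h.zero_of_notMem hx, zero_mul]

lemma IsContTest.setIntegral_abs_le {φ f : Space d → ℝ} (h : IsContTest Ω φ)
    (hf : LocallyIntegrableOn f Ω) {M : ℝ} (hM : ∀ x, |φ x| ≤ M) {K : Set (Space d)}
    (hK : IsCompact K) (hKΩ : K ⊆ Ω) (hφK : ∀ x, x ∉ K → φ x = 0) :
    ∫ x, |φ x * f x| ≤ M * ∫ x in K, |f x| := by
  rw [← setIntegral_eq_integral_of_forall_compl_eq_zero (s := K)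
    (fun x hx => by rw [hφK x hx]; simp), ← integral_const_mul]
  refine setIntegral_mono_on (h.integrable_mul hf).abs.integrableOn
    ((hf.integrableOn_compact_subset hKΩ hK).abs.const_mul M) hK.measurableSet fun x _ => ?_
  rw [abs_mul]
  exact mul_le_mul_of_nonneg_right (hM x) (abs_nonneg _)

/-! ### Local `L¹` bounds and convergence against test functions -/

/-- Sequences that are bounded in `L¹(K)` for every compact `K ⊆ Ω`. -/
def LocBdd (Ω : Set (Space d)) (f : ℕ → Space d → ℝ) : Prop :=
  (∀ n, LocallyIntegrableOn (f n) Ω) ∧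
    ∀ K : Set (Space d), IsCompact K → K ⊆ Ω → ∃ B : ℝ, ∀ n, ∫ x in K, |f n x| ≤ B

/-- Convergence against continuous compactly supported functions. -/
structure LocConv (Ω : Set (Space d)) (f : ℕ → Space d → ℝ) (f₀ : Space d → ℝ) : Prop where
  seq : ∀ n, LocallyIntegrableOn (f n) Ω
  lim : LocallyIntegrableOn f₀ Ω
  tendsto : ∀ φ, IsContTest Ω φ →
    Tendsto (fun n => ∫ x in Ω, φ x * f n x) atTop (𝓝 (∫ x in Ω, φ x * f₀ x))

lemma LocallyIntegrableOn.continuousOn_mul' {c f : Space d → ℝ} (hΩ : IsOpen Ω)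
    (hf : LocallyIntegrableOn f Ω) (hc : ContinuousOn c Ω) :
    LocallyIntegrableOn (fun x => c x * f x) Ω :=
  hf.continuousOn_mul hc hΩ.isLocallyClosed

lemma locallyIntegrableOn_zero_fun : LocallyIntegrableOn (fun _ : Space d => (0 : ℝ)) Ω :=
  (locallyIntegrable_const 0).locallyIntegrableOn Ω

lemma locallyIntegrableOn_finsetSum {ι : Type*} (s : Finset ι) {f : ι → Space d → ℝ}
    (hf : ∀ i ∈ s, LocallyIntegrableOn (f i) Ω) :
    LocallyIntegrableOn (fun x => ∑ i ∈ s, f i x) Ω := by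
  classical
  induction s using Finset.induction_on with
  | empty => simpa using locallyIntegrableOn_zero_fun
  | insert i s hi ih =>
    simp only [Finset.sum_insert hi]
    exact (hf i (Finset.mem_insert_self i s)).add
      (ih fun j hj => hf j (Finset.mem_insert_of_mem hj))

section Bdd

lemma LocBdd.add {f g : ℕ → Space d → ℝ} (hf : LocBdd Ω f) (hg : LocBdd Ω g) :
    LocBdd Ω fun n x => f n x + g n x := by
  refine ⟨fun n => (hf.1 n).add (hg.1 n), fun K hK hKΩ => ?_⟩
  obtain ⟨B, hB⟩ := hf.2 K hK hKΩ
  obtain ⟨B', hB'⟩ := hg.2 K hK hKΩ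
  refine ⟨B + B', fun n => ?_⟩
  have h1 := ((hf.1 n).integrableOn_compact_subset hKΩ hK).abs
  have h2 := ((hg.1 n).integrableOn_compact_subset hKΩ hK).abs
  calc ∫ x in K, |f n x + g n x| ≤ ∫ x in K, (|f n x| + |g n x|) :=
        setIntegral_mono (((hf.1 n).integrableOn_compact_subset hKΩ hK).add
          ((hg.1 n).integrableOn_compact_subset hKΩ hK)).abs (h1.add h2) fun x => abs_add_le _ _
    _ = (∫ x in K, |f n x|) + ∫ x in K, |g n x| := integral_add h1 h2
    _ ≤ B + B' := add_le_add (hB n) (hB' n)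

lemma LocBdd.continuousOn_mul (hΩ : IsOpen Ω) {f : ℕ → Space d → ℝ} {c : Space d → ℝ}
    (hf : LocBdd Ω f) (hc : ContinuousOn c Ω) : LocBdd Ω fun n x => c x * f n x := by
  refine ⟨fun n => LocallyIntegrableOn.continuousOn_mul' hΩ (hf.1 n) hc, fun K hK hKΩ => ?_⟩
  obtain ⟨B, hB⟩ := hf.2 K hK hKΩ
  obtain ⟨M, hM⟩ := hK.exists_bound_of_continuousOn (hc.mono hKΩ)
  have hM0 : ∀ x ∈ K, |c x| ≤ |M| := fun x hx => (hM x hx).trans (le_abs_self M)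
  refine ⟨|M| * B, fun n => ?_⟩
  have h1 := (hf.1 n).integrableOn_compact_subset hKΩ hK
  calc ∫ x in K, |c x * f n x| ≤ ∫ x in K, |M| * |f n x| :=
        setIntegral_mono_on (h1.continuousOn_mul (hc.mono hKΩ) hK).abs (h1.abs.const_mul _)
          hK.measurableSet fun x hx => by
            rw [abs_mul]; exact mul_le_mul_of_nonneg_right (hM0 x hx) (abs_nonneg _)
    _ = |M| * ∫ x in K, |f n x| := integral_const_mul _ _
    _ ≤ |M| * B := mul_le_mul_of_nonneg_left (hB n) (abs_nonneg M)

lemma LocBdd.neg {f : ℕ → Space d → ℝ} (hf : LocBdd Ω f) : LocBdd Ω fun n x => -f n x :=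
  ⟨fun n => (hf.1 n).neg, fun K hK hKΩ => by simpa only [abs_neg] using hf.2 K hK hKΩ⟩

lemma LocBdd.sub {f g : ℕ → Space d → ℝ} (hf : LocBdd Ω f) (hg : LocBdd Ω g) :
    LocBdd Ω fun n x => f n x - g n x := by
  simpa only [sub_eq_add_neg] using hf.add hg.neg

lemma LocBdd.sum {ι : Type*} (s : Finset ι) {f : ι → ℕ → Space d → ℝ}
    (hf : ∀ i, LocBdd Ω (f i)) : LocBdd Ω fun n x => ∑ i ∈ s, f i n x := by
  classical
  induction s using Finset.induction_on with
  | empty =>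
    refine ⟨fun n => ?_, fun K _ _ => ⟨0, fun n => ?_⟩⟩
    · simpa using locallyIntegrableOn_zero_fun
    · simp
  | insert i s hi ih =>
    simp only [Finset.sum_insert hi]
    exact (hf i).add ih

lemma LocConv.add {f g : ℕ → Space d → ℝ} {f₀ g₀ : Space d → ℝ} (hf : LocConv Ω f f₀)
    (hg : LocConv Ω g g₀) : LocConv Ω (fun n x => f n x + g n x) fun x => f₀ x + g₀ x := by
  refine ⟨fun n => (hf.seq n).add (hg.seq n), hf.lim.add hg.lim, fun φ hφ => ?_⟩
  have hs : ∀ {u v : Space d → ℝ}, LocallyIntegrableOn u Ω → LocallyIntegrableOn v Ω →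
      ∫ x in Ω, φ x * (u x + v x) = (∫ x in Ω, φ x * u x) + ∫ x in Ω, φ x * v x := by
    intro u v hu hv
    rw [← integral_add (hφ.integrable_mul hu).integrableOn (hφ.integrable_mul hv).integrableOn]
    simp only [mul_add]
  rw [hs hf.lim hg.lim]
  exact ((hf.tendsto φ hφ).add (hg.tendsto φ hφ)).congr fun n => (hs (hf.seq n) (hg.seq n)).symm

lemma LocConv.continuousOn_mul (hΩ : IsOpen Ω) {f : ℕ → Space d → ℝ} {f₀ c : Space d → ℝ}
    (hf : LocConv Ω f f₀) (hc : ContinuousOn c Ω) :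
    LocConv Ω (fun n x => c x * f n x) fun x => c x * f₀ x := by
  refine ⟨fun n => LocallyIntegrableOn.continuousOn_mul' hΩ (hf.seq n) hc,
    LocallyIntegrableOn.continuousOn_mul' hΩ hf.lim hc, fun φ hφ => ?_⟩
  simpa only [mul_assoc] using hf.tendsto _ (hφ.mul_continuousOn hΩ hc)

lemma LocConv.const_mul {f : ℕ → Space d → ℝ} {f₀ : Space d → ℝ} (hΩ : IsOpen Ω)
    (hf : LocConv Ω f f₀) (c : ℝ) : LocConv Ω (fun n x => c * f n x) fun x => c * f₀ x :=
  hf.continuousOn_mul hΩ continuousOn_const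

lemma LocConv.neg (hΩ : IsOpen Ω) {f : ℕ → Space d → ℝ} {f₀ : Space d → ℝ} (hf : LocConv Ω f f₀) :
    LocConv Ω (fun n x => -f n x) fun x => -f₀ x := by
  simpa only [neg_one_mul] using hf.const_mul hΩ (-1)

lemma LocConv.sub (hΩ : IsOpen Ω) {f g : ℕ → Space d → ℝ} {f₀ g₀ : Space d → ℝ}
    (hf : LocConv Ω f f₀) (hg : LocConv Ω g g₀) :
    LocConv Ω (fun n x => f n x - g n x) fun x => f₀ x - g₀ x := by
  simpa only [sub_eq_add_neg] using hf.add (hg.neg hΩ)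

lemma LocConv.sum {ι : Type*} (s : Finset ι) {f : ι → ℕ → Space d → ℝ} {f₀ : ι → Space d → ℝ}
    (hf : ∀ i, LocConv Ω (f i) (f₀ i)) :
    LocConv Ω (fun n x => ∑ i ∈ s, f i n x) fun x => ∑ i ∈ s, f₀ i x := by
  classical
  induction s using Finset.induction_on with
  | empty =>
    simp only [Finset.sum_empty]
    exact ⟨fun _ => locallyIntegrableOn_zero_fun, locallyIntegrableOn_zero_fun, fun φ _ => by simp⟩
  | insert i s hi ih =>
    simp only [Finset.sum_insert hi]
    exact (hf i).add ih

lemma LocConv.congr {f g : ℕ → Space d → ℝ} {f₀ g₀ : Space d → ℝ} (hΩ : IsOpen Ω)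
    (hf : LocConv Ω f f₀)
    (h : ∀ n, ∀ᵐ x ∂(volume.restrict Ω), f n x = g n x)
    (h₀ : ∀ᵐ x ∂(volume.restrict Ω), f₀ x = g₀ x) : LocConv Ω g g₀ := by
  have key : ∀ {u v : Space d → ℝ}, (∀ᵐ x ∂(volume.restrict Ω), u x = v x) →
      LocallyIntegrableOn u Ω → LocallyIntegrableOn v Ω := by
    intro u v huv hu
    rw [locallyIntegrableOn_iff hΩ.isLocallyClosed] at hu ⊢
    intro K hKΩ hK
    exact (hu K hKΩ hK).congr (ae_restrict_of_ae_restrict_of_subset hKΩ huv)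
  refine ⟨fun n => key (h n) (hf.seq n), key h₀ hf.lim, fun φ hφ => ?_⟩
  refine ((hf.tendsto φ hφ).congr fun n => ?_).trans_eq ?_
  · exact integral_congr_ae ((h n).mono fun x hx => by simp only [hx])
  · congr 1
    exact integral_congr_ae (h₀.mono fun x hx => by simp only [hx])

/-- A locally bounded sequence that converges against smooth test functions converges against
continuous ones. -/
lemma LocBdd.locConv {f : ℕ → Space d → ℝ} {f₀ : Space d → ℝ} (hf : LocBdd Ω f)
    (hf₀ : LocallyIntegrableOn f₀ Ω) (h : ∀ φ, IsTest Ω φ →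
      Tendsto (fun n => ∫ x in Ω, φ x * f n x) atTop (𝓝 (∫ x in Ω, φ x * f₀ x))) :
    LocConv Ω f f₀ := by
  refine ⟨hf.1, hf₀, fun φ hφ => ?_⟩
  obtain ⟨B, hB⟩ := hf.2 _ hφ.compact hφ.subset
  set B' := |B| + ∫ x in tsupport φ, |f₀ x| with hB'
  have hB0 : 0 ≤ B' := add_nonneg (abs_nonneg _) (integral_nonneg fun x => abs_nonneg _)
  rw [Metric.tendsto_nhds]
  intro τ hτ
  set e := τ / (3 * (B' + 1)) with he
  have he0 : 0 < e := by positivity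
  -- The smooth approximant is uniformly close to `φ` and has support inside that of `φ`, so the
  -- error is at most `e` times the `L¹` norm on one fixed compact set.
  obtain ⟨g, hg, hgφ, hgs⟩ := hφ.continuous.exists_contDiff_approx ⊤ (ε := fun _ => e)
    continuous_const fun _ => he0
  have hgts : tsupport g ⊆ tsupport φ := closure_mono hgs
  have hgt : IsTest Ω g := ⟨hg, hφ.compact.mono hgs, hgts.trans hφ.subset⟩
  have key : ∀ {u : Space d → ℝ}, LocallyIntegrableOn u Ω → ∫ x in tsupport φ, |u x| ≤ B' →
      |(∫ x in Ω, φ x * u x) - ∫ x in Ω, g x * u x| ≤ τ / 3 := by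
    intro u hu huB
    have i1 := hφ.integrable_mul hu
    have i2 := hgt.isContTest.integrable_mul hu
    rw [hφ.integral_eq, hgt.isContTest.integral_eq, ← integral_sub i1 i2]
    have hdt : IsContTest Ω fun x => φ x - g x :=
      ⟨hφ.continuous.sub hg.continuous, hφ.compact.sub hgt.compact,
        (tsupport_sub φ g).trans (Set.union_subset hφ.subset hgt.subset)⟩
    have h1 := hdt.setIntegral_abs_le hu (M := e) (fun x => by
      rw [← Real.dist_eq, dist_comm]; exact (hgφ x).le) hφ.compact hφ.subset
      fun x hx => by
        rw [image_eq_zero_of_notMem_tsupport hx,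
          image_eq_zero_of_notMem_tsupport fun h => hx (hgts h), sub_zero]
    simp only [← sub_mul]
    refine abs_integral_le_integral_abs.trans (h1.trans ?_)
    calc e * ∫ x in tsupport φ, |u x| ≤ e * B' := by gcongr
      _ ≤ τ / 3 := by
        rw [he, div_mul_eq_mul_div, div_le_div_iff₀ (by positivity) (by norm_num)]
        nlinarith
  filter_upwards [Metric.tendsto_nhds.1 (h g hgt) (τ / 3) (by positivity)] with n hn
  have k1 := key (hf.1 n) ((hB n).trans ((le_abs_self B).trans
    (le_add_of_nonneg_right (integral_nonneg fun x => abs_nonneg _))))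
  have k2 := key hf₀ (le_add_of_nonneg_left (abs_nonneg B))
  rw [Real.dist_eq] at *
  rw [abs_le] at k1 k2
  rw [abs_lt] at *
  constructor <;> linarith [hn.1, hn.2, k1.1, k1.2, k2.1, k2.2]

/-- Together with `LocConv.congr` this carries almost everywhere identities to the limit: both sides
converge as the same sequence, and the fundamental lemma of the calculus of variations identifies
the limits. -/
lemma LocConv.ae_eq {f : ℕ → Space d → ℝ} {f₀ g₀ : Space d → ℝ} (hΩ : IsOpen Ω)
    (hf : LocConv Ω f f₀) (hg : LocConv Ω f g₀) : ∀ᵐ x ∂(volume.restrict Ω), f₀ x = g₀ x := by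
  have h := hΩ.ae_eq_zero_of_integral_contDiff_smul_eq_zero (f := fun x => f₀ x - g₀ x)
    (μ := volume) (hf.lim.sub hg.lim) fun φ h1 h2 h3 => ?_
  · rw [ae_restrict_iff' hΩ.measurableSet]
    filter_upwards [h] with x hx hxΩ using sub_eq_zero.1 (hx hxΩ)
  · have hφ : IsContTest Ω φ := ⟨h1.continuous, h2, h3⟩
    have := tendsto_nhds_unique (hf.tendsto φ hφ) (hg.tendsto φ hφ)
    rw [hφ.integral_eq, hφ.integral_eq] at this
    simp only [smul_eq_mul, mul_sub]
    rw [integral_sub (hφ.integrable_mul hf.lim) (hφ.integrable_mul hg.lim), this, sub_self]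

end Bdd

end

section


variable {d : ℕ} {Ω : Set (Space d)} {p : ℝ} {C : ℝ≥0}

/-! ### Weakly convergent sequences on bounded domains -/

lemma integral_rpow_le_of_eLpNorm_le {X : Type*} [MeasurableSpace X] {ν : Measure X} {f : X → ℝ}
    (hp : 2 < p) (hf : MemLp f (ENNReal.ofReal p) ν)
    (h : eLpNorm f (ENNReal.ofReal p) ν ≤ C) : ∫ x, |f x| ^ p ∂ν ≤ (C : ℝ) ^ p := by
  have hp0 : 0 < p := by linarith
  rw [hf.eLpNorm_eq_integral_rpow_norm (by simpa using hp0) ENNReal.ofReal_ne_top,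
    ENNReal.toReal_ofReal hp0.le, ← ENNReal.ofReal_coe_nnreal,
    ENNReal.ofReal_le_ofReal_iff C.coe_nonneg] at h
  simp only [Real.norm_eq_abs] at h
  have h0 : 0 ≤ ∫ x, |f x| ^ p ∂ν := integral_nonneg fun x => Real.rpow_nonneg (abs_nonneg _) _
  calc ∫ x, |f x| ^ p ∂ν = ((∫ x, |f x| ^ p ∂ν) ^ p⁻¹) ^ p := by
        rw [← Real.rpow_mul h0, inv_mul_cancel₀ hp0.ne', Real.rpow_one]
    _ ≤ (C : ℝ) ^ p := Real.rpow_le_rpow (Real.rpow_nonneg h0 _) h hp0.le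

/-- Beyond `N` the factor `|s| ^ (2 - p)` is at most `N ^ (2 - p)` because the exponent is negative.
Bounded sets of `L^p` therefore have uniformly small quadratic tails. -/
lemma tailSq_le_rpow (hp : 2 < p) {N : ℝ} (hN : 0 < N) (s : ℝ) :
    tailSq N s ≤ N ^ (2 - p) * |s| ^ p := by
  unfold tailSq
  split_ifs with h
  · have hs : 0 < |s| := hN.trans h
    have h1 : |s| ^ (2 - p) ≤ N ^ (2 - p) :=
      Real.rpow_le_rpow_of_nonpos hN h.le (by linarith)
    calc s ^ 2 = |s| ^ (2 - p) * |s| ^ p := by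
          rw [← Real.rpow_add hs, sub_add_cancel, Real.rpow_ofNat, sq_abs]
      _ ≤ _ := by gcongr
  · positivity

/-- The common tail bound of the ball of radius `C` in `L^p`. -/
def tailBound (p : ℝ) (C : ℝ≥0) (N : ℝ) : ℝ := N ^ (2 - p) * (C : ℝ) ^ p

lemma tendsto_tailBound (hp : 2 < p) (C : ℝ≥0) : Tendsto (tailBound p C) atTop (𝓝 0) := by
  have h : Tendsto (fun N : ℝ => N ^ (-(p - 2)) * (C : ℝ) ^ p) atTop (𝓝 (0 * (C : ℝ) ^ p)) :=
    (tendsto_rpow_neg_atTop (by linarith)).mul_const _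
  rw [zero_mul] at h
  refine h.congr fun N => ?_
  rw [tailBound, neg_sub]

lemma integral_tailSq_le {X : Type*} [MeasurableSpace X] {ν : Measure X} [IsFiniteMeasure ν]
    {f : X → ℝ} (hp : 2 < p) (hf : MemLp f (ENNReal.ofReal p) ν)
    (h : eLpNorm f (ENNReal.ofReal p) ν ≤ C) {N : ℝ} (hN : 0 < N) :
    ∫ x, tailSq N (f x) ∂ν ≤ tailBound p C N := by
  have hp0 : 0 < p := by linarith
  have hi : Integrable (fun x => |f x| ^ p) ν := by
    have := hf.integrable_norm_rpow (by simpa using hp0) ENNReal.ofReal_ne_top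
    rwa [ENNReal.toReal_ofReal hp0.le] at this
  calc ∫ x, tailSq N (f x) ∂ν ≤ ∫ x, N ^ (2 - p) * |f x| ^ p ∂ν :=
        integral_mono (integrable_tailSq (hf.mono_exponent (two_le_ofReal hp)) N)
          (hi.const_mul _) fun x => tailSq_le_rpow hp hN _
    _ ≤ tailBound p C N := by
        rw [integral_const_mul]
        exact mul_le_mul_of_nonneg_left (integral_rpow_le_of_eLpNorm_le hp hf h)
          (Real.rpow_nonneg hN.le _)

lemma tailSq_mul_le {N c s : ℝ} (hc : |c| ≤ 1) : tailSq N (c * s) ≤ tailSq N s := by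
  have h1 : |c * s| ≤ |s| := by
    rw [abs_mul]; exact mul_le_of_le_one_left (abs_nonneg _) hc
  unfold tailSq
  split_ifs with h h'
  · exact sq_le_sq.2 h1
  · exact absurd (h.trans_le h1) h'
  · positivity
  · exact le_rfl

/-- A sequence bounded by `C` in `L^p(Ω)` and weakly convergent there. -/
structure BddWeak (Ω : Set (Space d)) (p : ℝ) (C : ℝ≥0) (f : ℕ → Space d → ℝ)
    (f₀ : Space d → ℝ) : Prop where
  mem : ∀ n, MemLp (f n) (ENNReal.ofReal p) (volume.restrict Ω)
  bdd : ∀ n, eLpNorm (f n) (ENNReal.ofReal p) (volume.restrict Ω) ≤ C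
  mem₀ : MemLp f₀ (ENNReal.ofReal p) (volume.restrict Ω)
  weak : WeakLp Ω p f f₀

lemma memLp_two_of_memLp [IsFiniteMeasure (volume.restrict Ω)] (hp : 2 < p) {f : Space d → ℝ}
    (hf : MemLp f (ENNReal.ofReal p) (volume.restrict Ω)) : MemLp f 2 (volume.restrict Ω) :=
  hf.mono_exponent (two_le_ofReal hp)

lemma locallyIntegrableOn_of_memLp [IsFiniteMeasure (volume.restrict Ω)] (hp : 2 < p)
    {f : Space d → ℝ} (hf : MemLp f (ENNReal.ofReal p) (volume.restrict Ω)) :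
    LocallyIntegrableOn f Ω := by
  have h : IntegrableOn f Ω := hf.integrable (le_trans (by norm_num) (two_le_ofReal hp))
  exact h.locallyIntegrableOn

lemma locallyIntegrableOn_mul_of_memLp [IsFiniteMeasure (volume.restrict Ω)] (hp : 2 < p)
    {f g : Space d → ℝ} (hf : MemLp f (ENNReal.ofReal p) (volume.restrict Ω))
    (hg : MemLp g (ENNReal.ofReal p) (volume.restrict Ω)) :
    LocallyIntegrableOn (fun x => f x * g x) Ω := by
  have h : IntegrableOn (fun x => f x * g x) Ω :=
    (memLp_two_of_memLp hp hf).integrable_mul (memLp_two_of_memLp hp hg)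
  exact h.locallyIntegrableOn

/-- A uniform `L²` bound on balls of `L^p(Ω)`. -/
lemma exists_integral_sq_le (Ω : Set (Space d)) [IsFiniteMeasure (volume.restrict Ω)] (hp : 2 < p)
    (C : ℝ≥0) : ∃ R : ℝ, 0 ≤ R ∧ ∀ f : Space d → ℝ,
      MemLp f (ENNReal.ofReal p) (volume.restrict Ω) →
      eLpNorm f (ENNReal.ofReal p) (volume.restrict Ω) ≤ C → ∫ x in Ω, f x ^ 2 ≤ R := by
  obtain ⟨R, hR, h⟩ := eLpNorm_two_le_of_eLpNorm_le (Ω := Ω) hp C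
  exact ⟨R ^ 2, by positivity, fun f hf hfC =>
    integral_sq_le_of_eLpNorm_le (memLp_two_of_memLp hp hf) hR (h f hf.1 hfC)⟩

lemma locBdd_mul [IsFiniteMeasure (volume.restrict Ω)] (hp : 2 < p)
    {f g : ℕ → Space d → ℝ} (hf : ∀ n, MemLp (f n) (ENNReal.ofReal p) (volume.restrict Ω))
    (hfC : ∀ n, eLpNorm (f n) (ENNReal.ofReal p) (volume.restrict Ω) ≤ C)
    (hg : ∀ n, MemLp (g n) (ENNReal.ofReal p) (volume.restrict Ω))
    (hgC : ∀ n, eLpNorm (g n) (ENNReal.ofReal p) (volume.restrict Ω) ≤ C) :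
    LocBdd Ω fun n x => f n x * g n x := by
  obtain ⟨R, hR, h⟩ := exists_integral_sq_le Ω hp C
  refine ⟨fun n => locallyIntegrableOn_mul_of_memLp hp (hf n) (hg n),
    fun K hK hKΩ => ⟨R + R, fun n => ?_⟩⟩
  have f2 := memLp_two_of_memLp hp (hf n)
  have g2 := memLp_two_of_memLp hp (hg n)
  have hi : IntegrableOn (fun x => f n x * g n x) Ω := f2.integrable_mul g2
  calc ∫ x in K, |f n x * g n x| ≤ ∫ x in Ω, |f n x * g n x| :=
        setIntegral_mono_set hi.abs (Eventually.of_forall fun x => abs_nonneg _)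
          hKΩ.eventuallyLE
    _ ≤ ∫ x in Ω, (f n x ^ 2 + g n x ^ 2) := by
        refine integral_mono hi.abs (f2.integrable_sq.add g2.integrable_sq) fun x => ?_
        beta_reduce
        rw [abs_le]
        constructor <;> nlinarith [sq_nonneg (f n x + g n x), sq_nonneg (f n x - g n x),
          sq_nonneg (f n x), sq_nonneg (g n x)]
    _ = (∫ x in Ω, f n x ^ 2) + ∫ x in Ω, g n x ^ 2 :=
        integral_add f2.integrable_sq g2.integrable_sq
    _ ≤ R + R := add_le_add (h _ (hf n) (hfC n)) (h _ (hg n) (hgC n))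

lemma integral_abs_le_add [IsFiniteMeasure (volume.restrict Ω)] {f : Space d → ℝ}
    (hf : MemLp f 2 (volume.restrict Ω)) :
    ∫ x in Ω, |f x| ≤ volume.real Ω + ∫ x in Ω, f x ^ 2 := by
  have h1 : volume.real Ω = ∫ _ in Ω, (1 : ℝ) := by simp
  rw [h1, ← integral_add (integrable_const _) hf.integrable_sq]
  refine integral_mono (hf.integrable (by norm_num)).abs
    ((integrable_const _).add hf.integrable_sq) fun x => ?_
  beta_reduce
  nlinarith [sq_nonneg (|f x| - 1), sq_abs (f x), abs_nonneg (f x)]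

lemma locBdd_of_bdd [IsFiniteMeasure (volume.restrict Ω)] (hp : 2 < p)
    {f : ℕ → Space d → ℝ} (hf : ∀ n, MemLp (f n) (ENNReal.ofReal p) (volume.restrict Ω))
    (hfC : ∀ n, eLpNorm (f n) (ENNReal.ofReal p) (volume.restrict Ω) ≤ C) : LocBdd Ω f := by
  obtain ⟨R, hR, h⟩ := exists_integral_sq_le Ω hp C
  refine ⟨fun n => locallyIntegrableOn_of_memLp hp (hf n),
    fun K hK hKΩ => ⟨volume.real Ω + R, fun n => ?_⟩⟩
  have f2 := memLp_two_of_memLp hp (hf n)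
  calc ∫ x in K, |f n x| ≤ ∫ x in Ω, |f n x| :=
        setIntegral_mono_set (f2.integrable (by norm_num)).abs
          (Eventually.of_forall fun x => abs_nonneg _) hKΩ.eventuallyLE
    _ ≤ volume.real Ω + ∫ x in Ω, f n x ^ 2 := integral_abs_le_add f2
    _ ≤ volume.real Ω + R := by have := h _ (hf n) (hfC n); linarith

lemma IsContTest.memLp {φ : Space d → ℝ} (h : IsContTest Ω φ) (q : ℝ≥0∞) : MemLp φ q :=
  h.continuous.memLp_of_hasCompactSupport h.compact

lemma BddWeak.locConv [IsFiniteMeasure (volume.restrict Ω)] (hp : 2 < p)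
    {f : ℕ → Space d → ℝ} {f₀ : Space d → ℝ} (h : BddWeak Ω p C f f₀) : LocConv Ω f f₀ := by
  refine ⟨fun n => locallyIntegrableOn_of_memLp hp (h.mem n),
    locallyIntegrableOn_of_memLp hp h.mem₀, fun φ hφ => ?_⟩
  simpa only [mul_comm] using h.weak φ ((hφ.memLp _).restrict Ω)

lemma memLp_of_restrict (hΩ : IsOpen Ω) {f : Space d → ℝ} {q : ℝ≥0∞}
    (hf : MemLp f q (volume.restrict Ω)) (h0 : ∀ x, x ∉ Ω → f x = 0) : MemLp f q := by
  have h1 : Ω.indicator f = f := by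
    ext x
    by_cases hx : x ∈ Ω
    · rw [Set.indicator_of_mem hx]
    · rw [Set.indicator_of_notMem hx, h0 x hx]
  rw [← h1, memLp_indicator_iff_restrict hΩ.measurableSet]
  exact hf

lemma IsContTest.memLp_mul (hΩ : IsOpen Ω) {χ f : Space d → ℝ} (hχ : IsContTest Ω χ)
    (hf : MemLp f 2 (volume.restrict Ω)) : MemLp (fun x => χ x * f x) 2 := by
  obtain ⟨M, hM0, hM⟩ := exists_bound_of_hasCompactSupport hχ.continuous hχ.compact
  refine memLp_of_restrict hΩ ?_ fun x hx => by rw [hχ.zero_of_notMem hx, zero_mul]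
  refine hf.of_le_mul (c := M) (hχ.continuous.aestronglyMeasurable.mul hf.aestronglyMeasurable)
    (Eventually.of_forall fun x => ?_)
  rw [norm_mul]
  exact mul_le_mul_of_nonneg_right (hM x) (norm_nonneg _)

lemma IsContTest.integral_sq_mul_le (hΩ : IsOpen Ω) {χ f : Space d → ℝ} (hχ : IsContTest Ω χ)
    {M : ℝ} (hM : ∀ x, |χ x| ≤ M)
    (hf : MemLp f 2 (volume.restrict Ω)) :
    ∫ x, (χ x * f x) ^ 2 ≤ M ^ 2 * ∫ x in Ω, f x ^ 2 := by
  rw [← setIntegral_eq_integral_of_forall_compl_eq_zero (s := Ω)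
    (fun x hx => by rw [hχ.zero_of_notMem hx]; simp), ← integral_const_mul]
  refine integral_mono (((hχ.memLp_mul hΩ hf).restrict Ω).integrable_sq)
    (hf.integrable_sq.const_mul _) fun x => ?_
  change (χ x * f x) ^ 2 ≤ M ^ 2 * f x ^ 2
  rw [mul_pow]
  exact mul_le_mul_of_nonneg_right (sq_le_sq.2 ((hM x).trans (le_abs_self M))) (sq_nonneg _)

/-- The cut-off can be moved onto the test function, and on a finite measure `L²` functions belong
to the dual space since `p / (p - 1) ≤ 2`. -/
lemma BddWeak.weakL2 [IsFiniteMeasure (volume.restrict Ω)] (hΩ : IsOpen Ω) (hp : 2 < p)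
    {f : ℕ → Space d → ℝ} {f₀ χ : Space d → ℝ}
    (h : BddWeak Ω p C f f₀) (hχ : IsContTest Ω χ) :
    WeakL2 volume (fun n x => χ x * f n x) fun x => χ x * f₀ x := by
  intro ψ hψ
  have hm : MemLp (fun x => χ x * ψ x) (ENNReal.ofReal (p / (p - 1))) (volume.restrict Ω) :=
    (hχ.memLp_mul hΩ (hψ.restrict Ω)).restrict Ω |>.mono_exponent (ofReal_conj_le_two hp)
  have e : ∀ u : Space d → ℝ, ∫ x in Ω, u x * (χ x * ψ x) = ∫ x, χ x * u x * ψ x := by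
    intro u
    rw [setIntegral_eq_integral_of_forall_compl_eq_zero
      fun x hx => by rw [hχ.zero_of_notMem hx]; simp]
    congr 1; ext x; ring
  have := h.weak _ hm
  simpa only [e] using this

/-- Bounded weakly convergent forms whose curl is locally bounded in `L¹`. -/
structure BddForms (Ω : Set (Space d)) (p : ℝ) (C : ℝ≥0) (a : ℕ → Fin d → Space d → ℝ)
    (a₀ : Fin d → Space d → ℝ) : Prop where
  weak : ∀ j, BddWeak Ω p C (fun n => a n j) (a₀ j)
  curl : ∃ F : Fin d → Fin d → ℕ → Space d → ℝ, (∀ i j, LocBdd Ω (F i j)) ∧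
    ∀ n i j, ∀ φ, IsTest Ω φ →
      ∫ x in Ω, (pd i φ x * a n j x - pd j φ x * a n i x) = -∫ x in Ω, φ x * F i j n x

/-- Multiplying by a cut-off changes the curl into `χ F + dχ ∧ a`, still bounded in `L¹`, and does
not increase the tails. A threshold for `A`, rather than one value, lets two sequences of forms
share a constant. -/
lemma BddForms.exists_controlledForm [IsFiniteMeasure (volume.restrict Ω)] (hΩ : IsOpen Ω)
    (hp : 2 < p) {a : ℕ → Fin d → Space d → ℝ} {a₀ : Fin d → Space d → ℝ}
    (h : BddForms Ω p C a a₀) {χ : Space d → ℝ} (hχ : IsTest Ω χ) (hχ1 : ∀ x, |χ x| ≤ 1) :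
    ∃ A₀ : ℝ, ∀ A, A₀ ≤ A → ∀ n,
      ControlledForm A (tailBound p C) fun j x => χ x * a n j x := by
  obtain ⟨R, hR, hRf⟩ := exists_integral_sq_le Ω hp C
  obtain ⟨F, hF, hcurl⟩ := h.curl
  choose B hB using fun i j => (hF i j).2 _ hχ.compact hχ.subset
  have hχc := hχ.isContTest
  choose M hM0 hM using fun i => exists_bound_of_hasCompactSupport
    (hχ.pd i).smooth.continuous (hχ.pd i).compact
  set V := volume.real Ω + R with hV
  have hV0 : 0 ≤ V := add_nonneg measureReal_nonneg hR
  have a2 : ∀ n j, MemLp (a n j) 2 (volume.restrict Ω) := fun n j =>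
    memLp_two_of_memLp hp ((h.weak j).mem n)
  have ali : ∀ n j, LocallyIntegrableOn (a n j) Ω := fun n j =>
    locallyIntegrableOn_of_memLp hp ((h.weak j).mem n)
  have haR : ∀ n j, ∫ x in Ω, a n j x ^ 2 ≤ R := fun n j =>
    hRf _ ((h.weak j).mem n) ((h.weak j).bdd n)
  have haV : ∀ n j, ∫ x in Ω, |a n j x| ≤ V := fun n j =>
    (integral_abs_le_add (a2 n j)).trans (by rw [hV]; have := haR n j; linarith)
  have hmulL1 : ∀ (φ : Space d → ℝ) (m : ℝ), IsTest Ω φ → (∀ x, |φ x| ≤ m) → ∀ n j,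
      ∫ x, |φ x * a n j x| ≤ m * V := by
    intro φ m hφ hm n j
    rw [← setIntegral_eq_integral_of_forall_compl_eq_zero (s := Ω)
      (fun x hx => by rw [hφ.isContTest.zero_of_notMem hx]; simp)]
    have hm0 : 0 ≤ m := (abs_nonneg _).trans (hm 0)
    calc ∫ x in Ω, |φ x * a n j x| ≤ ∫ x in Ω, m * |a n j x| := by
          refine integral_mono (hφ.isContTest.integrable_mul (ali n j)).integrableOn.abs
            (((a2 n j).integrable (by norm_num)).abs.const_mul m) fun x => ?_
          simp only [abs_mul]
          exact mul_le_mul_of_nonneg_right (hm x) (abs_nonneg _)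
      _ = m * ∫ x in Ω, |a n j x| := integral_const_mul _ _
      _ ≤ m * V := mul_le_mul_of_nonneg_left (haV n j) hm0
  have hi1 : ∀ n i j, Integrable fun x => pd i χ x * a n j x := fun n i j =>
    (hχ.pd i).isContTest.integrable_mul (ali n j)
  have hi2 : ∀ n i j, Integrable fun x => χ x * F i j n x := fun n i j =>
    hχc.integrable_mul ((hF i j).1 n)
  refine ⟨V + ∑ i, ∑ j, (|B i j| + M i * V + M j * V), fun A hA n => ?_⟩
  have hVA : V ≤ A := le_trans (le_add_of_nonneg_right (Finset.sum_nonneg fun i _ =>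
    Finset.sum_nonneg fun j _ => by have := hM0 i; have := hM0 j; positivity)) hA
  refine ⟨fun j => hχ.compact.mul_right, fun j => hχc.memLp_mul hΩ (a2 n j),
    fun j => ?_, fun j => ?_, fun j N hN => ?_, ?_⟩
  · exact (hmulL1 χ 1 hχ hχ1 n j).trans (by linarith)
  · refine (hχc.integral_sq_mul_le hΩ hχ1 (a2 n j)).trans ?_
    have h1 : (0 : ℝ) ≤ volume.real Ω := measureReal_nonneg
    have := haR n j
    linarith
  · rw [← setIntegral_eq_integral_of_forall_compl_eq_zero (s := Ω)
      (fun x hx => by rw [hχc.zero_of_notMem hx, zero_mul]; simp [tailSq])]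
    refine le_trans ?_ (integral_tailSq_le hp ((h.weak j).mem n) ((h.weak j).bdd n) hN)
    exact integral_mono (integrable_tailSq ((hχc.memLp_mul hΩ (a2 n j)).restrict Ω) N)
      (integrable_tailSq (a2 n j) N) fun x => tailSq_mul_le (hχ1 x)
  · refine ⟨fun i j x => χ x * F i j n x + pd i χ x * a n j x - pd j χ x * a n i x,
      fun i j => ((hi2 n i j).add (hi1 n i j)).sub (hi1 n j i), fun i j => ?_, ?_⟩
    · have t1 : ∫ x, |χ x * F i j n x| ≤ |B i j| := by
        refine (hχc.setIntegral_abs_le ((hF i j).1 n) hχ1 hχ.compact hχ.subset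
          fun x hx => image_eq_zero_of_notMem_tsupport hx).trans ?_
        rw [one_mul]
        exact (hB i j n).trans (le_abs_self _)
      have t2 := hmulL1 _ _ (hχ.pd i) (hM i) n j
      have t3 := hmulL1 _ _ (hχ.pd j) (hM j) n i
      have t4 : ∫ x, |χ x * F i j n x + pd i χ x * a n j x - pd j χ x * a n i x| ≤
          (∫ x, |χ x * F i j n x|) + (∫ x, |pd i χ x * a n j x|) + ∫ x, |pd j χ x * a n i x| := by
        rw [← integral_add (hi2 n i j).abs (hi1 n i j).abs,
          ← integral_add ((hi2 n i j).abs.fun_add (hi1 n i j).abs) (hi1 n j i).abs]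
        refine integral_mono (((hi2 n i j).add (hi1 n i j)).sub (hi1 n j i)).abs
          (((hi2 n i j).abs.fun_add (hi1 n i j).abs).fun_add (hi1 n j i).abs) fun x => ?_
        exact (abs_sub _ _).trans (add_le_add_left (abs_add_le _ _) _)
      have t5 : |B i j| + M i * V + M j * V ≤ ∑ i, ∑ j, (|B i j| + M i * V + M j * V) := by
        have nn : ∀ i j, 0 ≤ |B i j| + M i * V + M j * V := fun i j => by
          have := hM0 i; have := hM0 j; positivity
        exact (Finset.single_le_sum (f := fun j => |B i j| + M i * V + M j * V)
          (fun j _ => nn i j) (Finset.mem_univ j)).trans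
          (Finset.single_le_sum (f := fun i => ∑ j, (|B i j| + M i * V + M j * V))
          (fun i _ => Finset.sum_nonneg fun j _ => nn i j) (Finset.mem_univ i))
      linarith
    · intro i j ψ hψ hψc
      -- A test function on the whole space becomes one on `Ω` after multiplication by the cut-off;
      -- expanding its derivatives produces the terms with `dχ`.
      have hψχ : IsTest Ω fun x => ψ x * χ x := hχ.mul_left hψ
      have hc := hcurl n i j _ hψχ
      have hpd : ∀ i x, pd i (fun x => ψ x * χ x) x = pd i ψ x * χ x + ψ x * pd i χ x :=
        fun i x => pd_mul (hψ.differentiable (by simp) x)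
          (hχ.smooth.differentiable (by simp) x) i
      have e1 : ∀ i j, Integrable fun x => pd i ψ x * (χ x * a n j x) := fun i j =>
        integrable_mul_of_locallyIntegrable (contDiff_pd_infty hψ i).continuous
          (hasCompactSupport_pd hψc i) (hχc.integrable_mul (ali n j)).locallyIntegrable
      have e2 : ∀ i j, Integrable fun x => ψ x * (pd i χ x * a n j x) := fun i j =>
        integrable_mul_of_locallyIntegrable hψ.continuous hψc (hi1 n i j).locallyIntegrable
      have e3 : Integrable fun x => ψ x * (χ x * F i j n x) :=
        integrable_mul_of_locallyIntegrable hψ.continuous hψc (hi2 n i j).locallyIntegrable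
      rw [setIntegral_eq_integral_of_forall_compl_eq_zero fun x hx => by
        rw [(hψχ.pd i).isContTest.zero_of_notMem hx, (hψχ.pd j).isContTest.zero_of_notMem hx]
        simp, hψχ.isContTest.integral_eq] at hc
      have l1 : ∀ x, pd i (fun x => ψ x * χ x) x * a n j x - pd j (fun x => ψ x * χ x) x * a n i x
          = (pd i ψ x * (χ x * a n j x) - pd j ψ x * (χ x * a n i x))
            + (ψ x * (pd i χ x * a n j x) - ψ x * (pd j χ x * a n i x)) := by
        intro x; rw [hpd, hpd]; ring
      have l2 : ∀ x, ψ x * (χ x * F i j n x + pd i χ x * a n j x - pd j χ x * a n i x)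
          = ψ x * χ x * F i j n x
            + (ψ x * (pd i χ x * a n j x) - ψ x * (pd j χ x * a n i x)) := by
        intro x; ring
      simp only [l1] at hc
      simp only [l2]
      simp only [← mul_assoc] at e3
      rw [integral_add ((e1 i j).sub' (e1 j i)) ((e2 i j).sub' (e2 j i))] at hc
      rw [integral_add e3 ((e2 i j).sub' (e2 j i))]
      linarith

/-- Weak continuity of exterior products on `Ω`. -/
theorem BddForms.locConv_wedge [IsFiniteMeasure (volume.restrict Ω)] (hd : 0 < d) (hΩ : IsOpen Ω)
    (hp : 2 < p) {a b : ℕ → Fin d → Space d → ℝ} {a₀ b₀ : Fin d → Space d → ℝ}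
    (ha : BddForms Ω p C a a₀) (hb : BddForms Ω p C b b₀) (k l : Fin d) :
    LocConv Ω (fun n x => a n k x * b n l x - a n l x * b n k x)
      fun x => a₀ k x * b₀ l x - a₀ l x * b₀ k x := by
  have hbd : ∀ k l, LocBdd Ω fun n x => a n k x * b n l x := fun k l =>
    locBdd_mul hp (ha.weak k).mem (ha.weak k).bdd (hb.weak l).mem (hb.weak l).bdd
  refine ((hbd k l).sub (hbd l k)).locConv
    ((locallyIntegrableOn_mul_of_memLp hp (ha.weak k).mem₀ (hb.weak l).mem₀).sub
      (locallyIntegrableOn_mul_of_memLp hp (ha.weak l).mem₀ (hb.weak k).mem₀)) fun φ hφ => ?_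
  -- As `χ = 1` on the support of `φ`, localising both forms leaves the tested product unchanged.
  obtain ⟨χ, hχ, hχ01, hχ1⟩ := exists_cutoff hΩ hφ.compact.isCompact hφ.subset
  have hχa : ∀ x, |χ x| ≤ 1 := fun x => abs_le.2 ⟨by linarith [(hχ01 x).1], (hχ01 x).2⟩
  obtain ⟨A₁, hA₁⟩ := ha.exists_controlledForm hΩ hp hχ hχa
  obtain ⟨A₂, hA₂⟩ := hb.exists_controlledForm hΩ hp hχ hχa
  have h := tendsto_integral_wedge hd (tendsto_tailBound hp C)
    (hA₁ (max A₁ A₂) (le_max_left _ _)) (hA₂ (max A₁ A₂) (le_max_right _ _))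
    (α₀ := fun j x => χ x * a₀ j x) (β₀ := fun j x => χ x * b₀ j x)
    (fun j => hχ.isContTest.memLp_mul hΩ (memLp_two_of_memLp hp (ha.weak j).mem₀))
    (fun j => hχ.isContTest.memLp_mul hΩ (memLp_two_of_memLp hp (hb.weak j).mem₀))
    (fun j => (ha.weak j).weakL2 hΩ hp hχ.isContTest)
    (fun j => (hb.weak j).weakL2 hΩ hp hχ.isContTest) hφ.smooth hφ.compact k l
  have e : ∀ u v w z : Space d → ℝ,
      ∫ x, φ x * (χ x * u x * (χ x * v x) - χ x * w x * (χ x * z x))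
        = ∫ x in Ω, φ x * (u x * v x - w x * z x) := by
    intro u v w z
    rw [hφ.isContTest.integral_eq]
    congr 1; ext x
    by_cases hx : x ∈ tsupport φ
    · rw [hχ1 x hx]; ring
    · rw [image_eq_zero_of_notMem_tsupport hx]; ring
  simpa only [e] using h

end

section


variable {d : ℕ} {Ω : Set (Space d)} {p : ℝ} {C : ℝ≥0}

/-! ### Products with strongly compact factors -/

/-- `f'` is the weak partial derivative `∂f/∂x^k` on `Ω` (scalar valued). -/
structure WeakPD (Ω : Set (Space d)) (k : Fin d) (f f' : Space d → ℝ) : Prop where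
  left : LocallyIntegrableOn f Ω
  right : LocallyIntegrableOn f' Ω
  eq : ∀ φ, IsTest Ω φ → ∫ x in Ω, pd k φ x * f x = -∫ x in Ω, φ x * f' x

lemma WeakPD.weakGrad_mul {f : Space d → ℝ} {f' : Fin d → Space d → ℝ}
    (h : ∀ k, WeakPD Ω k f (f' k)) {χ : Space d → ℝ} (hχ : IsTest Ω χ) :
    WeakGrad (fun x => χ x * f x) fun k x => χ x * f' k x + pd k χ x * f x := by
  intro k ψ hψ hψc
  have hψχ : IsTest Ω fun x => ψ x * χ x := hχ.mul_left hψ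
  have hc := (h k).eq _ hψχ
  have hχc := hχ.isContTest
  have hpd : ∀ x, pd k (fun x => ψ x * χ x) x = pd k ψ x * χ x + ψ x * pd k χ x :=
    fun x => pd_mul (hψ.differentiable (by simp) x) (hχ.smooth.differentiable (by simp) x) k
  have e1 : Integrable fun x => pd k ψ x * (χ x * f x) :=
    integrable_mul_of_locallyIntegrable (contDiff_pd_infty hψ k).continuous
      (hasCompactSupport_pd hψc k) (hχc.integrable_mul (h k).left).locallyIntegrable
  have e2 : Integrable fun x => ψ x * (pd k χ x * f x) :=
    integrable_mul_of_locallyIntegrable hψ.continuous hψc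
      ((hχ.pd k).isContTest.integrable_mul (h k).left).locallyIntegrable
  have e3 : Integrable fun x => ψ x * (χ x * f' k x) :=
    integrable_mul_of_locallyIntegrable hψ.continuous hψc
      (hχc.integrable_mul (h k).right).locallyIntegrable
  rw [(hψχ.pd k).isContTest.integral_eq, hψχ.isContTest.integral_eq] at hc
  have l1 : ∀ x, pd k (fun x => ψ x * χ x) x * f x
      = pd k ψ x * (χ x * f x) + ψ x * (pd k χ x * f x) := by
    intro x; rw [hpd]; ring
  have l2 : ∀ x, ψ x * (χ x * f' k x + pd k χ x * f x)
      = ψ x * (χ x * f' k x) + ψ x * (pd k χ x * f x) := by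
    intro x; ring
  simp only [l1, mul_assoc] at hc
  simp only [l2]
  rw [integral_add e1 e2] at hc
  rw [integral_add e3 e2]
  linarith

/-- Products of a sequence with locally bounded weak gradients and a weakly convergent one. -/
theorem locConv_mul_of_weakPD [IsFiniteMeasure (volume.restrict Ω)] (hd : 0 < d) (hΩ : IsOpen Ω)
    (hp : 2 < p) {c : Space d → ℝ} (hc : ContinuousOn c Ω) {v h : ℕ → Space d → ℝ}
    {v₀ h₀ : Space d → ℝ} (hv : BddWeak Ω p C v v₀) (hh : BddWeak Ω p C h h₀)
    {f' : Fin d → ℕ → Space d → ℝ} (hf' : ∀ k, LocBdd Ω (f' k))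
    (hf : ∀ k n, WeakPD Ω k (fun x => c x * v n x) (f' k n)) :
    LocConv Ω (fun n x => c x * v n x * h n x) fun x => c x * v₀ x * h₀ x := by
  have hcv : LocBdd Ω fun n x => c x * v n x :=
    (locBdd_of_bdd hp hv.mem hv.bdd).continuousOn_mul hΩ hc
  have hbd : LocBdd Ω fun n x => c x * v n x * h n x := by
    simpa only [mul_assoc] using (locBdd_mul hp hv.mem hv.bdd hh.mem hh.bdd).continuousOn_mul hΩ hc
  have hbd₀ : LocallyIntegrableOn (fun x => c x * v₀ x * h₀ x) Ω := by
    simpa only [mul_assoc] using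
      LocallyIntegrableOn.continuousOn_mul' hΩ
        (locallyIntegrableOn_mul_of_memLp hp hv.mem₀ hh.mem₀) hc
  refine hbd.locConv hbd₀ fun φ hφ => ?_
  obtain ⟨χ, hχ, hχ01, hχ1⟩ := exists_cutoff hΩ hφ.compact.isCompact hφ.subset
  have hχa : ∀ x, |χ x| ≤ 1 := fun x => abs_le.2 ⟨by linarith [(hχ01 x).1], (hχ01 x).2⟩
  have hχc := hχ.isContTest
  have hχcc := hχc.mul_continuousOn hΩ hc
  obtain ⟨R, hR, hRf⟩ := exists_integral_sq_le Ω hp C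
  obtain ⟨M, hM0, hM⟩ := exists_bound_of_hasCompactSupport hχcc.continuous hχcc.compact
  choose N hN0 hN using fun i => exists_bound_of_hasCompactSupport
    (hχ.pd i).smooth.continuous (hχ.pd i).compact
  choose B hB using fun k => (hf' k).2 _ hχ.compact hχ.subset
  obtain ⟨D, hD⟩ := hcv.2 _ hχ.compact hχ.subset
  -- One constant serves three purposes: the `L²` bound of the localised `c * v`, that of the
  -- localised `h`, and the `L¹` bound of the gradient `χ f' + ∂χ (c v)`.
  set A := M ^ 2 * R + R + ∑ k, (|B k| + N k * |D|) with hA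
  have nn : ∀ k, 0 ≤ |B k| + N k * |D| := fun k => by have := hN0 k; positivity
  have nns : 0 ≤ ∑ k, (|B k| + N k * |D|) := Finset.sum_nonneg fun k _ => nn k
  have nnM : 0 ≤ M ^ 2 * R := by positivity
  have v2 : ∀ n, MemLp (v n) 2 (volume.restrict Ω) := fun n => memLp_two_of_memLp hp (hv.mem n)
  have h2 : ∀ n, MemLp (h n) 2 (volume.restrict Ω) := fun n => memLp_two_of_memLp hp (hh.mem n)
  have e0 : ∀ u : Space d → ℝ, (fun x => χ x * (c x * u x)) = fun x => χ x * c x * u x :=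
    fun u => by ext x; ring
  have hctl : ∀ n, ControlledFun A fun x => χ x * (c x * v n x) := by
    intro n
    refine ⟨by rw [e0]; exact hχcc.memLp_mul hΩ (v2 n), ?_, _, fun k => ?_, fun k => ?_,
      WeakPD.weakGrad_mul (fun k => hf k n) hχ⟩
    · simp only [← mul_assoc]
      refine (hχcc.integral_sq_mul_le hΩ hM (v2 n)).trans ?_
      have := mul_le_mul_of_nonneg_left (hRf _ (hv.mem n) (hv.bdd n)) (sq_nonneg M)
      linarith
    · exact (hχc.integrable_mul (hf k n).right).add
        ((hχ.pd k).isContTest.integrable_mul (hf k n).left)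
    · have i1 := hχc.integrable_mul (hf k n).right
      have i2 := (hχ.pd k).isContTest.integrable_mul (hf k n).left
      have t1 : ∫ x, |χ x * f' k n x| ≤ |B k| := by
        refine (hχc.setIntegral_abs_le (hf k n).right hχa hχ.compact hχ.subset
          fun x hx => image_eq_zero_of_notMem_tsupport hx).trans ?_
        rw [one_mul]
        exact (hB k n).trans (le_abs_self _)
      have t2 : ∫ x, |pd k χ x * (c x * v n x)| ≤ N k * |D| := by
        refine ((hχ.pd k).isContTest.setIntegral_abs_le (hf k n).left (hN k) hχ.compact hχ.subset
          fun x hx => image_eq_zero_of_notMem_tsupport fun h =>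
            hx (tsupport_pd_subset χ k h)).trans ?_
        exact mul_le_mul_of_nonneg_left ((hD n).trans (le_abs_self _)) (hN0 k)
      have t3 : ∫ x, |χ x * f' k n x + pd k χ x * (c x * v n x)| ≤
          (∫ x, |χ x * f' k n x|) + ∫ x, |pd k χ x * (c x * v n x)| := by
        rw [← integral_add i1.abs i2.abs]
        exact integral_mono (i1.add i2).abs (i1.abs.fun_add i2.abs) fun x => abs_add_le _ _
      have t4 := Finset.single_le_sum (f := fun k => |B k| + N k * |D|) (fun k _ => nn k)
        (Finset.mem_univ k)
      linarith
  have key := tendsto_integral_controlledFun_mul hd (tendsto_tailBound hp C) hctl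
    (h := fun n x => χ x * h n x) (h₀ := fun x => χ x * h₀ x)
    (f₀ := fun x => χ x * (c x * v₀ x))
    (fun n => hχc.memLp_mul hΩ (h2 n)) (fun n => ?_) (fun n L hL => ?_)
    (by rw [e0]; exact hχcc.memLp_mul hΩ (memLp_two_of_memLp hp hv.mem₀))
    (hχc.memLp_mul hΩ (memLp_two_of_memLp hp hh.mem₀))
    (by simpa only [mul_assoc] using hv.weakL2 hΩ hp hχcc) (hh.weakL2 hΩ hp hχc)
    hφ.smooth.continuous hφ.compact
  · have e : ∀ u w : Space d → ℝ, ∫ x, φ x * (χ x * (c x * u x) * (χ x * w x))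
        = ∫ x in Ω, φ x * (c x * u x * w x) := by
      intro u w
      rw [hφ.isContTest.integral_eq]
      congr 1; ext x
      by_cases hx : x ∈ tsupport φ
      · rw [hχ1 x hx]; ring
      · rw [image_eq_zero_of_notMem_tsupport hx]; ring
    simpa only [e] using key
  · refine (hχc.integral_sq_mul_le hΩ hχa (h2 n)).trans ?_
    have := hRf _ (hh.mem n) (hh.bdd n)
    linarith
  · rw [← setIntegral_eq_integral_of_forall_compl_eq_zero (s := Ω)
      (fun x hx => by rw [hχc.zero_of_notMem hx, zero_mul]; simp [tailSq])]
    refine le_trans ?_ (integral_tailSq_le hp (hh.mem n) (hh.bdd n) hL)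
    exact integral_mono (integrable_tailSq ((hχc.memLp_mul hΩ (h2 n)).restrict Ω) L)
      (integrable_tailSq (h2 n) L) fun x => tailSq_mul_le (hχa x)

end

section


variable {d m : ℕ} {Ω : Set (Space d)} {p : ℝ} {C : ℝ≥0}
  {g : Space d → Matrix (Fin d) (Fin d) ℝ} {σ : ℝ}

/-! ### The coefficients of the metric -/

lemma IsMetricOn.contDiffOn_pd (hΩ : IsOpen Ω) (hg : IsMetricOn Ω g) (k i j : Fin d) :
    ContDiffOn ℝ 1 (pd k fun z => g z i j) Ω :=
  ((hg.contDiffOn i j).fderiv_of_isOpen hΩ (by norm_num)).clm_apply contDiffOn_const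

lemma IsMetricOn.continuousOn_pd (hΩ : IsOpen Ω) (hg : IsMetricOn Ω g) (k i j : Fin d) :
    ContinuousOn (pd k fun z => g z i j) Ω :=
  (hg.contDiffOn_pd hΩ k i j).continuousOn

lemma IsMetricOn.det_ne_zero (hg : IsMetricOn Ω g) {x : Space d} (hx : x ∈ Ω) :
    (g x).det ≠ 0 := (hg.posDef x hx).det_pos.ne'

/-- Cramer's rule: the adjugate is polynomial in the entries and the determinant does not vanish on
`Ω`. -/
lemma IsMetricOn.continuousOn_inv (hg : IsMetricOn Ω g) (i j : Fin d) :
    ContinuousOn (fun x => (g x)⁻¹ i j) Ω := by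
  have h1 : Continuous fun x : Ω => g x := continuous_matrix fun i j =>
    continuousOn_iff_continuous_domRestrict.1 (hg.contDiffOn i j).continuousOn
  rw [continuousOn_iff_continuous_domRestrict]
  have h2 : (Ω.domRestrict fun x => (g x)⁻¹ i j)
      = fun x : Ω => ((g x).det)⁻¹ * (g x).adjugate i j := by
    ext x
    simp [Matrix.inv_def, Ring.inverse_eq_inv']
  rw [h2]
  exact (h1.matrix_det.inv₀ fun x => hg.det_ne_zero x.2).mul
    ((continuous_apply_apply i j).comp h1.matrix_adjugate)

lemma IsMetricOn.continuousOn_christoffel (hΩ : IsOpen Ω) (hg : IsMetricOn Ω g) (k i j : Fin d) :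
    ContinuousOn (christoffel g k i j) Ω := by
  refine continuousOn_const.mul (continuousOn_finsetSum _ fun l _ => ?_)
  exact (hg.continuousOn_inv k l).mul (((hg.continuousOn_pd hΩ j i l).add
    (hg.continuousOn_pd hΩ i j l)).sub (hg.continuousOn_pd hΩ l i j))

/-! ### Weak continuity of the Gauss-Codazzi-Ricci system -/

lemma lpLoc_two_of_memLp [IsFiniteMeasure (volume.restrict Ω)] (hp : 2 < p) {f : Space d → ℝ}
    (hf : MemLp f (ENNReal.ofReal p) (volume.restrict Ω)) : LpLoc Ω 2 f := fun K _ hKΩ => by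
  have h2 : ENNReal.ofReal 2 = 2 := by simp
  rw [h2]
  exact (memLp_two_of_memLp hp hf).mono_measure (Measure.restrict_mono hKΩ le_rfl)

lemma integral_curl_eq {A B S φ : Space d → ℝ} (hA : LocallyIntegrableOn A Ω)
    (hB : LocallyIntegrableOn B Ω) (hS : LocallyIntegrableOn S Ω) (hφ : IsTest Ω φ) (k l : Fin d) :
    ∫ x in Ω, (-(pd k φ x * A x) + pd l φ x * B x + φ x * S x)
      = -(∫ x in Ω, pd k φ x * A x) + (∫ x in Ω, pd l φ x * B x) + ∫ x in Ω, φ x * S x := by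
  have i1 := ((hφ.pd k).isContTest.integrable_mul hA).integrableOn (s := Ω)
  have i2 := ((hφ.pd l).isContTest.integrable_mul hB).integrableOn (s := Ω)
  have i3 := (hφ.isContTest.integrable_mul hS).integrableOn (s := Ω)
  rw [integral_add (i1.fun_neg.fun_add i2) i3, integral_add i1.fun_neg i2, integral_neg]

lemma integral_curl_eq_neg {A B S φ : Space d → ℝ} (hA : LocallyIntegrableOn A Ω)
    (hB : LocallyIntegrableOn B Ω) (hS : LocallyIntegrableOn S Ω) (hφ : IsTest Ω φ) {k l : Fin d}
    (h : ∫ x in Ω, (-(pd k φ x * A x) + pd l φ x * B x + φ x * S x) = 0) :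
    ∫ x in Ω, (pd k φ x * A x - pd l φ x * B x) = -∫ x in Ω, φ x * -S x := by
  rw [integral_curl_eq hA hB hS hφ] at h
  simp only [mul_neg, integral_neg]
  rw [integral_sub ((hφ.pd k).isContTest.integrable_mul hA).integrableOn
    ((hφ.pd l).isContTest.integrable_mul hB).integrableOn]
  linarith

lemma integral_curl_eq_zero_of_locConv {A B S : ℕ → Space d → ℝ} {A₀ B₀ S₀ φ : Space d → ℝ}
    (hA : LocConv Ω A A₀) (hB : LocConv Ω B B₀) (hS : LocConv Ω S S₀) (hφ : IsTest Ω φ)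
    (k l : Fin d)
    (h : ∀ n, ∫ x in Ω, (-(pd k φ x * A n x) + pd l φ x * B n x + φ x * S n x) = 0) :
    ∫ x in Ω, (-(pd k φ x * A₀ x) + pd l φ x * B₀ x + φ x * S₀ x) = 0 := by
  rw [integral_curl_eq hA.lim hB.lim hS.lim hφ]
  refine tendsto_nhds_unique (((hA.tendsto _ (hφ.pd k).isContTest).neg.add
    (hB.tendsto _ (hφ.pd l).isContTest)).add (hS.tendsto _ hφ.isContTest)) ?_
  refine tendsto_const_nhds.congr fun n => ?_
  rw [← h n, integral_curl_eq (hA.seq n) (hB.seq n) (hS.seq n) hφ]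

section

variable {u : ℕ → Field d m} {u₀ : Field d m}

lemma WeakLimit.bddWeak_h (hw : WeakLimit Ω p u u₀) (hu : ∀ n, (u n).InLp Ω p)
    (hC : ∀ n, (u n).LpBound Ω p C) (a : Fin m) (i j : Fin d) :
    BddWeak Ω p C (fun n => (u n).h a i j) (u₀.h a i j) :=
  ⟨fun n => (hu n).1 a i j, fun n => (hC n).1 a i j, hw.inLp.1 a i j, hw.h a i j⟩

lemma WeakLimit.bddWeak_κ (hw : WeakLimit Ω p u u₀) (hu : ∀ n, (u n).InLp Ω p)
    (hC : ∀ n, (u n).LpBound Ω p C) (a : Fin m) (k : Fin d) (b : Fin m) :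
    BddWeak Ω p C (fun n => (u n).κ a k b) (u₀.κ a k b) :=
  ⟨fun n => (hu n).2 a k b, fun n => (hC n).2 a k b, hw.inLp.2 a k b, hw.κ a k b⟩

variable [IsFiniteMeasure (volume.restrict Ω)]

/-- With `a` and `j` frozen, the Codazzi equation is a formula for the curl of the form in the first
tangential index: linear terms with continuous coefficients and products `κ h`, all locally bounded
in `L¹`. -/
lemma WeakLimit.bddForms_h (hΩ : IsOpen Ω) (hp : 2 < p) (hg : IsMetricOn Ω g)
    (hw : WeakLimit Ω p u u₀) (hu : ∀ n, (u n).InLp Ω p)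
    (hC : ∀ n, (u n).LpBound Ω p C) (hs : ∀ n, IsWeakSolution Ω g σ (u n))
    (a : Fin m) (j : Fin d) :
    BddForms Ω p C (fun n l => (u n).h a l j) (fun l => u₀.h a l j) := by
  have hh := fun a i j => locBdd_of_bdd hp (hw.bddWeak_h hu hC a i j).mem (hC · |>.1 a i j)
  have hκh := fun a k b c i j => locBdd_mul hp (hw.bddWeak_κ hu hC a k b).mem (hC · |>.2 a k b)
    (hw.bddWeak_h hu hC c i j).mem (hC · |>.1 c i j)
  have hS : ∀ k l, LocBdd Ω fun n x => (∑ m, (christoffel g m l j x * (u n).h a k m x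
            - christoffel g m k j x * (u n).h a l m x))
        + ∑ b, ((u n).κ a k b x * (u n).h b l j x - (u n).κ a l b x * (u n).h b k j x) :=
    fun k l => (LocBdd.sum _ fun r =>
      ((hh a k r).continuousOn_mul hΩ (hg.continuousOn_christoffel hΩ r l j)).sub
        ((hh a l r).continuousOn_mul hΩ (hg.continuousOn_christoffel hΩ r k j))).add
      (LocBdd.sum _ fun b => (hκh a k b b l j).sub (hκh a l b b k j))
  exact ⟨fun l => hw.bddWeak_h hu hC a l j, _, fun k l => (hS k l).neg, fun n k l φ hφ =>
    integral_curl_eq_neg ((hh a l j).1 n) ((hh a k j).1 n) ((hS k l).1 n) hφ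
      ((hs n).codazzi a j k l φ hφ)⟩

/-- With `a` and `b` frozen, the Ricci equation gives the curl of the connection form through
products `h h` and `κ κ`. -/
lemma WeakLimit.bddForms_κ (hΩ : IsOpen Ω) (hp : 2 < p) (hg : IsMetricOn Ω g)
    (hw : WeakLimit Ω p u u₀) (hu : ∀ n, (u n).InLp Ω p)
    (hC : ∀ n, (u n).LpBound Ω p C) (hs : ∀ n, IsWeakSolution Ω g σ (u n))
    (a b : Fin m) :
    BddForms Ω p C (fun n l => (u n).κ a l b) (fun l => u₀.κ a l b) := by
  have hκ := fun a k b => locBdd_of_bdd hp (hw.bddWeak_κ hu hC a k b).mem (hC · |>.2 a k b)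
  have hκκ := fun a k b c l e => locBdd_mul hp (hw.bddWeak_κ hu hC a k b).mem (hC · |>.2 a k b)
    (hw.bddWeak_κ hu hC c l e).mem (hC · |>.2 c l e)
  have hhh := fun a k b c i j => locBdd_mul hp (hw.bddWeak_h hu hC a k b).mem (hC · |>.1 a k b)
    (hw.bddWeak_h hu hC c i j).mem (hC · |>.1 c i j)
  have hS : ∀ k l, LocBdd Ω fun n x => -(σ * ∑ m, ∑ r, (g x)⁻¹ m r *
            ((u n).h a m l x * (u n).h b k r x - (u n).h a m k x * (u n).h b l r x))
        + ∑ c, ((u n).κ a k c x * (u n).κ c l b x - (u n).κ a l c x * (u n).κ c k b x) :=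
    fun k l => LocBdd.add (LocBdd.neg (LocBdd.continuousOn_mul hΩ (LocBdd.sum _ fun r =>
      LocBdd.sum _ fun s => LocBdd.continuousOn_mul hΩ
        ((hhh a r l b k s).sub (hhh a r k b l s)) (hg.continuousOn_inv r s)) continuousOn_const))
      (LocBdd.sum _ fun c => (hκκ a k c c l b).sub (hκκ a l c c k b))
  exact ⟨fun l => hw.bddWeak_κ hu hC a l b, _, fun k l => (hS k l).neg, fun n k l φ hφ =>
    integral_curl_eq_neg ((hκ a l b).1 n) ((hκ a k b).1 n) ((hS k l).1 n) hφ
      ((hs n).ricci a b k l φ hφ)⟩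

/-- Weak continuity of the Gauss-Codazzi-Ricci system. -/
theorem WeakLimit.isWeakSolution (hd : 0 < d) (hΩ : IsOpen Ω) (hp : 2 < p) (hg : IsMetricOn Ω g)
    (hw : WeakLimit Ω p u u₀) (hu : UniformlyBounded Ω p u)
    (hs : ∀ n, IsWeakSolution Ω g σ (u n)) : IsWeakSolution Ω g σ u₀ := by
  obtain ⟨hu, C, hC⟩ := hu
  have fh := hw.bddForms_h hΩ hp hg hu hC hs
  have fκ := hw.bddForms_κ hΩ hp hg hu hC hs
  have ch := fun a i j => (hw.bddWeak_h hu hC a i j).locConv hp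
  have cκ := fun a i j => (hw.bddWeak_κ hu hC a i j).locConv hp
  have hsymm : ∀ a i j, ∀ᵐ x ∂(volume.restrict Ω), u₀.h a i j x = u₀.h a j i x := fun a i j =>
    (ch a i j).ae_eq hΩ ((ch a j i).congr hΩ (fun n => (hs n).symm a j i)
      (Eventually.of_forall fun x => rfl))
  refine ⟨fun a i j => lpLoc_two_of_memLp hp (hw.inLp.1 a i j),
    fun a k b => lpLoc_two_of_memLp hp (hw.inLp.2 a k b), hsymm, fun a k b => ?_,
    fun i j k l φ hφ => ?_, fun a j k l φ hφ => ?_, fun a b k l φ hφ => ?_⟩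
  · refine (cκ a k b).ae_eq hΩ (((cκ b k a).neg hΩ).congr hΩ (fun n => ?_)
      (Eventually.of_forall fun x => rfl))
    filter_upwards [(hs n).antisymm a k b] with x hx using hx.symm
  -- The Gauss expression is the `(j, k)` component of the exterior product of the forms `h^a_{·i}`
  -- and `h^a_{·l}`, summed over `a`.
  · have h := LocConv.sum Finset.univ fun a => (fh a i).locConv_wedge hd hΩ hp (fh a l) j k
    refine tendsto_nhds_unique (h.tendsto φ hφ.isContTest) ?_
    exact tendsto_const_nhds.congr fun n => ((hs n).gauss i j k l φ hφ).symm
  · refine integral_curl_eq_zero_of_locConv (ch a l j) (ch a k j) ?_ hφ k l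
      fun n => (hs n).codazzi a j k l φ hφ
    exact (LocConv.sum _ fun r =>
      ((ch a k r).continuousOn_mul hΩ (hg.continuousOn_christoffel hΩ r l j)).sub hΩ
        ((ch a l r).continuousOn_mul hΩ (hg.continuousOn_christoffel hΩ r k j))).add
      (LocConv.sum _ fun b => (fκ a b).locConv_wedge hd hΩ hp (fh b j) k l)
  · refine integral_curl_eq_zero_of_locConv (cκ a l b) (cκ a k b) ?_ hφ k l
      fun n => (hs n).ricci a b k l φ hφ
    refine LocConv.add (LocConv.neg hΩ (LocConv.const_mul hΩ (LocConv.sum _ fun r =>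
      LocConv.sum _ fun s => LocConv.continuousOn_mul hΩ ?_ (hg.continuousOn_inv r s)) σ))
      (LocConv.sum _ fun c => (fκ a c).locConv_wedge hd hΩ hp (fκ c b) k l)
    -- In the Ricci equation the form index of the first factor stands in second place; the symmetry
    -- of `h`, for the sequence and for the limit, brings the difference into exterior product form.
    refine ((fh a r).locConv_wedge hd hΩ hp (fh b s) l k).congr hΩ (fun n => ?_) ?_
    · filter_upwards [(hs n).symm a l r, (hs n).symm a k r] with x h1 h2
      rw [h1, h2]
    · filter_upwards [hsymm a l r, hsymm a k r] with x h1 h2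
      rw [h1, h2]

end

end

section


variable {d m N : ℕ} {Ω : Set (Space d)} {p : ℝ} {C : ℝ≥0}

/-! ### Weak partial derivatives -/

lemma locallyIntegrableOn_iff_eval (hΩ : IsOpen Ω) {f : Space d → Space N} :
    LocallyIntegrableOn f Ω ↔ ∀ q, LocallyIntegrableOn (fun x => f x q) Ω := by
  simp only [locallyIntegrableOn_iff hΩ.isLocallyClosed]
  exact ⟨fun h q K hK hc => integrable_piLp_iff.1 (h K hK hc) q,
    fun h K hK hc => integrable_piLp_iff.2 fun q => h q K hK hc⟩

lemma IsTest.eval_setIntegral (hΩ : IsOpen Ω) {φ : Space d → ℝ} (hφ : IsTest Ω φ)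
    {f : Space d → Space N} (hf : LocallyIntegrableOn f Ω) (q : Fin N) :
    (∫ x in Ω, φ x • f x) q = ∫ x in Ω, φ x * f x q := by
  rw [eval_integral_piLp]
  · rfl
  · intro r
    exact (hφ.isContTest.integrable_mul ((locallyIntegrableOn_iff_eval hΩ).1 hf r)).integrableOn

lemma hasWeakPartial_iff (hΩ : IsOpen Ω) {k : Fin d} {f f' : Space d → Space N} :
    HasWeakPartial Ω k f f' ↔ ∀ q, WeakPD Ω k (fun x => f x q) fun x => f' x q := by
  constructor
  · rintro ⟨h1, h2, h3⟩ q
    refine ⟨(locallyIntegrableOn_iff_eval hΩ).1 h1 q, (locallyIntegrableOn_iff_eval hΩ).1 h2 q,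
      fun φ hφ => ?_⟩
    have := congrArg (fun v : Space N => v q) (h3 φ hφ)
    simp only [PiLp.neg_apply] at this
    rwa [(hφ.pd k).eval_setIntegral hΩ h1, hφ.eval_setIntegral hΩ h2] at this
  · intro h
    have h1 : LocallyIntegrableOn f Ω := (locallyIntegrableOn_iff_eval hΩ).2 fun q => (h q).left
    have h2 : LocallyIntegrableOn f' Ω := (locallyIntegrableOn_iff_eval hΩ).2 fun q => (h q).right
    refine ⟨h1, h2, fun φ hφ => ?_⟩
    ext q
    rw [PiLp.neg_apply, (hφ.pd k).eval_setIntegral hΩ h1, hφ.eval_setIntegral hΩ h2]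
    exact (h q).eq φ hφ

lemma lpLoc_iff_eval {q : ℝ} {f : Space d → Space N} :
    LpLoc Ω q f ↔ ∀ r, LpLoc Ω q fun x => f x r :=
  ⟨fun h r K hK hc => memLp_piLp_iff.1 (h K hK hc) r,
    fun h K hK hc => memLp_piLp_iff.2 fun r => h r K hK hc⟩

lemma ae_eq_of_forall_integral_eq (hΩ : IsOpen Ω) {f g : Space d → ℝ}
    (hf : LocallyIntegrableOn f Ω) (hg : LocallyIntegrableOn g Ω)
    (h : ∀ φ, IsTest Ω φ → ∫ x in Ω, φ x * f x = ∫ x in Ω, φ x * g x) :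
    ∀ᵐ x ∂(volume.restrict Ω), f x = g x := by
  have h := hΩ.ae_eq_zero_of_integral_contDiff_smul_eq_zero (f := fun x => f x - g x)
    (μ := volume) (hf.sub hg) fun φ h1 h2 h3 => ?_
  · rw [ae_restrict_iff' hΩ.measurableSet]
    filter_upwards [h] with x hx hxΩ using sub_eq_zero.1 (hx hxΩ)
  · have hφ : IsTest Ω φ := ⟨h1, h2, h3⟩
    have := h φ hφ
    rw [hφ.isContTest.integral_eq, hφ.isContTest.integral_eq] at this
    simp only [smul_eq_mul, mul_sub]
    rw [integral_sub (hφ.isContTest.integrable_mul hf) (hφ.isContTest.integrable_mul hg), this,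
      sub_self]

lemma LocallyIntegrableOn.congr_ae (hΩ : IsOpen Ω) {f g : Space d → ℝ}
    (hf : LocallyIntegrableOn f Ω) (h : ∀ᵐ x ∂(volume.restrict Ω), f x = g x) :
    LocallyIntegrableOn g Ω := by
  rw [locallyIntegrableOn_iff hΩ.isLocallyClosed] at hf ⊢
  exact fun K hKΩ hK => (hf K hKΩ hK).congr (ae_restrict_of_ae_restrict_of_subset hKΩ h)

lemma WeakPD.congr (hΩ : IsOpen Ω) {k : Fin d} {f f' g g' : Space d → ℝ} (h : WeakPD Ω k f f')
    (hfg : ∀ᵐ x ∂(volume.restrict Ω), f x = g x)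
    (hfg' : ∀ᵐ x ∂(volume.restrict Ω), f' x = g' x) : WeakPD Ω k g g' := by
  refine ⟨LocallyIntegrableOn.congr_ae hΩ h.left hfg, LocallyIntegrableOn.congr_ae hΩ h.right hfg',
    fun φ hφ => ?_⟩
  have e1 : ∫ x in Ω, pd k φ x * f x = ∫ x in Ω, pd k φ x * g x :=
    integral_congr_ae (hfg.mono fun x hx => by simp only [hx])
  have e2 : ∫ x in Ω, φ x * f' x = ∫ x in Ω, φ x * g' x :=
    integral_congr_ae (hfg'.mono fun x hx => by simp only [hx])
  rw [← e1, ← e2]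
  exact h.eq φ hφ

lemma WeakPD.unique (hΩ : IsOpen Ω) {k : Fin d} {f f' f'' : Space d → ℝ} (h : WeakPD Ω k f f')
    (h' : WeakPD Ω k f f'') : ∀ᵐ x ∂(volume.restrict Ω), f' x = f'' x :=
  ae_eq_of_forall_integral_eq hΩ h.right h'.right fun φ hφ => by
    rw [← neg_inj, ← h.eq φ hφ, h'.eq φ hφ]

/-- Tested with `φ`, both second derivatives equal the pairing of `y` with the same mixed derivative
of `φ`. -/
lemma WeakPD.symm_second (hΩ : IsOpen Ω) {i j : Fin d} {y yi yj yij yji : Space d → ℝ}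
    (hi : WeakPD Ω i y yi) (hj : WeakPD Ω j y yj) (hij : WeakPD Ω i yj yij)
    (hji : WeakPD Ω j yi yji) : ∀ᵐ x ∂(volume.restrict Ω), yij x = yji x := by
  refine ae_eq_of_forall_integral_eq hΩ hij.right hji.right fun φ hφ => ?_
  have h1 := hij.eq φ hφ
  have h2 := hji.eq φ hφ
  have h3 := hj.eq _ (hφ.pd i)
  have h4 := hi.eq _ (hφ.pd j)
  have h5 : pd j (pd i φ) = pd i (pd j φ) := funext fun x => pd_comm hφ.smooth j i x
  rw [h5] at h3
  linarith

lemma ContDiffOn.weakPD (hΩ : IsOpen Ω) {f : Space d → ℝ} (hf : ContDiffOn ℝ 1 f Ω) (k : Fin d) :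
    WeakPD Ω k f (pd k f) := by
  have hc : ContinuousOn (pd k f) Ω :=
    (hf.continuousOn_fderiv_of_isOpen hΩ (by norm_num)).clm_apply continuousOn_const
  refine ⟨hf.continuousOn.locallyIntegrableOn hΩ.measurableSet,
    hc.locallyIntegrableOn hΩ.measurableSet, fun φ hφ => ?_⟩
  have i0 := hφ.isContTest.integrable_mul
    (hf.continuousOn.locallyIntegrableOn (μ := volume) hΩ.measurableSet)
  have i1 := hφ.isContTest.integrable_mul (hc.locallyIntegrableOn (μ := volume) hΩ.measurableSet)
  have i2 := (hφ.pd k).isContTest.integrable_mul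
    (hf.continuousOn.locallyIntegrableOn (μ := volume) hΩ.measurableSet)
  rw [(hφ.pd k).isContTest.integral_eq, hφ.isContTest.integral_eq]
  have h := integral_mul_fderiv_eq_neg_fderiv_mul_of_integrable (μ := volume) (f := f) (g := φ)
    (v := EuclideanSpace.single k 1) (by simpa only [pd, mul_comm] using i1)
    (by simpa only [pd, mul_comm] using i2) (by simpa only [mul_comm] using i0)
    -- Differentiability of `f` is required only on the support of `φ`, which lies in `Ω`.
    (fun x hx => (hf.contDiffAt (hΩ.mem_nhds (hφ.subset hx))).differentiableAt (by norm_num))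
    (fun x _ => hφ.smooth.differentiable (by simp) x)
  simpa only [pd, mul_comm] using h

lemma IsContTest.memLp_mul_of_lpLoc {χ f : Space d → ℝ} (hχ : IsContTest Ω χ)
    (hf : LpLoc Ω 2 f) : MemLp (fun x => χ x * f x) 2 := by
  have h := hf _ hχ.compact hχ.subset
  rw [show ENNReal.ofReal 2 = 2 by simp] at h
  obtain ⟨M, hM0, hM⟩ := exists_bound_of_hasCompactSupport hχ.continuous hχ.compact
  have h1 : (tsupport χ).indicator (fun x => χ x * f x) = fun x => χ x * f x :=
    Set.indicator_eq_self.2 ((Function.support_mul_subset_left _ _).trans (subset_tsupport _))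
  rw [← h1, memLp_indicator_iff_restrict (isClosed_tsupport χ).measurableSet]
  refine h.of_le_mul (c := M) (hχ.continuous.aestronglyMeasurable.mul h.aestronglyMeasurable)
    (Eventually.of_forall fun x => ?_)
  rw [norm_mul]
  exact mul_le_mul_of_nonneg_right (hM x) (norm_nonneg _)

lemma LpLoc.locallyIntegrableOn_mul (hΩ : IsOpen Ω) {f g : Space d → ℝ} (hf : LpLoc Ω 2 f)
    (hg : LpLoc Ω 2 g) : LocallyIntegrableOn (fun x => f x * g x) Ω := by
  rw [locallyIntegrableOn_iff hΩ.isLocallyClosed]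
  intro K hKΩ hK
  have h1 := hf K hK hKΩ
  have h2 := hg K hK hKΩ
  rw [show ENNReal.ofReal 2 = 2 by simp] at h1 h2
  exact h1.integrable_mul h2

/-- Mollifying `f` alone makes `φ * f_s` an admissible test function for the weak derivative of `g`;
the scale then tends to zero in products of two `L²` functions. -/
lemma WeakGrad.integral_pd_mul_mul (hd : 0 < d) {f g : Space d → ℝ} {f' g' : Fin d → Space d → ℝ}
    (hf : WeakGrad f f') (hg : WeakGrad g g') (f2 : MemLp f 2) (g2 : MemLp g 2)
    (f2' : ∀ k, MemLp (f' k) 2) (g2' : ∀ k, MemLp (g' k) 2) {φ : Space d → ℝ}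
    (hφ : ContDiff ℝ ∞ φ) (hφc : HasCompactSupport φ) (k : Fin d) :
    ∫ x, pd k φ x * (f x * g x) = -∫ x, φ x * (f' k x * g x + f x * g' k x) := by
  obtain ⟨η, C, hη⟩ := exists_isMollifierFamily hd
  have hφ' := (contDiff_pd_infty hφ k).continuous
  have hφc' := hasCompactSupport_pd hφc k
  have l1 := tendsto_integral_cv_mul hη f2 g2 hφ' hφc'
  have l2 := (tendsto_integral_cv_mul hη (f2' k) g2 hφ.continuous hφc).add
    (tendsto_integral_cv_mul hη f2 (g2' k) hφ.continuous hφc)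
  rw [← integral_add (integrable_mul_mul hφ.continuous hφc (f2' k) g2)
    (integrable_mul_mul hφ.continuous hφc f2 (g2' k))] at l2
  simp only [← mul_add] at l2
  refine tendsto_nhds_unique l1 (l2.neg.congr' ?_)
  filter_upwards [self_mem_nhdsWithin] with s (hs : 0 < s)
  have fl := MemLp.locallyIntegrable_two f2
  have hcs := cv_contDiff fl (hη.smooth s hs) (hη.hasCompactSupport hs)
  have c2 := hη.memLp_cv hs f2
  have c2' := hη.memLp_cv hs (f2' k)
  have hw := hg k (fun x => φ x * cv f (η s) x) (hφ.mul hcs) hφc.mul_right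
  have hpd : ∀ x, pd k (fun x => φ x * cv f (η s) x) x
      = pd k φ x * cv f (η s) x + φ x * cv (f' k) (η s) x := by
    intro x
    rw [pd_mul (hφ.differentiable (by simp) x) (hcs.differentiable (by simp) x),
      pd_cv fl (hη.smooth s hs) (hη.hasCompactSupport hs),
      hf.cv_eq (hη.smooth s hs) (hη.hasCompactSupport hs)]
  simp only [hpd, add_mul, mul_assoc] at hw
  rw [integral_add (integrable_mul_mul hφ' hφc' c2 g2)
    (integrable_mul_mul hφ.continuous hφc c2' g2)] at hw
  linarith

/-- The product rule for weak derivatives. -/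
lemma WeakPD.mul (hd : 0 < d) (hΩ : IsOpen Ω) {f g : Space d → ℝ} {f' g' : Fin d → Space d → ℝ}
    (hf : ∀ k, WeakPD Ω k f (f' k)) (hg : ∀ k, WeakPD Ω k g (g' k)) (f2 : LpLoc Ω 2 f)
    (g2 : LpLoc Ω 2 g) (f2' : ∀ k, LpLoc Ω 2 (f' k)) (g2' : ∀ k, LpLoc Ω 2 (g' k)) (k : Fin d) :
    WeakPD Ω k (fun x => f x * g x) fun x => f' k x * g x + f x * g' k x := by
  refine ⟨f2.locallyIntegrableOn_mul hΩ g2, ((f2' k).locallyIntegrableOn_mul hΩ g2).add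
    (f2.locallyIntegrableOn_mul hΩ (g2' k)), fun φ hφ => ?_⟩
  obtain ⟨χ, hχ, hχ01, hχ1⟩ := exists_cutoff hΩ hφ.compact.isCompact hφ.subset
  have hχc := hχ.isContTest
  have h := WeakGrad.integral_pd_mul_mul hd (WeakPD.weakGrad_mul hf hχ) (WeakPD.weakGrad_mul hg hχ)
    (hχc.memLp_mul_of_lpLoc f2) (hχc.memLp_mul_of_lpLoc g2)
    (fun k => (hχc.memLp_mul_of_lpLoc (f2' k)).add ((hχ.pd k).isContTest.memLp_mul_of_lpLoc f2))
    (fun k => (hχc.memLp_mul_of_lpLoc (g2' k)).add ((hχ.pd k).isContTest.memLp_mul_of_lpLoc g2))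
    hφ.smooth hφ.compact k
  rw [(hφ.pd k).isContTest.integral_eq, hφ.isContTest.integral_eq]
  -- Where `φ` is nonzero it is so in a neighbourhood, on which `χ` is constantly one.
  have hpd : ∀ x, φ x * pd k χ x = 0 := by
    intro x
    by_cases hx : φ x = 0
    · rw [hx, zero_mul]
    · have hχe : χ =ᶠ[𝓝 x] fun _ => 1 := by
        filter_upwards [(hφ.smooth.continuous.isOpen_support).mem_nhds hx] with z hz
        exact hχ1 z (subset_tsupport _ hz)
      rw [pd, hχe.fderiv_eq]
      simp
  refine Eq.trans ?_ (h.trans (congrArg Neg.neg ?_))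
  · congr 1; ext x
    by_cases hx : x ∈ tsupport φ
    · rw [hχ1 x hx]; ring
    · rw [image_eq_zero_of_notMem_tsupport fun h => hx (tsupport_pd_subset φ k h)]; ring
  · congr 1; ext x
    by_cases hx : x ∈ tsupport φ
    · rw [hχ1 x hx]
      linear_combination (g x * f x + f x * g x) * hpd x
    · rw [image_eq_zero_of_notMem_tsupport hx]; ring

lemma WeakPD.sum {ι : Type*} (s : Finset ι) {k : Fin d} {f f' : ι → Space d → ℝ}
    (h : ∀ i, WeakPD Ω k (f i) (f' i)) :
    WeakPD Ω k (fun x => ∑ i ∈ s, f i x) fun x => ∑ i ∈ s, f' i x := by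
  refine ⟨locallyIntegrableOn_finsetSum _ fun i _ => (h i).left,
    locallyIntegrableOn_finsetSum _ fun i _ => (h i).right, fun φ hφ => ?_⟩
  simp only [Finset.mul_sum]
  rw [integral_finsetSum _ fun i _ =>
      ((hφ.pd k).isContTest.integrable_mul (h i).left).integrableOn,
    integral_finsetSum _ fun i _ => (hφ.isContTest.integrable_mul (h i).right).integrableOn,
    ← Finset.sum_neg_distrib]
  exact Finset.sum_congr rfl fun i _ => (h i).eq φ hφ

lemma weakPD_of_tendsto {k : Fin d} {f f' : ℕ → Space d → ℝ} {f₀ f₀' : Space d → ℝ}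
    (h : ∀ n, WeakPD Ω k (f n) (f' n)) (hf₀ : LocallyIntegrableOn f₀ Ω)
    (hf : ∀ φ, IsTest Ω φ →
      Tendsto (fun n => ∫ x in Ω, φ x * f n x) atTop (𝓝 (∫ x in Ω, φ x * f₀ x)))
    (hf' : LocConv Ω f' f₀') : WeakPD Ω k f₀ f₀' :=
  ⟨hf₀, hf'.lim, fun φ hφ => tendsto_nhds_unique (hf _ (hφ.pd k)) <|
    (hf'.tendsto φ hφ.isContTest).neg.congr fun n => ((h n).eq φ hφ).symm⟩

end

section


variable {d m N : ℕ} {Ω : Set (Space d)} {p : ℝ} {C : ℝ≥0}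
  {g : Space d → Matrix (Fin d) (Fin d) ℝ}

/-! ### The Gauss-Weingarten equations -/

lemma inner_eq_sum (v w : Space N) : inner ℝ v w = ∑ q, v q * w q := by
  simp [PiLp.inner_apply, mul_comm]

lemma lpLoc_of_norm_le {F : Type*} [NormedAddCommGroup F] {q : ℝ} {f : Space d → F}
    {c : Space d → ℝ} (hf : LocallyIntegrableOn f Ω) (hc : ContinuousOn c Ω)
    (h : ∀ᵐ x ∂(volume.restrict Ω), ‖f x‖ ≤ c x) : LpLoc Ω q f := by
  intro K hK hKΩ
  have : IsFiniteMeasure (volume.restrict K) := isFiniteMeasure_restrict.2 hK.measure_lt_top.ne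
  obtain ⟨M, hM⟩ := hK.exists_bound_of_continuousOn (hc.mono hKΩ)
  refine MemLp.of_bound (hf.integrableOn_compact_subset hKΩ hK).aestronglyMeasurable M ?_
  filter_upwards [ae_restrict_of_ae_restrict_of_subset hKΩ h, ae_restrict_mem hK.measurableSet]
    with x hx hxK using hx.trans ((le_abs_self _).trans (hM x hxK))

lemma LpLoc.two {F : Type*} [NormedAddCommGroup F] (hp : 2 < p) {f : Space d → F}
    (hf : LpLoc Ω p f) : LpLoc Ω 2 f := fun K hK hKΩ => by
  have : IsFiniteMeasure (volume.restrict K) := isFiniteMeasure_restrict.2 hK.measure_lt_top.ne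
  exact (hf K hK hKΩ).mono_exponent (ENNReal.ofReal_le_ofReal hp.le)

lemma HasWeakPartial.inner (hd : 0 < d) (hΩ : IsOpen Ω) {f g : Space d → Space N}
    {f' g' : Fin d → Space d → Space N}
    (hf : ∀ k, HasWeakPartial Ω k f (f' k)) (hg : ∀ k, HasWeakPartial Ω k g (g' k))
    (f2 : LpLoc Ω 2 f) (g2 : LpLoc Ω 2 g) (f2' : ∀ k, LpLoc Ω 2 (f' k))
    (g2' : ∀ k, LpLoc Ω 2 (g' k)) (k : Fin d) :
    WeakPD Ω k (fun x => inner ℝ (f x) (g x))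
      fun x => inner ℝ (f' k x) (g x) + inner ℝ (f x) (g' k x) := by
  simp only [inner_eq_sum, ← Finset.sum_add_distrib]
  exact WeakPD.sum _ fun q => WeakPD.mul hd hΩ (f' := fun k x => f' k x q)
    (g' := fun k x => g' k x q) (fun k => (hasWeakPartial_iff hΩ).1 (hf k) q)
    (fun k => (hasWeakPartial_iff hΩ).1 (hg k) q) (lpLoc_iff_eval.1 f2 q) (lpLoc_iff_eval.1 g2 q)
    (fun k => lpLoc_iff_eval.1 (f2' k) q) (fun k => lpLoc_iff_eval.1 (g2' k) q) k

/-- The Gram matrix of tangents and normals is block diagonal with invertible blocks, so these `d +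
m` vectors form a basis and `v - w`, orthogonal to all of them, is orthogonal to itself. -/
lemma eq_of_inner_frame_eq {e : Fin d → Space (d + m)} {ν : Fin m → Space (d + m)}
    {G : Matrix (Fin d) (Fin d) ℝ} (hG : G.PosDef) (he : ∀ i j, inner ℝ (e i) (e j) = G i j)
    (hν : ∀ a b, inner ℝ (ν a) (ν b) = if a = b then (1 : ℝ) else 0)
    (heν : ∀ i a, inner ℝ (e i) (ν a) = 0) {v w : Space (d + m)}
    (h1 : ∀ i, inner ℝ v (e i) = inner ℝ w (e i)) (h2 : ∀ a, inner ℝ v (ν a) = inner ℝ w (ν a)) :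
    v = w := by
  have hli : LinearIndependent ℝ (Sum.elim e ν) := by
    rw [Fintype.linearIndependent_iff]
    intro c hc
    simp only [Fintype.sum_sum_type, Sum.elim_inl, Sum.elim_inr] at hc
    have hb : ∀ b, c (Sum.inr b) = 0 := by
      intro b
      have := congrArg (fun z => inner ℝ z (ν b)) hc
      simpa [inner_add_left, sum_inner, real_inner_smul_left, heν, hν] using this
    have ha : (fun i => c (Sum.inl i)) = 0 := by
      refine Matrix.eq_zero_of_vecMul_eq_zero hG.det_pos.ne' ?_
      ext j
      have := congrArg (fun z => inner ℝ z (e j)) hc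
      simpa [inner_add_left, sum_inner, real_inner_smul_left, he, hb, Matrix.vecMul,
        dotProduct] using this
    rintro (i | b)
    · exact congrFun ha i
    · exact hb b
  have hspan := hli.span_eq_top_of_card_eq_finrank' (by simp)
  have hle : Submodule.span ℝ (Set.range (Sum.elim e ν)) ≤
      LinearMap.ker (innerₛₗ ℝ (v - w)) := by
    rw [Submodule.span_le]
    rintro _ ⟨i | a, rfl⟩
    · simp [h1]
    · simp [h2]
  have hmem : v - w ∈ LinearMap.ker (innerₛₗ ℝ (v - w)) := hle (hspan ▸ Submodule.mem_top)
  rw [LinearMap.mem_ker, innerₛₗ_apply_apply, inner_self_eq_zero] at hmem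
  exact sub_eq_zero.1 hmem

/-- Lowering the upper index cancels the inverse metric and leaves the Koszul expression. -/
lemma sum_christoffel_mul {x : Space d} (hx : (g x).PosDef) (i j l : Fin d) :
    ∑ k, christoffel g k i j x * g x k l = (1 / 2 : ℝ) *
      (pd j (fun z => g z i l) x + pd i (fun z => g z j l) x - pd l (fun z => g z i j) x) := by
  have hs : ∀ k l, g x k l = g x l k := fun k l => by
    have := hx.isHermitian.apply k l
    simpa using this.symm
  have hinv : ∀ l', ∑ k, g x l k * (g x)⁻¹ k l' = if l = l' then 1 else 0 := fun l' => by
    have := congrFun (congrFun (Matrix.mul_nonsing_inv (g x) (isUnit_iff_ne_zero.2 hx.det_pos.ne')) l) l'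
    rwa [Matrix.mul_apply, Matrix.one_apply] at this
  unfold christoffel
  simp only [mul_assoc, Finset.sum_mul, ← Finset.mul_sum]
  rw [Finset.sum_comm]
  have : ∀ l', ∑ k, (g x)⁻¹ k l' * ((pd j (fun z => g z i l') x + pd i (fun z => g z j l') x
      - pd l' (fun z => g z i j) x) * g x k l) = (∑ k, g x l k * (g x)⁻¹ k l') *
      (pd j (fun z => g z i l') x + pd i (fun z => g z j l') x - pd l' (fun z => g z i j) x) := by
    intro l'
    rw [Finset.sum_mul]
    exact Finset.sum_congr rfl fun k _ => by rw [hs k l]; ring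
  simp only [this, hinv, ite_mul, one_mul, zero_mul, Finset.sum_ite_eq, Finset.mem_univ, if_true]

/-- An isometric immersion whose second derivatives and whose frame derivatives are expressed by
the coefficients. -/
structure GaussWeingarten (Ω : Set (Space d)) (g : Space d → Matrix (Fin d) (Fin d) ℝ)
    (y : Space d → Space (d + m)) (ν : Fin m → Space d → Space (d + m)) (u : Field d m)
    (Dy : Fin d → Space d → Space (d + m)) : Prop where
  partial_y : ∀ i, HasWeakPartial Ω i y (Dy i)
  partial_Dy : ∀ i j, HasWeakPartial Ω i (Dy j) fun x =>
    (∑ k, christoffel g k i j x • Dy k x) + ∑ a, u.h a i j x • ν a x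
  partial_ν : ∀ k b, HasWeakPartial Ω k (ν b) fun x =>
    (∑ i, ∑ j, (-((g x)⁻¹ i j * u.h b k j x)) • Dy i x) + ∑ a, u.κ a k b x • ν a x
  frame : ∀ᵐ x ∂(volume.restrict Ω),
      (∀ i j, inner ℝ (Dy i x) (Dy j x) = g x i j) ∧
      (∀ a b, inner ℝ (ν a x) (ν b x) = if a = b then (1 : ℝ) else 0) ∧
      (∀ i a, inner ℝ (Dy i x) (ν a x) = 0)

lemma norm_le_sqrt_of_inner_self {v : Space N} {c : ℝ} (h : inner ℝ v v = c) : ‖v‖ ≤ √c := by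
  rw [norm_eq_sqrt_real_inner, h]

lemma HasWeakPartial.congr (hΩ : IsOpen Ω) {k : Fin d} {f f' f'' : Space d → Space N}
    (h : HasWeakPartial Ω k f f') (h' : ∀ᵐ x ∂(volume.restrict Ω), f' x = f'' x) :
    HasWeakPartial Ω k f f'' :=
  (hasWeakPartial_iff hΩ).2 fun q => ((hasWeakPartial_iff hΩ).1 h q).congr hΩ
    (Eventually.of_forall fun _ => rfl) (h'.mono fun x hx => by rw [hx])

/-- A vector is determined by its products with the frame. Normal components of the second
derivatives and of the frame derivatives are the coefficients by definition; tangential ones follow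
by differentiating `∂_i y ⬝ ∂_j y = g_{ij}` and `∂_i y ⬝ ν_a = 0` weakly. -/
theorem IsIsometricImmersion.exists_gaussWeingarten (hd : 0 < d) (hΩ : IsOpen Ω) (hp : 2 < p)
    (hg : IsMetricOn Ω g) {y : Space d → Space (d + m)} {ν : Fin m → Space d → Space (d + m)}
    {u : Field d m} (h : IsIsometricImmersion Ω g p y ν u) :
    ∃ Dy, GaussWeingarten Ω g y ν u Dy := by
  obtain ⟨Dy, DDy, Dν, hy, hDy, hν, hae⟩ := h
  have Dy2 : ∀ i, LpLoc Ω 2 (Dy i) := fun i => lpLoc_of_norm_le (hy i).right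
    (hg.contDiffOn i i).continuousOn.sqrt (hae.mono fun x hx => norm_le_sqrt_of_inner_self (hx.1 i i))
  have ν2 : ∀ a, LpLoc Ω 2 (ν a) := fun a => lpLoc_of_norm_le (c := fun _ => √1)
    (by obtain ⟨k⟩ : Nonempty (Fin d) := ⟨⟨0, hd⟩⟩
        exact (hν k a).1.left) continuousOn_const
    (hae.mono fun x hx => norm_le_sqrt_of_inner_self (by simpa using hx.2.1 a a))
  have DDy2 : ∀ i j, LpLoc Ω 2 (DDy i j) := fun i j => (hDy i j).2.two hp
  have Dν2 : ∀ k a, LpLoc Ω 2 (Dν k a) := fun k a => (hν k a).2.two hp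
  have hsymm : ∀ i j, ∀ᵐ x ∂(volume.restrict Ω), DDy i j x = DDy j i x := by
    intro i j
    have : ∀ q, ∀ᵐ x ∂(volume.restrict Ω), DDy i j x q = DDy j i x q := fun q =>
      ((hasWeakPartial_iff hΩ).1 (hy i) q).symm_second hΩ ((hasWeakPartial_iff hΩ).1 (hy j) q)
        ((hasWeakPartial_iff hΩ).1 (hDy i j).1 q) ((hasWeakPartial_iff hΩ).1 (hDy j i).1 q)
    filter_upwards [ae_all_iff.2 this] with x hx
    ext q
    exact hx q
  -- The product rule and the classical derivative of `g` give two weak derivatives of the same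
  -- function, which coincide almost everywhere.
  have hmetric : ∀ k i j, ∀ᵐ x ∂(volume.restrict Ω),
      inner ℝ (DDy k i x) (Dy j x) + inner ℝ (Dy i x) (DDy k j x) = pd k (fun z => g z i j) x := by
    intro k i j
    have h1 := HasWeakPartial.inner hd hΩ (fun k => (hDy k i).1) (fun k => (hDy k j).1) (Dy2 i)
      (Dy2 j) (fun k => DDy2 k i) (fun k => DDy2 k j) k
    exact (h1.congr hΩ (hae.mono fun x hx => hx.1 i j) (Eventually.of_forall fun _ => rfl)).unique hΩ
      (ContDiffOn.weakPD hΩ ((hg.contDiffOn i j).of_le (by norm_num)) k)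
  have hnormal : ∀ k i a, ∀ᵐ x ∂(volume.restrict Ω),
      inner ℝ (DDy k i x) (ν a x) + inner ℝ (Dy i x) (Dν k a x) = 0 := by
    intro k i a
    have h1 := HasWeakPartial.inner hd hΩ (fun k => (hDy k i).1) (fun k => (hν k a).1) (Dy2 i)
      (ν2 a) (fun k => DDy2 k i) (fun k => Dν2 k a) k
    have h2 := (h1.congr hΩ (g := fun _ => (0 : ℝ)) (hae.mono fun x hx => hx.2.2.1 i a)
      (Eventually.of_forall fun _ => rfl)).unique hΩ (ContDiffOn.weakPD hΩ contDiffOn_const k)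
    simpa [pd] using h2
  have hsymm' := ae_all_iff.2 fun i => ae_all_iff.2 (hsymm i)
  have hmetric' := ae_all_iff.2 fun k => ae_all_iff.2 fun i => ae_all_iff.2 (hmetric k i)
  have hnormal' := ae_all_iff.2 fun k => ae_all_iff.2 fun i => ae_all_iff.2 (hnormal k i)
  refine ⟨Dy, hy, fun i j => (hDy i j).1.congr hΩ ?_, fun k b => (hν k b).1.congr hΩ ?_,
    hae.mono fun x hx => ⟨hx.1, hx.2.1, hx.2.2.1⟩⟩
  · filter_upwards [hae, hsymm', hmetric', ae_restrict_mem hΩ.measurableSet]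
      with x ⟨x1, x2, x3, x4, x5⟩ xs xm hxΩ
    refine eq_of_inner_frame_eq (hg.posDef x hxΩ) x1 x2 x3 (fun l => ?_) fun a => ?_
    · have x3' : ∀ a, inner ℝ (ν a x) (Dy l x) = 0 := fun a => by
        rw [real_inner_comm]; exact x3 l a
      simp only [inner_add_left, sum_inner, real_inner_smul_left, x1, x3', mul_zero,
        Finset.sum_const_zero, add_zero]
      -- Koszul's argument: in the alternating sum of the three metric derivatives, symmetry of
      -- second derivatives leaves twice the wanted product.
      rw [sum_christoffel_mul (hg.posDef x hxΩ), ← xm j i l, ← xm i j l, ← xm l i j,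
        real_inner_comm (DDy j l x), real_inner_comm (DDy i l x), real_inner_comm (DDy l j x),
        xs j i, xs j l, xs l i]
      ring
    · simp [inner_add_left, sum_inner, real_inner_smul_left, x2, x3, x4]
  · filter_upwards [hae, hnormal', ae_restrict_mem hΩ.measurableSet]
      with x ⟨x1, x2, x3, x4, x5⟩ xn hxΩ
    refine eq_of_inner_frame_eq (hg.posDef x hxΩ) x1 x2 x3 (fun l => ?_) fun a => ?_
    · have x3' : ∀ a, inner ℝ (ν a x) (Dy l x) = 0 := fun a => by
        rw [real_inner_comm]; exact x3 l a
      have hinv : ∀ j, ∑ i, (g x)⁻¹ i j * g x i l = if l = j then 1 else 0 := fun j => by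
        have hdet := isUnit_iff_ne_zero.2 (hg.posDef x hxΩ).det_pos.ne'
        have := congrFun (congrFun (Matrix.mul_nonsing_inv (g x) hdet) l) j
        rw [Matrix.mul_apply, Matrix.one_apply] at this
        rw [← this]
        refine Finset.sum_congr rfl fun i _ => ?_
        rw [mul_comm, ← (hg.posDef x hxΩ).isHermitian.apply i l, star_trivial]
      simp only [inner_add_left, sum_inner, real_inner_smul_left, x1, x3', mul_zero,
        Finset.sum_const_zero, add_zero]
      rw [Finset.sum_comm]
      have e : ∀ j, ∑ i, -((g x)⁻¹ i j * u.h b k j x) * g x i l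
          = -((∑ i, (g x)⁻¹ i j * g x i l) * u.h b k j x) := by
        intro j
        rw [Finset.sum_mul, ← Finset.sum_neg_distrib]
        exact Finset.sum_congr rfl fun i _ => by ring
      simp only [e, hinv, ite_mul, one_mul, zero_mul, Finset.sum_neg_distrib, Finset.sum_ite_eq,
        Finset.mem_univ, if_true]
      -- Differentiated orthogonality gives the tangential part of `∂_k ν_b` as minus the second
      -- fundamental form.
      have := xn k l b
      rw [x4, real_inner_comm]
      linarith
    · simp [inner_add_left, sum_inner, real_inner_smul_left, x2, x3, x5]

end

section


variable {d m N : ℕ} {Ω : Set (Space d)} {p : ℝ} {C : ℝ≥0}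
  {g : Space d → Matrix (Fin d) (Fin d) ℝ}

/-! ### From the Gauss-Weingarten equations to isometric immersions -/

lemma LpLoc.add {F : Type*} [NormedAddCommGroup F] {q : ℝ} {f g : Space d → F}
    (hf : LpLoc Ω q f) (hg : LpLoc Ω q g) : LpLoc Ω q fun x => f x + g x :=
  fun K hK hKΩ => (hf K hK hKΩ).add (hg K hK hKΩ)

lemma LpLoc.sum {F ι : Type*} [NormedAddCommGroup F] {q : ℝ} (s : Finset ι) {f : ι → Space d → F}
    (hf : ∀ i, LpLoc Ω q (f i)) : LpLoc Ω q fun x => ∑ i ∈ s, f i x :=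
  fun K hK hKΩ => memLp_finsetSum _ fun i _ => hf i K hK hKΩ

lemma LpLoc.smul {F : Type*} [NormedAddCommGroup F] [NormedSpace ℝ F] {q : ℝ}
    {b c : Space d → ℝ} {f : Space d → F} (hb : LpLoc Ω q b) (hf : LocallyIntegrableOn f Ω)
    (hc : ContinuousOn c Ω) (h : ∀ᵐ x ∂(volume.restrict Ω), ‖f x‖ ≤ c x) :
    LpLoc Ω q fun x => b x • f x := by
  intro K hK hKΩ
  obtain ⟨M, hM⟩ := hK.exists_bound_of_continuousOn (hc.mono hKΩ)
  refine (hb K hK hKΩ).of_le_mul (c := M) ((hb K hK hKΩ).aestronglyMeasurable.smul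
    (hf.integrableOn_compact_subset hKΩ hK).aestronglyMeasurable) ?_
  filter_upwards [ae_restrict_of_ae_restrict_of_subset hKΩ h, ae_restrict_mem hK.measurableSet]
    with x hx hxK
  rw [norm_smul, mul_comm]
  exact mul_le_mul_of_nonneg_right (hx.trans ((le_abs_self _).trans (hM x hxK))) (norm_nonneg _)

lemma ContinuousOn.lpLoc (hΩ : IsOpen Ω) {q : ℝ} {c : Space d → ℝ} (hc : ContinuousOn c Ω) :
    LpLoc Ω q c :=
  lpLoc_of_norm_le (hc.locallyIntegrableOn hΩ.measurableSet) hc.norm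
    (Eventually.of_forall fun _ => le_rfl)

/-- The right-hand sides of the equations are the required derivatives: an `L^p` or continuous
coefficient times a locally bounded frame vector is in `L^p_loc`, and products with the normals
return the coefficients. -/
theorem GaussWeingarten.isIsometricImmersion (hd : 0 < d) (hΩ : IsOpen Ω) (hg : IsMetricOn Ω g)
    {y : Space d → Space (d + m)} {ν : Fin m → Space d → Space (d + m)} {u : Field d m}
    {Dy : Fin d → Space d → Space (d + m)} (h : GaussWeingarten Ω g y ν u Dy)
    (hu : u.InLp Ω p) : IsIsometricImmersion Ω g p y ν u := by
  have hDn : ∀ i, ∀ᵐ x ∂(volume.restrict Ω), ‖Dy i x‖ ≤ √(g x i i) := fun i =>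
    h.frame.mono fun x hx => norm_le_sqrt_of_inner_self (hx.1 i i)
  have hνn : ∀ a, ∀ᵐ x ∂(volume.restrict Ω), ‖ν a x‖ ≤ √1 := fun a =>
    h.frame.mono fun x hx => norm_le_sqrt_of_inner_self (by simpa using hx.2.1 a a)
  have hDl : ∀ i, LocallyIntegrableOn (Dy i) Ω := fun i => (h.partial_y i).right
  have hνl : ∀ a, LocallyIntegrableOn (ν a) Ω := fun a => (h.partial_ν ⟨0, hd⟩ a).left
  have hgc : ∀ i, ContinuousOn (fun x => √(g x i i)) Ω := fun i =>
    (hg.contDiffOn i i).continuousOn.sqrt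
  have hh : ∀ a i j, LpLoc Ω p (u.h a i j) := fun a i j K _ hKΩ =>
    (hu.1 a i j).mono_measure (Measure.restrict_mono hKΩ le_rfl)
  have hκ : ∀ a k b, LpLoc Ω p (u.κ a k b) := fun a k b K _ hKΩ =>
    (hu.2 a k b).mono_measure (Measure.restrict_mono hKΩ le_rfl)
  refine ⟨Dy, _, _, h.partial_y, fun i j => ⟨h.partial_Dy i j, ?_⟩,
    fun k b => ⟨h.partial_ν k b, ?_⟩, ?_⟩
  · exact (LpLoc.sum _ fun k => (ContinuousOn.lpLoc hΩ
      (hg.continuousOn_christoffel hΩ k i j)).smul (hDl k) (hgc k) (hDn k)).add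
      (LpLoc.sum _ fun a => (hh a i j).smul (hνl a) continuousOn_const (hνn a))
  · refine (LpLoc.sum _ fun i => LpLoc.sum _ fun j => LpLoc.smul ?_ (hDl i) (hgc i) (hDn i)).add
      (LpLoc.sum _ fun a => (hκ a k b).smul (hνl a) continuousOn_const (hνn a))
    have hc := (hg.continuousOn_inv i j).neg
    refine fun K hK hKΩ => (((hh b k j).smul (hc.locallyIntegrableOn hΩ.measurableSet) hc.norm
      (Eventually.of_forall fun _ => le_rfl)) K hK hKΩ).ae_eq (Eventually.of_forall fun x => ?_)
    simp only [smul_eq_mul, Pi.neg_apply]; ring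
  · filter_upwards [h.frame] with x ⟨x1, x2, x3⟩
    exact ⟨x1, x2, x3, fun a i j => by simp [inner_add_left, sum_inner, real_inner_smul_left, x2, x3],
      fun a k b => by simp [inner_add_left, sum_inner, real_inner_smul_left, x2, x3]⟩

/-! ### Weak continuity of the Gauss-Weingarten equations -/

lemma DistribLimit.eval (hΩ : IsOpen Ω) {y : ℕ → Space d → Space N} {y₀ : Space d → Space N}
    (h : DistribLimit Ω y y₀) (q : Fin N) {φ : Space d → ℝ} (hφ : IsTest Ω φ) :
    Tendsto (fun n => ∫ x in Ω, φ x * y n x q) atTop (𝓝 (∫ x in Ω, φ x * y₀ x q)) := by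
  have h1 := ((EuclideanSpace.proj (𝕜 := ℝ) q).continuous.tendsto _).comp (h.tendsto φ hφ)
  rw [← hφ.eval_setIntegral hΩ h.lim]
  exact h1.congr fun n => hφ.eval_setIntegral hΩ (h.seq n) q

lemma locConv_const {f : Space d → ℝ} (hf : LocallyIntegrableOn f Ω) :
    LocConv Ω (fun _ => f) f := ⟨fun _ => hf, hf, fun _ _ => tendsto_const_nhds⟩

/-- The equations control the frame gradients in `L¹_loc`, and this control makes the products of
frame components with `h`, `κ` or other frame components converge to the products of the limits. The
weights `c` separate the growth of `∂y` near the boundary from the globally bounded factors `v`. -/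
theorem gaussWeingarten_of_tendsto [IsFiniteMeasure (volume.restrict Ω)] (hd : 0 < d)
    (hΩ : IsOpen Ω) (hp : 2 < p) (hg : IsMetricOn Ω g)
    {y : ℕ → Space d → Space (d + m)} {ν : ℕ → Fin m → Space d → Space (d + m)}
    {u : ℕ → Field d m} {Dy : ℕ → Fin d → Space d → Space (d + m)}
    (h : ∀ n, GaussWeingarten Ω g (y n) (ν n) (u n) (Dy n)) (hu : ∀ n, (u n).InLp Ω p)
    (hC : ∀ n, (u n).LpBound Ω p C) {c : Fin d → Space d → ℝ} (hc : ∀ i, ContinuousOn (c i) Ω)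
    {v : ℕ → Fin d → Fin (d + m) → Space d → ℝ} (hDv : ∀ n i x q, Dy n i x q = c i x * v n i q x)
    {y₀ : Space d → Space (d + m)} (hy : DistribLimit Ω y y₀) {u₀ : Field d m}
    (hw : WeakLimit Ω p u u₀) {v₀ : Fin d → Fin (d + m) → Space d → ℝ}
    (hv : ∀ i q, BddWeak Ω p C (fun n => v n i q) (v₀ i q))
    {ν₀ : Fin m → Fin (d + m) → Space d → ℝ}
    (hν : ∀ a q, BddWeak Ω p C (fun n x => ν n a x q) (ν₀ a q)) :
    GaussWeingarten Ω g y₀ (fun a x => WithLp.toLp 2 fun q => ν₀ a q x) u₀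
      fun i x => WithLp.toLp 2 fun q => c i x * v₀ i q x := by
  have hh := hw.bddWeak_h hu hC
  have hκ := hw.bddWeak_κ hu hC
  have hΓ := hg.continuousOn_christoffel hΩ
  have wDy : ∀ k i q n, WeakPD Ω k (fun x => c i x * v n i q x)
      fun x => (∑ r, christoffel g r k i x * (c r x * v n r q x))
        + ∑ a, (u n).h a k i x * ν n a x q := by
    intro k i q n
    refine ((hasWeakPartial_iff hΩ).1 ((h n).partial_Dy k i) q).congr hΩ
      (Eventually.of_forall fun x => hDv n i x q) (Eventually.of_forall fun x => ?_)
    simp [hDv]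
  have wν : ∀ k b q n, WeakPD Ω k (fun x => ν n b x q)
      fun x => (∑ i, ∑ j, -(g x)⁻¹ i j * (c i x * v n i q x * (u n).h b k j x))
        + ∑ a, (u n).κ a k b x * ν n a x q := by
    intro k b q n
    refine ((hasWeakPartial_iff hΩ).1 ((h n).partial_ν k b) q).congr hΩ
      (Eventually.of_forall fun x => rfl) (Eventually.of_forall fun x => ?_)
    simp only [PiLp.add_apply, WithLp.ofLp_sum, Finset.sum_apply, PiLp.smul_apply, smul_eq_mul, hDv]
    congr 1
    exact Finset.sum_congr rfl fun i _ => Finset.sum_congr rfl fun j _ => by ring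
  have bDy : ∀ k i q, LocBdd Ω fun n x => (∑ r, christoffel g r k i x * (c r x * v n r q x))
        + ∑ a, (u n).h a k i x * ν n a x q := fun k i q =>
    (LocBdd.sum _ fun r => ((locBdd_of_bdd hp (hv r q).mem (hv r q).bdd).continuousOn_mul hΩ
      (hc r)).continuousOn_mul hΩ (hΓ r k i)).add
    (LocBdd.sum _ fun a => locBdd_mul hp (hh a k i).mem (hh a k i).bdd (hν a q).mem (hν a q).bdd)
  have bν : ∀ k b q, LocBdd Ω fun n x =>
      (∑ i, ∑ j, -(g x)⁻¹ i j * (c i x * v n i q x * (u n).h b k j x))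
        + ∑ a, (u n).κ a k b x * ν n a x q := fun k b q =>
    (LocBdd.sum _ fun i => LocBdd.sum _ fun j => LocBdd.continuousOn_mul hΩ
      (by simpa only [mul_assoc] using (locBdd_mul hp (hv i q).mem (hv i q).bdd (hh b k j).mem
        (hh b k j).bdd).continuousOn_mul hΩ (hc i)) (hg.continuousOn_inv i j).neg).add
    (LocBdd.sum _ fun a => locBdd_mul hp (hκ a k b).mem (hκ a k b).bdd (hν a q).mem (hν a q).bdd)
  -- The second factor is left arbitrary: it is taken to be `h` in the Weingarten equation and again
  -- a frame component in the orthonormality relations.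
  have mulv : ∀ i q {f : ℕ → Space d → ℝ} {f₀ : Space d → ℝ}, BddWeak Ω p C f f₀ →
      LocConv Ω (fun n x => c i x * v n i q x * f n x) fun x => c i x * v₀ i q x * f₀ x :=
    fun i q f f₀ hf => locConv_mul_of_weakPD hd hΩ hp (hc i) (hv i q) hf (fun k => bDy k i q)
      fun k n => wDy k i q n
  have mulν : ∀ a q {f : ℕ → Space d → ℝ} {f₀ : Space d → ℝ}, BddWeak Ω p C f f₀ →
      LocConv Ω (fun n x => f n x * ν n a x q) fun x => f₀ x * ν₀ a q x := by
    intro a q f f₀ hf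
    have := locConv_mul_of_weakPD hd hΩ hp (c := fun _ => 1) continuousOn_const (hν a q) hf
      (fun k => bν k a q) fun k n => by simpa only [one_mul] using wν k a q n
    simp only [one_mul] at this
    exact this.congr hΩ (fun n => Eventually.of_forall fun x => mul_comm _ _)
      (Eventually.of_forall fun x => mul_comm _ _)
  have cv : ∀ i q, LocConv Ω (fun n x => c i x * v n i q x) fun x => c i x * v₀ i q x :=
    fun i q => ((hv i q).locConv hp).continuousOn_mul hΩ (hc i)
  refine ⟨fun i => (hasWeakPartial_iff hΩ).2 fun q => ?_, fun k i => (hasWeakPartial_iff hΩ).2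
    fun q => ?_, fun k b => (hasWeakPartial_iff hΩ).2 fun q => ?_, ?_⟩
  · refine weakPD_of_tendsto (f := fun n x => y n x q) (fun n => ?_)
      ((locallyIntegrableOn_iff_eval hΩ).1 hy.lim q) (fun φ hφ => hy.eval hΩ q hφ) (cv i q)
    simpa only [hDv] using (hasWeakPartial_iff hΩ).1 ((h n).partial_y i) q
  · refine (weakPD_of_tendsto (wDy k i q) (cv i q).lim
      (fun φ hφ => (cv i q).tendsto φ hφ.isContTest)
      ((LocConv.sum _ fun r => (cv r q).continuousOn_mul hΩ (hΓ r k i)).add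
        (LocConv.sum _ fun a => mulν a q (hh a k i)))).congr hΩ
      (Eventually.of_forall fun x => rfl) (Eventually.of_forall fun x => ?_)
    simp
  · refine (weakPD_of_tendsto (wν k b q) ((hν b q).locConv hp).lim
      (fun φ hφ => ((hν b q).locConv hp).tendsto φ hφ.isContTest)
      ((LocConv.sum _ fun i => LocConv.sum _ fun j => (mulv i q (hh b k j)).continuousOn_mul hΩ
        (hg.continuousOn_inv i j).neg).add
        (LocConv.sum _ fun a => mulν a q (hκ a k b)))).congr hΩ
      (Eventually.of_forall fun x => rfl) (Eventually.of_forall fun x => ?_)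
    simp only [PiLp.add_apply, WithLp.ofLp_sum, Finset.sum_apply, PiLp.smul_apply, smul_eq_mul,
      Pi.neg_apply]
    congr 1
    exact Finset.sum_congr rfl fun i _ => Finset.sum_congr rfl fun j _ => by ring
  -- Along the sequence each inner product equals a fixed function; it also converges to the inner
  -- product of the limits, and uniqueness of the limit identifies the two.
  · have f1 : ∀ i j, ∀ᵐ x ∂(volume.restrict Ω),
        ∑ q, c j x * (c i x * v₀ i q x * v₀ j q x) = g x i j := fun i j =>
      ((LocConv.sum _ fun q => (mulv i q (hv j q)).continuousOn_mul hΩ (hc j)).congr hΩ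
        (g := fun _ x => g x i j) (fun n => (h n).frame.mono fun x hx => by
          rw [← hx.1 i j, inner_eq_sum]
          exact Finset.sum_congr rfl fun q _ => by rw [hDv, hDv]; ring)
        (Eventually.of_forall fun x => rfl)).ae_eq hΩ
        (locConv_const ((hg.contDiffOn i j).continuousOn.locallyIntegrableOn hΩ.measurableSet))
    have f2 : ∀ a b, ∀ᵐ x ∂(volume.restrict Ω),
        ∑ q, ν₀ a q x * ν₀ b q x = if a = b then 1 else 0 := fun a b =>
      ((LocConv.sum _ fun q => mulν b q (hν a q)).congr hΩ
        (g := fun _ _ => if a = b then 1 else 0) (fun n => (h n).frame.mono fun x hx => by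
          rw [← hx.2.1 a b, inner_eq_sum]) (Eventually.of_forall fun x => rfl)).ae_eq hΩ
        (locConv_const ((locallyIntegrable_const _).locallyIntegrableOn _))
    have f3 : ∀ i a, ∀ᵐ x ∂(volume.restrict Ω), ∑ q, c i x * v₀ i q x * ν₀ a q x = 0 := fun i a =>
      ((LocConv.sum _ fun q => mulv i q (hν a q)).congr hΩ
        (g := fun _ _ => 0) (fun n => (h n).frame.mono fun x hx => by
          rw [← hx.2.2 i a, inner_eq_sum]
          exact Finset.sum_congr rfl fun q _ => by rw [hDv])
        (Eventually.of_forall fun x => rfl)).ae_eq hΩ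
        (locConv_const ((locallyIntegrable_const _).locallyIntegrableOn _))
    filter_upwards [ae_all_iff.2 fun i => ae_all_iff.2 (f1 i),
      ae_all_iff.2 fun a => ae_all_iff.2 (f2 a), ae_all_iff.2 fun i => ae_all_iff.2 (f3 i)]
      with x h1 h2 h3
    simp only [inner_eq_sum]
    refine ⟨fun i j => ?_, h2, h3⟩
    rw [← h1 i j]
    exact Finset.sum_congr rfl fun q _ => by ring

/-! ### Extraction of subsequences -/

/-- All components are packed into one finite family so that a single subsequence serves them all;
`w` leaves room for the frame of the immersions. -/
lemma exists_weakLimit_subseq [IsFiniteMeasure (volume.restrict Ω)] (hp : 2 < p)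
    {ι : Type*} [Finite ι] {u : ℕ → Field d m} (hu : ∀ n, (u n).InLp Ω p)
    (hC : ∀ n, (u n).LpBound Ω p C) {w : ℕ → ι → Space d → ℝ}
    (hw : ∀ n i, MemLp (w n i) (ENNReal.ofReal p) (volume.restrict Ω))
    (hwC : ∀ n i, eLpNorm (w n i) (ENNReal.ofReal p) (volume.restrict Ω) ≤ C) :
    ∃ (s : ℕ → ℕ) (u₀ : Field d m) (w₀ : ι → Space d → ℝ), StrictMono s ∧
      WeakLimit Ω p (fun n => u (s n)) u₀ ∧ ∀ i, BddWeak Ω p C (fun n => w (s n) i) (w₀ i) := by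
  let f : ℕ → ((Fin m × Fin d × Fin d) ⊕ (Fin m × Fin d × Fin m)) ⊕ ι → Space d → ℝ := fun n =>
    Sum.elim (Sum.elim (fun t => (u n).h t.1 t.2.1 t.2.2) fun t => (u n).κ t.1 t.2.1 t.2.2) (w n)
  obtain ⟨s, f₀, hs, h⟩ := exists_weakLp_subseq_family (f := f) (C := C) hp
    (by rintro n ((⟨a, i, j⟩ | ⟨a, k, b⟩) | i)
        exacts [(hu n).1 a i j, (hu n).2 a k b, hw n i])
    (by rintro n ((⟨a, i, j⟩ | ⟨a, k, b⟩) | i)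
        exacts [(hC n).1 a i j, (hC n).2 a k b, hwC n i])
  exact ⟨s, ⟨fun a i j => f₀ (.inl (.inl (a, i, j))), fun a k b => f₀ (.inl (.inr (a, k, b)))⟩,
    fun i => f₀ (.inr i), hs,
    ⟨⟨fun a i j => (h (.inl (.inl (a, i, j)))).1, fun a k b => (h (.inl (.inr (a, k, b)))).1⟩,
      fun a i j => (h (.inl (.inl (a, i, j)))).2.2, fun a k b => (h (.inl (.inr (a, k, b)))).2.2⟩,
    fun i => ⟨fun n => hw (s n) i, fun n => hwC (s n) i, (h (.inr i)).1, (h (.inr i)).2.2⟩⟩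

lemma Field.LpBound.mono {C' : ℝ≥0} {u : Field d m} (h : u.LpBound Ω p C) (hCC : C ≤ C') :
    u.LpBound Ω p C' :=
  ⟨fun a i j => (h.1 a i j).trans (by exact_mod_cast hCC),
    fun a k b => (h.2 a k b).trans (by exact_mod_cast hCC)⟩

theorem exists_isIsometricImmersion_subseq [IsFiniteMeasure (volume.restrict Ω)] (hd : 0 < d)
    (hΩ : IsOpen Ω) (hp : 2 < p) (hg : IsMetricOn Ω g)
    {y : ℕ → Space d → Space (d + m)} {ν : ℕ → Fin m → Space d → Space (d + m)}
    {u : ℕ → Field d m} {y₀ : Space d → Space (d + m)}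
    (h : ∀ n, IsIsometricImmersion Ω g p (y n) (ν n) (u n)) (hu : UniformlyBounded Ω p u)
    (hy : DistribLimit Ω y y₀) :
    ∃ (s : ℕ → ℕ) (ν₀ : Fin m → Space d → Space (d + m)) (u₀ : Field d m),
      StrictMono s ∧ WeakLimit Ω p (fun n => u (s n)) u₀ ∧
      IsIsometricImmersion Ω g p y₀ ν₀ u₀ := by
  obtain ⟨hu, C, hC⟩ := hu
  choose Dy hDy using fun n => (h n).exists_gaussWeingarten hd hΩ hp hg
  -- Since `|∂_i y|² = g_{ii}` may be unbounded near the boundary, `∂_i y` is divided by a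
  -- continuous majorant of its length; the `1 +` keeps the divisor positive at every point, also
  -- outside `Ω`.
  let c : Fin d → Space d → ℝ := fun i x => √(1 + |g x i i|)
  have hc : ∀ i, ContinuousOn (c i) Ω := fun i =>
    (continuousOn_const.add (hg.contDiffOn i i).continuousOn.abs).sqrt
  have hc0 : ∀ i x, 0 < c i x := fun i x => Real.sqrt_pos.2 (by positivity)
  let v : ℕ → Fin d → Fin (d + m) → Space d → ℝ := fun n i q x => (c i x)⁻¹ * Dy n i x q
  have hDl : ∀ n i q, LocallyIntegrableOn (fun x => Dy n i x q) Ω := fun n i q =>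
    (locallyIntegrableOn_iff_eval hΩ).1 ((hDy n).partial_y i).right q
  have hνl : ∀ n a q, LocallyIntegrableOn (fun x => ν n a x q) Ω := fun n a q =>
    (locallyIntegrableOn_iff_eval hΩ).1 ((hDy n).partial_ν ⟨0, hd⟩ a).left q
  let w : ℕ → ((Fin d × Fin (d + m)) ⊕ (Fin m × Fin (d + m))) → Space d → ℝ := fun n =>
    Sum.elim (fun t => v n t.1 t.2) fun t x => ν n t.1 x t.2
  have hwm : ∀ n t, AEStronglyMeasurable (w n t) (volume.restrict Ω) := by
    rintro n (⟨i, q⟩ | ⟨a, q⟩)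
    · exact (((hc i).inv₀ fun x _ => (hc0 i x).ne').aestronglyMeasurable hΩ.measurableSet).mul
        (hDl n i q).aestronglyMeasurable
    · exact (hνl n a q).aestronglyMeasurable
  have hw1 : ∀ n t, ∀ᵐ x ∂(volume.restrict Ω), ‖w n t x‖ ≤ 1 := by
    rintro n (⟨i, q⟩ | ⟨a, q⟩)
    · filter_upwards [(hDy n).frame] with x hx
      have h1 : ‖Dy n i x q‖ ≤ c i x := (PiLp.norm_apply_le _ q).trans
        ((norm_le_sqrt_of_inner_self (hx.1 i i)).trans (Real.sqrt_le_sqrt (by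
          linarith [le_abs_self (g x i i)])))
      change ‖(c i x)⁻¹ * Dy n i x q‖ ≤ 1
      rw [norm_mul, norm_inv, Real.norm_of_nonneg (hc0 i x).le]
      exact inv_mul_le_one_of_le₀ h1 (hc0 i x).le
    · filter_upwards [(hDy n).frame] with x hx
      refine (PiLp.norm_apply_le _ q).trans ?_
      have h1 := norm_le_sqrt_of_inner_self (hx.2.1 a a)
      simpa using h1
  -- This is the `L^p(Ω)` bound of a function bounded by one; its maximum with `C` serves the
  -- coefficients and the frame alike.
  have hfin : (volume.restrict Ω) Set.univ ^ (ENNReal.ofReal p).toReal⁻¹ * ENNReal.ofReal 1 ≠ ⊤ :=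
    ENNReal.mul_ne_top (ENNReal.rpow_ne_top_of_nonneg (by positivity) (measure_ne_top _ _))
      ENNReal.ofReal_ne_top
  obtain ⟨s, u₀, w₀, hs, hw, hb⟩ := exists_weakLimit_subseq (w := w) hp hu
    (fun n => (hC n).mono (le_max_left C (ENNReal.toNNReal _)))
    (fun n t => MemLp.of_bound (hwm n t) 1 (hw1 n t))
    (fun n t => (eLpNorm_le_of_ae_bound (hw1 n t)).trans
      ((ENNReal.coe_toNNReal hfin).symm.le.trans (by exact_mod_cast le_max_right C _)))
  refine ⟨s, _, u₀, hs, hw, (gaussWeingarten_of_tendsto hd hΩ hp hg (fun n => hDy (s n))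
    (fun n => hu (s n)) (fun n => (hC (s n)).mono (le_max_left C _)) hc
    (v := fun n => v (s n)) (fun n i x q => ?_)
    ⟨fun n => hy.seq (s n), hy.lim, fun φ hφ => (hy.tendsto φ hφ).comp hs.tendsto_atTop⟩ hw
    (fun i q => hb (.inl (i, q))) fun a q => hb (.inr (a, q))).isIsometricImmersion hd hΩ hg hw.inLp⟩
  change _ = c i x * ((c i x)⁻¹ * Dy (s n) i x q)
  rw [mul_inv_cancel_left₀ (hc0 i x).ne']

lemma isFiniteMeasure_restrict_of_isBounded (hΩb : Bornology.IsBounded Ω) :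
    IsFiniteMeasure (volume.restrict Ω) :=
  isFiniteMeasure_restrict.2 hΩb.measure_lt_top.ne

end

end GCR

end

/-! ### The weak continuity theorem -/

theorem theorem3p3 (d m : ℕ) (hd : 3 ≤ d) (Ω : Set (GCR.Space d)) (hΩ : IsOpen Ω)
    (hΩb : Bornology.IsBounded Ω) (g : GCR.Space d → Matrix (Fin d) (Fin d) ℝ)
    (hg : GCR.IsMetricOn Ω g) (p : ℝ) (hp : 2 < p) :
    (∀ σ : ℝ, σ = 1 ∨ σ = -1 → ∀ u : ℕ → GCR.Field d m,
      (∀ n, GCR.IsWeakSolution Ω g σ (u n)) → GCR.UniformlyBounded Ω p u →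
        (∀ u₀ : GCR.Field d m, GCR.WeakLimit Ω p u u₀ → GCR.IsWeakSolution Ω g σ u₀) ∧
        ∃ (s : ℕ → ℕ) (u₀ : GCR.Field d m), StrictMono s ∧
          GCR.WeakLimit Ω p (fun n => u (s n)) u₀ ∧ GCR.IsWeakSolution Ω g σ u₀) ∧
    (∀ (y : ℕ → GCR.Space d → GCR.Space (d + m))
      (ν : ℕ → Fin m → GCR.Space d → GCR.Space (d + m)) (u : ℕ → GCR.Field d m)
      (y₀ : GCR.Space d → GCR.Space (d + m)),
      (∀ n, GCR.IsIsometricImmersion Ω g p (y n) (ν n) (u n)) →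
      GCR.UniformlyBounded Ω p u → GCR.DistribLimit Ω y y₀ →
        ∃ (s : ℕ → ℕ) (ν₀ : Fin m → GCR.Space d → GCR.Space (d + m)) (u₀ : GCR.Field d m),
          StrictMono s ∧ GCR.WeakLimit Ω p (fun n => u (s n)) u₀ ∧
          GCR.IsIsometricImmersion Ω g p y₀ ν₀ u₀) := by
  have hd0 : 0 < d := by omega
  have := GCR.isFiniteMeasure_restrict_of_isBounded hΩb
  refine ⟨fun σ _ u hs hu => ⟨fun u₀ hw => hw.isWeakSolution hd0 hΩ hp hg hu hs, ?_⟩,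
    fun y ν u y₀ h hu hy => GCR.exists_isIsometricImmersion_subseq hd0 hΩ hp hg h hu hy⟩
  obtain ⟨hL, C, hC⟩ := hu
  -- There is no frame to carry along here, so the additional family is empty.
  obtain ⟨s, u₀, -, hs', hw, -⟩ := GCR.exists_weakLimit_subseq (ι := Empty) (w := fun _ => Empty.elim)
    hp hL hC (fun _ => Empty.rec) fun _ => Empty.rec
  exact ⟨s, u₀, hs', hw, hw.isWeakSolution hd0 hΩ hp hg
    ⟨fun n => hL (s n), C, fun n => hC (s n)⟩ fun n => hs (s n)⟩
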